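/- Let $d \ge 3$ be an integer and $p$ a prime number, and consider the rational map $$f = f_{d,p} \colon \mathbb{P}^2_{\overline{\mathbb Q}} \dashrightarrow \mathbb{P}^2_{\overline{\mathbb Q}},\qquad (x:y:z) \mapsto \Bigl(x^d - \tfrac{1}{p^{d-3}}\, y^2 z^{d-2} : x y^2 z^{d-3} : y^2 z^{d-2}\Bigr).$$ Write $I_f$ for its indeterminacy locus. For $i = 1, 2$ let $d_i(f) = \lim_{n\to\infty} \bigl((f^n)^*H^i \cdot H^{2-i}\bigr)^{1/n}$ be the $i$-th dynamical degree, where $H \subset \mathbb{P}^2$ is a line; thus $(f^n)^*H\cdot H$ is the algebraic degree of $f^n$ (the degree of the coordinates of $f^n$ after removal of common factors) and $(f^n)^*H^2$ is its topological degree $[\overline{\mathbb Q}(\mathbb{P}^2) : (f^n)^*\overline{\mathbb Q}(\mathbb{P}^2)]$. A dominant rational self-map of $\mathbb{P}^2$ is $q$-cohomologically hyperbolic if $q$ is the unique index in $\{1,2\}$ at which $d_i$ attains its maximum. A rational self-map $g$ of $\mathbb{P}^2$, with graph $\Gamma_g \subset \mathbb{P}^2\times\mathbb{P}^2$ (the Zariski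 closure of its graph on $\mathbb{P}^2\setminus I_g$) and projections $\pi_1, \pi_2 \colon \Gamma_g \to \mathbb{P}^2$, is finite over an open set $U \subset \mathbb{P}^2$ if $\pi_2^{-1}(U) \to U$ is a finite morphism and $\pi_2^{-1}(U) \cap \pi_1^{-1}(I_g) = \emptyset$. Let $(\mathbb{P}^2)_f^{\mathrm{back}}$ be the set of points $P$ such that for every $n \ge 1$ there is a Zariski open neighbourhood of $P$ over which $f^n$ is finite. 1. The limits $d_1(f)$ and $d_2(f)$ exist, $d_1(f) = d$ and $d_2(f) = 2$. In particular, $f$ is (dominant and) $1$-cohomologically hyperbolic. 2. Let $d = 4$, $p = 2$ and $P_0 = \bigl(\frac{1+\sqrt 3}{2} : \frac{1+\sqrt 3}{2} : 1\bigr)$, where $\sqrt 3 \in \overline{\mathbb Q}$ is a square root of $3$. Then $f(P_0) = P_0$, $P_0 \in (\mathbb{P}^2)_f^{\mathrm{back}}$, and there is a sequence of points $P_n \in (\mathbb{P}^2 \setminus I_f)(\overline{\mathbb Q})$, $n \ge 1$, such that $f(P_n) = P_{n-1}$ for all $n \ge 1$, the set $\{P_n \mid n \ge 0\}$ is Zariski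 dense in $\mathbb{P}^2$, and $\lim_{n\to\infty} h(P_n) = \infty$, where $h$ is the absolute logarithmic naive height on $\mathbb{P}^2(\overline{\mathbb Q})$. -/

import Mathlib

open MvPolynomial Filter Topology
open scoped LinearAlgebra.Projectivization

noncomputable section

namespace UnbddPreper

/-! ### Varieties as sets of points with regular functions -/

section Varieties

/-- The data generating a Zariski topology and a sheaf of regular functions on a set of points `X`:
a collection of pairs `(D, ψ)`, where `D` is a basic open set and `ψ` is a basic regular function
on `D` (only the values of `ψ` on `D` matter). -/
abbrev Basics (k : Type*) (X : Type*) := Set (Set X × (X → k))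

variable {k X Y : Type*}

/-- The topology generated by the basic open sets. -/
abbrev Basics.top (𝒳 : Basics k X) : TopologicalSpace X :=
  TopologicalSpace.generateFrom {D | ∃ ψ, (D, ψ) ∈ 𝒳}

/-- `T` is open in the subset `S`, for the induced topology. -/
def Basics.OpenIn (𝒳 : Basics k X) (S T : Set X) : Prop :=
  ∃ O, IsOpen[𝒳.top] O ∧ T = S ∩ O

/-- `φ` is regular on the subset `S` (with the induced structure): locally on `S`
it agrees with a basic regular function. -/
def Basics.RegularOn (𝒳 : Basics k X) (S : Set X) (φ : X → k) : Prop :=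
  ∀ x ∈ S, ∃ D ψ, (D, ψ) ∈ 𝒳 ∧ x ∈ D ∧ ∀ y ∈ S ∩ D, φ y = ψ y

/-- `u` restricts to a morphism `S → T`: it is continuous and pulls regular functions back to
regular functions. -/
def IsMorphism (𝒳 : Basics k X) (𝒴 : Basics k Y) (u : X → Y) (S : Set X) (T : Set Y) : Prop :=
  Set.MapsTo u S T ∧ ∀ D ψ, (D, ψ) ∈ 𝒴 →
    𝒳.OpenIn S (S ∩ u ⁻¹' D) ∧ 𝒳.RegularOn (S ∩ u ⁻¹' D) (ψ ∘ u)

/-- `S` and `T` are isomorphic. -/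
def AreIsomorphic (𝒳 : Basics k X) (𝒴 : Basics k Y) (S : Set X) (T : Set Y) : Prop :=
  ∃ (u : X → Y) (v : Y → X), IsMorphism 𝒳 𝒴 u S T ∧ IsMorphism 𝒴 𝒳 v T S ∧
    (∀ x ∈ S, v (u x) = x) ∧ ∀ y ∈ T, u (v y) = y

variable (k) in
/-- Affine space `𝔸ᵐ(k)`. -/
def affineSpace [Field k] (m : ℕ) : Basics k (Fin m → k) :=
  {q | ∃ A B : MvPolynomial (Fin m) k,
    q = ({x | eval x B ≠ 0}, fun x => eval x A / eval x B)}

/-- `S` is affine: isomorphic to a Zariski closed subset of some affine space. -/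
def Basics.IsAffine [Field k] (𝒳 : Basics k X) (S : Set X) : Prop :=
  ∃ (m : ℕ) (Z : Set (Fin m → k)), IsClosed[(affineSpace k m).top] Z ∧
    AreIsomorphic 𝒳 (affineSpace k m) S Z

/-- `g` restricts to a finite morphism `S → T`: `T` is covered by affine open subsets `W`
such that `g⁻¹(W)` is affine and `𝒪(g⁻¹(W))` is a finitely generated `𝒪(W)`-module. -/
def IsFiniteMorphism [Field k] (𝒳 : Basics k X) (𝒴 : Basics k Y) (g : X → Y)
    (S : Set X) (T : Set Y) : Prop :=
  IsMorphism 𝒳 𝒴 g S T ∧ ∀ Q ∈ T, ∃ W, Q ∈ W ∧ 𝒴.OpenIn T W ∧ 𝒴.IsAffine W ∧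
    𝒳.IsAffine (S ∩ g ⁻¹' W) ∧
    ∃ (r : ℕ) (b : Fin r → X → k), (∀ i, 𝒳.RegularOn (S ∩ g ⁻¹' W) (b i)) ∧
      ∀ φ, 𝒳.RegularOn (S ∩ g ⁻¹' W) φ →
        ∃ a : Fin r → Y → k, (∀ i, 𝒴.RegularOn W (a i)) ∧
          ∀ x ∈ S ∩ g ⁻¹' W, φ x = ∑ i, a i (g x) * b i x

end Varieties

/-! ### The projective plane and its rational self-maps -/

section Plane

variable (k : Type*) [Field k]

/-- The points of the projective plane. -/
abbrev P2 := ℙ k (Fin 3 → k)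

/-- The projective plane: the basic open sets are the `D₊(B)`, the basic regular functions are
quotients of homogeneous polynomials of the same degree. -/
def plane : Basics k (P2 k) :=
  {q | ∃ (e : ℕ) (A B : MvPolynomial (Fin 3) k), A.IsHomogeneous e ∧ B.IsHomogeneous e ∧
    q = ({P | eval P.rep B ≠ 0}, fun P => eval P.rep A / eval P.rep B)}

/-- The bidegree of the variables of `k[x₀, x₁, x₂, y₀, y₁, y₂]`. -/
def biweight : Fin 3 ⊕ Fin 3 → ℕ × ℕ := Sum.elim (fun _ => (1, 0)) (fun _ => (0, 1))

/-- The product `ℙ² × ℙ²`: the basic regular functions are quotients of bihomogeneous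
polynomials of the same bidegree. -/
def planeSq : Basics k (P2 k × P2 k) :=
  {q | ∃ (e : ℕ × ℕ) (A B : MvPolynomial (Fin 3 ⊕ Fin 3) k),
    A.IsWeightedHomogeneous biweight e ∧ B.IsWeightedHomogeneous biweight e ∧
    q = ({R | eval (Sum.elim R.1.rep R.2.rep) B ≠ 0}, fun R =>
      eval (Sum.elim R.1.rep R.2.rep) A / eval (Sum.elim R.1.rep R.2.rep) B)}

/-- Triples of polynomials; a nonzero triple `F` of homogeneous polynomials of the same degree
represents the rational map `(F₀ : F₁ : F₂)` from `ℙ²` to itself. -/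
abbrev Triple := Fin 3 → MvPolynomial (Fin 3) k

variable {k}

/-- `G` is a nonzero triple of homogeneous polynomials of degree `e` that represents the same
rational map as `F`. -/
def Represents (F G : Triple k) (e : ℕ) : Prop :=
  G ≠ 0 ∧ (∀ i, (G i).IsHomogeneous e) ∧ ∀ i j, F i * G j = F j * G i

/-- The rational map `F` is defined at `P` and its value there is `Q`. -/
def Sends (F : Triple k) (P Q : P2 k) : Prop :=
  ∃ (e : ℕ) (G : Triple k), Represents F G e ∧
    ∃ h : (fun i => eval P.rep (G i)) ≠ 0, Q = Projectivization.mk k _ h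

/-- The indeterminacy locus `I_f`. -/
def indet (F : Triple k) : Set (P2 k) := {P | ¬ ∃ Q, Sends F P Q}

/-- The rational map `F` is dominant. -/
def IsDominant (F : Triple k) : Prop :=
  @Dense _ (plane k).top {Q | ∃ P, Sends F P Q}

/-- The iterates of a rational map. -/
def iter (F : Triple k) : ℕ → Triple k
  | 0 => X
  | n + 1 => fun i => bind₁ (iter F n) (F i)

/-! ### Dynamical degrees -/

/-- The algebraic degree of a rational self-map of `ℙ²`: the integer `e` with `f^*𝒪(1) = 𝒪(e)`,
that is, the degree of a representative without common factor, which is the least degree of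
all representatives. -/
def algDegree (F : Triple k) : ℕ := sInf {e | ∃ G, Represents F G e}

/-- For a triple `F` with nonzero entries, the field generated over `k` by the quotients
`F i / F j`. -/
def quotField (F : Triple k) : IntermediateField k (FractionRing (MvPolynomial (Fin 3) k)) :=
  IntermediateField.adjoin k
    {q | ∃ i j, q = algebraMap (MvPolynomial (Fin 3) k) (FractionRing (MvPolynomial (Fin 3) k)) (F i)
      / algebraMap (MvPolynomial (Fin 3) k) (FractionRing (MvPolynomial (Fin 3) k)) (F j)}

/-- The topological degree `[k(ℙ²) : f^* k(ℙ²)]` of a rational self-map of `ℙ²`, which is the degree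
of the second projection of its graph. Here `k(ℙ²)` is generated by the quotients `xᵢ / xⱼ`, and
`f^* k(ℙ²)` by the quotients `Fᵢ / Fⱼ`. -/
def topDegree (F : Triple k) : ℕ := IntermediateField.relfinrank (quotField F) (quotField X)

/-- The intersection number `(f^* H^i · H^(2 - i))`, with `H` a line in `ℙ²`, computed on the graph
of `f`. -/
def degreeOf (F : Triple k) : ℕ → ℕ
  | 0 => 1
  | 1 => algDegree F
  | 2 => topDegree F
  | _ => 0

/-- The `i`-th dynamical degree `lim_n ((f^n)^* H^i · H^(2 - i))^(1/n)` exists and is `δ`. -/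
def HasDynDegree (F : Triple k) (i : ℕ) (δ : ℝ) : Prop :=
  Tendsto (fun n : ℕ => (degreeOf (iter F n) i : ℝ) ^ (1 / (n : ℝ))) atTop (𝓝 δ)

/-- The dominant rational map `F` is `q`-cohomologically hyperbolic: `q` is the unique index
in `{1, 2}` at which the dynamical degree is maximal. -/
def IsCohHyperbolic (F : Triple k) (q : ℕ) : Prop :=
  IsDominant F ∧ ∃ δ : ℕ → ℝ, (∀ i ∈ Finset.Icc 1 2, HasDynDegree F i (δ i)) ∧
    ∀ j, (j ∈ Finset.Icc 1 2 ∧ ∀ i ∈ Finset.Icc 1 2, δ i ≤ δ j) ↔ j = q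

/-! ### Finiteness over open sets -/

/-- The graph of a rational map: the Zariski closure in `ℙ² × ℙ²` of the graph on the domain. -/
def graph (F : Triple k) : Set (P2 k × P2 k) :=
  @closure _ (planeSq k).top {R | Sends F R.1 R.2}

/-- `F` is finite over `U`: the projection `g` of the graph to the target is finite over `U`, and
`g⁻¹(U)` does not meet the inverse image of the indeterminacy locus. -/
def FiniteOver (F : Triple k) (U : Set (P2 k)) : Prop :=
  IsFiniteMorphism (planeSq k) (plane k) Prod.snd (graph F ∩ Prod.snd ⁻¹' U) U ∧
    ∀ R ∈ graph F, R.2 ∈ U → R.1 ∉ indet F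

/-- The set of points `P` such that every iterate is finite over a neighbourhood of `P`. -/
def backLocus (F : Triple k) : Set (P2 k) :=
  {P | ∀ n, 1 ≤ n → ∃ U, IsOpen[(plane k).top] U ∧ P ∈ U ∧ FiniteOver (iter F n) U}

end Plane

/-! ### The field of algebraic numbers, the height and the map -/

/-- The field of algebraic numbers. -/
abbrev Qbar := AlgebraicClosure ℚ

/-- The field generated by the chosen homogeneous coordinates of `P`. -/
abbrev coordField (P : P2 Qbar) : IntermediateField ℚ Qbar :=
  IntermediateField.adjoin ℚ (Set.range P.rep)

instance coordFieldNumberField (P : P2 Qbar) : NumberField (coordField P) where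
  to_charZero := inferInstance
  to_finiteDimensional :=
    IntermediateField.finiteDimensional_adjoin fun x _ =>
      isAlgebraic_iff_isIntegral.mp ((AlgebraicClosure.isAlgebraic ℚ).isAlgebraic x)

/-- The (absolute logarithmic) naive height on `ℙ²(ℚ̄)`: the logarithmic height relative to a number
field containing homogeneous coordinates of `P`, divided by the degree of that field. -/
def naiveHeight (P : P2 Qbar) : ℝ :=
  Height.logHeight (fun i => (⟨P.rep i, IntermediateField.subset_adjoin ℚ _ ⟨i, rfl⟩⟩ : coordField P))
    / Module.finrank ℚ (coordField P)

/-- The map `(x : y : z) ↦ (x^d - p^(-(d-3)) y²z^(d-2) : xy²z^(d-3) : y²z^(d-2))`, for `d ≥ 3`. -/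
def fMap (d p : ℕ) : Triple Qbar :=
  ![X 0 ^ d - C (1 / (p : Qbar) ^ (d - 3)) * X 1 ^ 2 * X 2 ^ (d - 2),
    X 0 * X 1 ^ 2 * X 2 ^ (d - 3),
    X 1 ^ 2 * X 2 ^ (d - 2)]

/-- The point `(a : b : 1)`. -/
def affinePoint (a b : Qbar) : P2 Qbar :=
  Projectivization.mk Qbar ![a, b, 1] fun h => one_ne_zero (congrFun h 2)

end UnbddPreper

end

namespace UnbddPreper

/-! ### The algebraic degree of the iterates -/

section AlgebraicDegree

variable {d p : ℕ}

/-! In the chart `z = 1` the map is `(x, y) ↦ (x^d / y² - c, x)` with `c = p^(-(d-3))`. The second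
coordinate of an image is the first coordinate of its source, so an orbit is a single sequence
satisfying a second-order recurrence.

Degrees. The coordinates of every iterate have no common factor (`isRelPrime_iter_fMap`), so the
algebraic degree of `f^n` is `d^n`. The subfield `f^* k(ℙ²)` is `k(x, y²)`, of index 2 in `k(x, y)`,
and the tower law along the iterates gives topological degree `2^n` (`topDegree_iter`,
`topDegree_fMap`).

Finiteness, for `d = 4` and `p = 2`. Going back from `(a, b)` means solving `(a + 1/2) t² = b⁴` and
passing to `(b, t)`. The points for which no branch of length `n` meets `b = 0` or `a = -1/2` form a
principal open set (`exists_branchPolynomial`). Over it the intermediate coordinates are integral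
over the base: each square root has a denominator that is a unit by the Nullstellensatz, because a
character of the coordinate algebra is itself a regular chain (`isIntegralElem_tau`). Integrality
shows that closing the graph adds no point there (`graph_inter_eq_chainSet`) and that the projection
is finite (`isFiniteMorphism_snd_chainSet`). The fixed point `(α, α)`, with `α² = α + 1/2`, lies in
all these sets: 2-adically `|α| = √2 < |1/2|`, and all backward branches keep the absolute value
`√2` (`branchesRegular_of_absoluteValue`).

The orbit. Start with `α, α, -α, α` and continue with arbitrary roots. As `(2α - 1)² = 3`, the
number `-α + 1/2` is divisible by a prime above 3, so the next term acquires a pole there. From then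
on the logarithmic sizes satisfy `e (n+2) = 2 e (n+1) - e n / 2`, with irrational growth rate `1 +
√2/2` (`log_absoluteValue_orbit`). Irrationality gives distinct monomials eventually distinct 3-adic
sizes, so no curve contains the orbit (`dense_range_affinePoint`). The same growth at every place
above 3 makes the heights tend to infinity (`le_logHeight₁_orbit`, `le_naiveHeight`). -/

lemma coeff_ne_zero (hp : p.Prime) : (1 / (p : Qbar) ^ (d - 3)) ≠ 0 :=
  one_div_ne_zero (pow_ne_zero _ (Nat.cast_ne_zero.mpr hp.ne_zero))

lemma iter_succ {k : Type*} [Field k] (F : Triple k) (n : ℕ) (i : Fin 3) :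
    iter F (n + 1) i = bind₁ (iter F n) (F i) := rfl

lemma fMap_zero : fMap d p 0 =
    X 0 ^ d - C (1 / (p : Qbar) ^ (d - 3)) * X 1 ^ 2 * X 2 ^ (d - 2) := rfl

lemma fMap_one : fMap d p 1 = X 0 * X 1 ^ 2 * X 2 ^ (d - 3) := rfl

lemma fMap_two : fMap d p 2 = X 1 ^ 2 * X 2 ^ (d - 2) := rfl

lemma iter_fMap_succ_zero (n : ℕ) :
    iter (fMap d p) (n + 1) 0 = iter (fMap d p) n 0 ^ d -
      C (1 / (p : Qbar) ^ (d - 3)) * iter (fMap d p) n 1 ^ 2 * iter (fMap d p) n 2 ^ (d - 2) := by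
  rw [iter_succ, fMap_zero]
  simp only [map_sub, map_mul, map_pow, bind₁_X_right, bind₁_C_right]

lemma iter_fMap_succ_one (n : ℕ) :
    iter (fMap d p) (n + 1) 1 =
      iter (fMap d p) n 0 * iter (fMap d p) n 1 ^ 2 * iter (fMap d p) n 2 ^ (d - 3) := by
  rw [iter_succ, fMap_one]
  simp only [map_mul, map_pow, bind₁_X_right]

lemma iter_fMap_succ_two (n : ℕ) :
    iter (fMap d p) (n + 1) 2 = iter (fMap d p) n 1 ^ 2 * iter (fMap d p) n 2 ^ (d - 2) := by
  rw [iter_succ, fMap_two]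
  simp only [map_mul, map_pow, bind₁_X_right]

lemma iter_fMap_isHomogeneous (hd : 3 ≤ d) (n : ℕ) (i : Fin 3) :
    (iter (fMap d p) n i).IsHomogeneous (d ^ n) := by
  induction n generalizing i with
  | zero => exact isHomogeneous_X _ _
  | succ n ih =>
    have e1 : 0 + d ^ n * 2 + d ^ n * (d - 2) = d ^ (n + 1) := by
      rw [zero_add, ← mul_add, pow_succ]; congr 1; omega
    have e2 : d ^ n + d ^ n * 2 + d ^ n * (d - 3) = d ^ (n + 1) := by
      have : d ^ n + d ^ n * 2 + d ^ n * (d - 3) = d ^ n * (1 + 2 + (d - 3)) := by ring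
      rw [this, pow_succ]; congr 1; omega
    fin_cases i
    · change (iter (fMap d p) (n + 1) 0).IsHomogeneous _
      rw [iter_fMap_succ_zero]
      refine IsHomogeneous.sub (pow_succ d n ▸ (ih 0).pow d) ?_
      exact e1 ▸ (((isHomogeneous_C _ _).mul ((ih 1).pow 2)).mul ((ih 2).pow (d - 2)))
    · change (iter (fMap d p) (n + 1) 1).IsHomogeneous _
      rw [iter_fMap_succ_one]
      exact e2 ▸ (((ih 0).mul ((ih 1).pow 2)).mul ((ih 2).pow (d - 3)))
    · change (iter (fMap d p) (n + 1) 2).IsHomogeneous _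
      rw [iter_fMap_succ_two]
      rw [zero_add] at e1
      exact e1 ▸ (((ih 1).pow 2).mul ((ih 2).pow (d - 2)))

/-- The point `(1 : 0 : 0)` is fixed by `f`; this is the cheapest witness that the first coordinate
of an iterate is a nonzero polynomial. -/
lemma eval_iter_fMap (n : ℕ) :
    eval ![1, 0, 0] (iter (fMap d p) n 0) = 1 ∧ eval ![1, 0, 0] (iter (fMap d p) n 1) = 0 ∧
      eval ![1, 0, 0] (iter (fMap d p) n 2) = 0 := by
  induction n with
  | zero => simp [iter]
  | succ n ih =>
    obtain ⟨h0, h1, h2⟩ := ih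
    rw [iter_fMap_succ_zero, iter_fMap_succ_one, iter_fMap_succ_two]
    simp [h0, h1, h2]

lemma iter_fMap_zero_ne_zero (n : ℕ) : iter (fMap d p) n 0 ≠ 0 := fun h => by
  have := (eval_iter_fMap (d := d) (p := p) n).1
  simp [h] at this

lemma isRelPrime_X_X {i j : Fin 3} (h : i ≠ j) :
    IsRelPrime (X i : MvPolynomial (Fin 3) Qbar) (X j) := by
  rw [Irreducible.isRelPrime_iff_not_dvd (X_prime (R := Qbar)).irreducible]
  intro hd
  rw [X_dvd_X] at hd
  tauto

/-- With coordinates `A, B, D`, the next first coordinate is `A^d - c B² D^(d-2)`. A factor shared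
with `B` or `D` divides `A^d`, and one shared with `A` divides `c B² D^(d-2)`; both contradict the
induction hypothesis. Coprimality of `B` and `D` is neither needed nor preserved. -/
lemma isRelPrime_iter_fMap (hd : 3 ≤ d) (hp : p.Prime) (n : ℕ) :
    IsRelPrime (iter (fMap d p) n 0) (iter (fMap d p) n 1) ∧
      IsRelPrime (iter (fMap d p) n 0) (iter (fMap d p) n 2) := by
  induction n with
  | zero => exact ⟨isRelPrime_X_X (by decide), isRelPrime_X_X (by decide)⟩
  | succ n ih =>
    obtain ⟨h1, h2⟩ := ih
    rw [iter_fMap_succ_zero, iter_fMap_succ_one, iter_fMap_succ_two]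
    set A := iter (fMap d p) n 0
    set B := iter (fMap d p) n 1
    set D := iter (fMap d p) n 2
    have hu : IsUnit (C (1 / (p : Qbar) ^ (d - 3)) : MvPolynomial (Fin 3) Qbar) :=
      (isUnit_iff_ne_zero.mpr (coeff_ne_zero hp)).map C
    have hT : C (1 / (p : Qbar) ^ (d - 3)) * B ^ 2 * D ^ (d - 2) =
      B * (C (1 / (p : Qbar) ^ (d - 3)) * B * D ^ (d - 2)) := by ring
    have hT' : C (1 / (p : Qbar) ^ (d - 3)) * B ^ 2 * D ^ (d - 2) =
      D * (C (1 / (p : Qbar) ^ (d - 3)) * B ^ 2 * D ^ (d - 3)) := by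
      have : D ^ (d - 2) = D ^ (d - 3) * D := by rw [← pow_succ]; congr 1; omega
      rw [this]; ring
    have kA : IsRelPrime (A ^ d - C (1 / (p : Qbar) ^ (d - 3)) * B ^ 2 * D ^ (d - 2)) A := by
      intro q hq hA
      have h3 : q ∣ C (1 / (p : Qbar) ^ (d - 3)) * B ^ 2 * D ^ (d - 2) :=
        (dvd_sub_right (dvd_pow hA (by omega))).mp hq
      have : IsRelPrime A (C (1 / (p : Qbar) ^ (d - 3)) * B ^ 2 * D ^ (d - 2)) :=
        (hu.isRelPrime_right.mul_right h1.pow_right).mul_right h2.pow_right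
      exact this hA h3
    have kB : IsRelPrime (A ^ d - C (1 / (p : Qbar) ^ (d - 3)) * B ^ 2 * D ^ (d - 2)) B := by
      intro q hq hB
      rw [hT] at hq
      exact h1.pow_left ((dvd_sub_left (hB.mul_right _)).mp hq) hB
    have kD : IsRelPrime (A ^ d - C (1 / (p : Qbar) ^ (d - 3)) * B ^ 2 * D ^ (d - 2)) D := by
      intro q hq hB
      rw [hT'] at hq
      exact h2.pow_left ((dvd_sub_left (hB.mul_right _)).mp hq) hB
    exact ⟨(kA.mul_right kB.pow_right).mul_right kD.pow_right, kB.pow_right.mul_right kD.pow_right⟩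

/-- The coordinates of the iterates have no common factor, so that every other representative is
a multiple of them. -/
lemma Represents.exists_eq_mul (hd : 3 ≤ d) (hp : p.Prime) {n e : ℕ} {G : Triple Qbar}
    (hG : Represents (iter (fMap d p) n) G e) : ∃ q, ∀ i, G i = q * iter (fMap d p) n i := by
  obtain ⟨-, -, hc⟩ := hG
  obtain ⟨q, hq⟩ : iter (fMap d p) n 0 ∣ G 0 :=
    (isRelPrime_iter_fMap hd hp n).1.dvd_of_dvd_mul_left (Dvd.intro _ (hc 0 1))
  refine ⟨q, fun i => mul_left_cancel₀ (iter_fMap_zero_ne_zero (d := d) (p := p) n) ?_⟩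
  rw [hc 0 i, hq]; ring

lemma represents_iter_fMap (hd : 3 ≤ d) (n : ℕ) :
    Represents (iter (fMap d p) n) (iter (fMap d p) n) (d ^ n) :=
  ⟨fun h => iter_fMap_zero_ne_zero (d := d) (p := p) n (congrFun h 0), iter_fMap_isHomogeneous hd n,
    fun _ _ => mul_comm _ _⟩

lemma algDegree_iter_fMap (hd : 3 ≤ d) (hp : p.Prime) (n : ℕ) :
    algDegree (iter (fMap d p) n) = d ^ n := by
  refine le_antisymm (Nat.sInf_le ⟨_, represents_iter_fMap hd n⟩) ?_
  refine le_csInf ⟨_, _, represents_iter_fMap hd n⟩ ?_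
  rintro e ⟨G, hG⟩
  obtain ⟨q, hq⟩ := hG.exists_eq_mul hd hp
  have hA := iter_fMap_zero_ne_zero (d := d) (p := p) n
  have hq0 : q ≠ 0 := by
    rintro rfl
    exact hG.1 (funext fun i => by rw [hq i]; simp)
  have h0 : G 0 ≠ 0 := by rw [hq 0]; exact mul_ne_zero hq0 hA
  rw [← (hG.2.1 0).totalDegree h0, hq 0, totalDegree_mul_of_isDomain hq0 hA,
    (iter_fMap_isHomogeneous hd n 0).totalDegree hA]
  omega

end AlgebraicDegree

end UnbddPreper

namespace UnbddPreper

/-! ### The topological degree of the iterates -/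

section TopologicalDegree

lemma eval_bind₁_eq {k σ τ : Type*} [CommSemiring k] (v : τ → k) (F : σ → MvPolynomial τ k)
    (Q : MvPolynomial σ k) : eval v (bind₁ F Q) = eval (fun i => eval v (F i)) Q := by
  induction Q using MvPolynomial.induction_on with
  | C a => simp
  | add p q hp hq => simp [hp, hq]
  | mul_X p i hp => simp [hp]

variable {d p : ℕ}

/-- The map can be inverted by radicals: `x^d` is the first coordinate plus `c` times the third, the
ratio of the last two coordinates is `x / z`, and then the third coordinate determines `y²`. -/
lemma exists_eval_fMap_eq (hd : 3 ≤ d) {a b e : Qbar}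
    (ha : a + 1 / (p : Qbar) ^ (d - 3) * e ≠ 0) (hb : b ≠ 0) (he : e ≠ 0) :
    ∃ v : Fin 3 → Qbar, (fun i => eval v (fMap d p i)) = ![a, b, e] := by
  obtain ⟨x, hx⟩ := IsAlgClosed.exists_pow_nat_eq (a + 1 / (p : Qbar) ^ (d - 3) * e)
    (show 0 < d by omega)
  have hx0 : x ≠ 0 := by
    rintro rfl
    exact ha (by rw [← hx, zero_pow (by omega)])
  have hz : x * e / b ≠ 0 := div_ne_zero (mul_ne_zero hx0 he) hb
  obtain ⟨y, hy⟩ := IsAlgClosed.exists_pow_nat_eq (e / (x * e / b) ^ (d - 2)) two_pos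
  have hy' : y ^ 2 * (x * e / b) ^ (d - 2) = e := by
    rw [hy, div_mul_cancel₀ _ (pow_ne_zero _ hz)]
  have hpow : (x * e / b) ^ (d - 2) = (x * e / b) ^ (d - 3) * (x * e / b) := by
    rw [← pow_succ]; congr 1; omega
  refine ⟨![x, y, x * e / b], funext fun i => ?_⟩
  fin_cases i
  · change eval _ (fMap d p 0) = a
    rw [fMap_zero]
    simp only [map_sub, map_mul, map_pow, eval_X, eval_C, Matrix.cons_val, mul_assoc, hy', hx]
    ring
  · change eval _ (fMap d p 1) = b
    rw [fMap_one]
    simp only [map_mul, map_pow, eval_X, Matrix.cons_val]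
    refine mul_right_cancel₀ hz ?_
    have : x * y ^ 2 * (x * e / b) ^ (d - 3) * (x * e / b) = x * e := by
      rw [mul_assoc, ← hpow, mul_assoc, hy']
    rw [this]; field_simp
  · change eval _ (fMap d p 2) = e
    rw [fMap_two]
    simpa only [map_mul, map_pow, eval_X, Matrix.cons_val] using hy'

/-- The product of the linear forms whose complement is contained in the image of the map. -/
noncomputable def imageForm (d p : ℕ) : MvPolynomial (Fin 3) Qbar :=
  (X 0 + C (1 / (p : Qbar) ^ (d - 3)) * X 2) * X 1 * X 2

lemma imageForm_ne_zero : imageForm d p ≠ 0 := fun h => by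
  have h1 := congrArg (eval ![1 - 1 / (p : Qbar) ^ (d - 3), 1, 1]) h
  simp [imageForm] at h1

lemma exists_eval_fMap_eq_of_imageForm (hd : 3 ≤ d) {w : Fin 3 → Qbar}
    (hw : eval w (imageForm d p) ≠ 0) :
    ∃ v : Fin 3 → Qbar, (fun i => eval v (fMap d p i)) = w := by
  simp only [imageForm, map_mul, map_add, eval_X, eval_C, ne_eq, mul_eq_zero, not_or] at hw
  obtain ⟨v, hv⟩ := exists_eval_fMap_eq hd hw.1.1 hw.1.2 hw.2
  refine ⟨v, hv.trans (funext fun i => ?_)⟩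
  fin_cases i <;> rfl

/-- A polynomial killed by the substitution vanishes on the image, which contains the complement of
the hypersurface `imageForm = 0`. -/
lemma bind₁_fMap_injective (hd : 3 ≤ d) : Function.Injective (bind₁ (fMap d p)) := by
  rw [injective_iff_map_eq_zero]
  intro Q hQ
  have : imageForm d p * Q = 0 := by
    refine MvPolynomial.funext fun w => ?_
    by_cases hw : eval w (imageForm d p) = 0
    · simp [hw]
    · obtain ⟨v, rfl⟩ := exists_eval_fMap_eq_of_imageForm hd hw
      rw [map_mul, ← eval_bind₁_eq v (fMap d p) Q, hQ]
      simp
  exact (mul_eq_zero.mp this).resolve_left imageForm_ne_zero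

/-- The field of rational functions on affine space of dimension three. -/
abbrev RatFun := FractionRing (MvPolynomial (Fin 3) Qbar)

/-- The inclusion of the polynomials into the rational functions. -/
noncomputable abbrev toRat : MvPolynomial (Fin 3) Qbar →ₐ[Qbar] RatFun :=
  Algebra.algHom Qbar (MvPolynomial (Fin 3) Qbar) RatFun

lemma toRat_injective : Function.Injective toRat :=
  IsFractionRing.injective (MvPolynomial (Fin 3) Qbar) RatFun

/-- The endomorphism of the field of rational functions given by an injective substitution. -/
noncomputable def substHom (F : Triple Qbar) (hF : Function.Injective (bind₁ F)) :
    RatFun →ₐ[Qbar] RatFun :=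
  IsFractionRing.liftAlgHom (A := MvPolynomial (Fin 3) Qbar) (g := toRat.comp (bind₁ F))
    (toRat_injective.comp hF)

lemma substHom_toRat (F : Triple Qbar) (hF : Function.Injective (bind₁ F))
    (Q : MvPolynomial (Fin 3) Qbar) : substHom F hF (toRat Q) = toRat (bind₁ F Q) := by
  exact IsFractionRing.lift_algebraMap (A := MvPolynomial (Fin 3) Qbar)
    (g := (toRat.comp (bind₁ F)).toRingHom) (toRat_injective.comp hF) Q

lemma substHom_pow_toRat (F : Triple Qbar) (hF : Function.Injective (bind₁ F)) (n : ℕ)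
    (Q : MvPolynomial (Fin 3) Qbar) :
    (substHom F hF ^ n) (toRat Q) = toRat (bind₁ (iter F n) Q) := by
  induction n generalizing Q with
  | zero => simp [iter]
  | succ n ih =>
    rw [pow_succ, AlgHom.mul_apply, substHom_toRat, ih, bind₁_bind₁]
    rfl

lemma quotField_iter_add (F : Triple Qbar) (hF : Function.Injective (bind₁ F)) (G : Triple Qbar)
    (n : ℕ) : quotField (fun i => bind₁ (iter F n) (G i)) = (quotField G).map (substHom F hF ^ n) := by
  rw [quotField, quotField, IntermediateField.adjoin_map]
  congr 1
  ext q
  constructor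
  · rintro ⟨i, j, rfl⟩
    refine ⟨_, ⟨i, j, rfl⟩, ?_⟩
    rw [map_div₀]
    exact congrArg₂ (· / ·) (substHom_pow_toRat F hF n _) (substHom_pow_toRat F hF n _)
  · rintro ⟨_, ⟨i, j, rfl⟩, rfl⟩
    refine ⟨i, j, ?_⟩
    rw [map_div₀]
    exact congrArg₂ (· / ·) (substHom_pow_toRat F hF n _) (substHom_pow_toRat F hF n _)

lemma quotField_iter (F : Triple Qbar) (hF : Function.Injective (bind₁ F)) (n : ℕ) :
    quotField (iter F n) = (quotField X).map (substHom F hF ^ n) := by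
  rw [← quotField_iter_add]
  simp

lemma quotField_iter_succ (F : Triple Qbar) (hF : Function.Injective (bind₁ F)) (n : ℕ) :
    quotField (iter F (n + 1)) = (quotField F).map (substHom F hF ^ n) :=
  quotField_iter_add F hF F n

/-- Each step of the tower `k(ℙ²) ⊇ f^* k(ℙ²) ⊇ (f²)^* k(ℙ²) ⊇ …` is the image of the first one
under an injective power of `f^*`, so all relative degrees agree and multiply. -/
lemma topDegree_iter (F : Triple Qbar) (hF : Function.Injective (bind₁ F))
    (hle : quotField F ≤ quotField X) (n : ℕ) : topDegree (iter F n) = topDegree F ^ n := by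
  suffices h : topDegree (iter F n) = topDegree F ^ n ∧ quotField (iter F n) ≤ quotField X from h.1
  induction n with
  | zero => exact ⟨IntermediateField.relfinrank_self _, le_rfl⟩
  | succ n ih =>
    have h1 : quotField (iter F (n + 1)) ≤ quotField (iter F n) := by
      rw [quotField_iter_succ F hF, quotField_iter F hF]
      exact IntermediateField.map_mono _ hle
    refine ⟨?_, h1.trans ih.2⟩
    rw [topDegree, ← IntermediateField.relfinrank_mul_relfinrank h1 ih.2,
      quotField_iter_succ F hF, quotField_iter F hF n, IntermediateField.relfinrank_map_map,
      ← quotField_iter F hF n, ← topDegree, ← topDegree, ih.1, pow_succ, mul_comm]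

/-- The change of sign of the second coordinate. -/
noncomputable def negSecond : Triple Qbar := ![X 0, -X 1, X 2]

lemma bind₁_negSecond_injective : Function.Injective (bind₁ negSecond) := by
  have : Function.LeftInverse (bind₁ negSecond) (bind₁ negSecond) := fun Q => by
    rw [bind₁_bind₁]
    have h : (fun i => bind₁ negSecond (negSecond i)) = X := by
      funext i
      fin_cases i <;> simp [negSecond]
    rw [h]; simp
  exact this.injective

lemma bind₁_negSecond_fMap (i : Fin 3) : bind₁ negSecond (fMap d p i) = fMap d p i := by
  fin_cases i
  · change bind₁ negSecond (fMap d p 0) = fMap d p 0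
    rw [fMap_zero]; simp [negSecond]
  · change bind₁ negSecond (fMap d p 1) = fMap d p 1
    rw [fMap_one]; simp [negSecond]
  · change bind₁ negSecond (fMap d p 2) = fMap d p 2
    rw [fMap_two]; simp [negSecond]

lemma toRat_X_ne_zero (i : Fin 3) : toRat (X i) ≠ 0 := fun h =>
  X_ne_zero i (toRat_injective (h.trans (map_zero _).symm))

lemma div_mem_quotField (F : Triple Qbar) (i j : Fin 3) :
    toRat (F i) / toRat (F j) ∈ quotField F :=
  IntermediateField.subset_adjoin _ _ ⟨i, j, rfl⟩

/-- The involution `y ↦ -y` fixes every coordinate of `f`, hence all of `quotField (fMap d p)`, but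
it moves `y / z`. -/
lemma toRat_second_not_mem_quotField_fMap : toRat (X 1) / toRat (X 2) ∉ quotField (fMap d p) := by
  intro h
  have hfix : ∀ q ∈ quotField (fMap d p),
      substHom negSecond bind₁_negSecond_injective q = q := by
    intro q hq
    induction hq using IntermediateField.adjoin_induction with
    | mem q hq =>
      obtain ⟨i, j, rfl⟩ := hq
      rw [map_div₀]
      refine congrArg₂ (· / ·) ?_ ?_
      · exact (substHom_toRat _ _ _).trans (congrArg _ (bind₁_negSecond_fMap i))
      · exact (substHom_toRat _ _ _).trans (congrArg _ (bind₁_negSecond_fMap j))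
    | algebraMap a => exact AlgHom.commutes _ a
    | add x y _ _ hx hy => rw [map_add, hx, hy]
    | inv x _ hx => rw [map_inv₀, hx]
    | mul x y _ _ hx hy => rw [map_mul, hx, hy]
  have h1 := hfix _ h
  rw [map_div₀, substHom_toRat, substHom_toRat, bind₁_X_right, bind₁_X_right] at h1
  simp only [negSecond, Matrix.cons_val, map_neg] at h1
  have h2 := toRat_X_ne_zero 1
  have h3 := toRat_X_ne_zero 2
  field_simp at h1
  exact two_ne_zero (α := RatFun) (by linear_combination -h1)

lemma toRat_fMap_zero : toRat (fMap d p 0) = toRat (X 0) ^ d -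
    algebraMap Qbar RatFun (1 / (p : Qbar) ^ (d - 3)) * toRat (X 1) ^ 2 * toRat (X 2) ^ (d - 2) := by
  rw [fMap_zero, map_sub, map_mul, map_mul, map_pow, map_pow, map_pow, ← algebraMap_eq,
    AlgHom.commutes]

lemma toRat_fMap_one : toRat (fMap d p 1) = toRat (X 0) * toRat (X 1) ^ 2 * toRat (X 2) ^ (d - 3) := by
  rw [fMap_one, map_mul, map_mul, map_pow, map_pow]

lemma toRat_fMap_two : toRat (fMap d p 2) = toRat (X 1) ^ 2 * toRat (X 2) ^ (d - 2) := by
  rw [fMap_two, map_mul, map_pow, map_pow]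

lemma toRat_fMap_two_ne_zero : toRat (fMap d p 2) ≠ 0 := by
  rw [toRat_fMap_two]
  exact mul_ne_zero (pow_ne_zero _ (toRat_X_ne_zero 1)) (pow_ne_zero _ (toRat_X_ne_zero 2))

lemma fMap_one_div_two (hd : 3 ≤ d) :
    toRat (fMap d p 1) / toRat (fMap d p 2) = toRat (X 0) / toRat (X 2) := by
  have h1 := toRat_X_ne_zero 1
  have h2 := toRat_X_ne_zero 2
  rw [toRat_fMap_one, toRat_fMap_two]
  have : toRat (X 2) ^ (d - 2) = toRat (X 2) ^ (d - 3) * toRat (X 2) := by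
    rw [← pow_succ]; congr 1; omega
  rw [this]
  field_simp

lemma fMap_zero_div_two (hd : 3 ≤ d) :
    toRat (fMap d p 0) / toRat (fMap d p 2) =
      (toRat (X 0) / toRat (X 2)) ^ d / (toRat (X 1) / toRat (X 2)) ^ 2 -
        algebraMap Qbar RatFun (1 / (p : Qbar) ^ (d - 3)) := by
  have h1 := toRat_X_ne_zero 1
  have h2 := toRat_X_ne_zero 2
  rw [toRat_fMap_zero, toRat_fMap_two]
  have : toRat (X 2) ^ d = toRat (X 2) ^ (d - 2) * toRat (X 2) ^ 2 := by
    rw [← pow_add]; congr 1; omega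
  rw [div_pow, div_pow, this]
  field_simp

lemma quotField_fMap_le (hd : 3 ≤ d) : quotField (fMap d p) ≤ quotField X := by
  have hu := div_mem_quotField X 0 2
  have hv := div_mem_quotField X 1 2
  have key : ∀ i, toRat (fMap d p i) / toRat (fMap d p 2) ∈ quotField X := by
    intro i
    fin_cases i
    · change toRat (fMap d p 0) / toRat (fMap d p 2) ∈ quotField X
      rw [fMap_zero_div_two hd]
      exact sub_mem (div_mem (pow_mem hu _) (pow_mem hv _)) (IntermediateField.algebraMap_mem _ _)
    · change toRat (fMap d p 1) / toRat (fMap d p 2) ∈ quotField X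
      rw [fMap_one_div_two hd]
      exact hu
    · change toRat (fMap d p 2) / toRat (fMap d p 2) ∈ quotField X
      rw [div_self toRat_fMap_two_ne_zero]
      exact one_mem _
  rw [quotField, IntermediateField.adjoin_le_iff]
  rintro _ ⟨i, j, rfl⟩
  have := div_mem (key i) (key j)
  rwa [div_div_div_cancel_right₀ toRat_fMap_two_ne_zero] at this

lemma first_mem_quotField_fMap (hd : 3 ≤ d) :
    toRat (X 0) / toRat (X 2) ∈ quotField (fMap d p) := by
  rw [← fMap_one_div_two (p := p) hd]
  exact div_mem_quotField _ _ _

/-- From `f₀ / f₂ + c = (x/z)^d / (y/z)²` and `x/z = f₁ / f₂`, one can solve for `(y/z)²`. -/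
lemma second_sq_mem_quotField_fMap (hd : 3 ≤ d) :
    (toRat (X 1) / toRat (X 2)) ^ 2 ∈ quotField (fMap d p) := by
  have h0 := div_ne_zero (toRat_X_ne_zero 0) (toRat_X_ne_zero 2)
  have h1 := div_ne_zero (toRat_X_ne_zero 1) (toRat_X_ne_zero 2)
  have h : (toRat (X 1) / toRat (X 2)) ^ 2 = (toRat (X 0) / toRat (X 2)) ^ d /
      (toRat (fMap d p 0) / toRat (fMap d p 2) +
        algebraMap Qbar RatFun (1 / (p : Qbar) ^ (d - 3))) := by
    rw [fMap_zero_div_two hd, sub_add_cancel, div_div_cancel₀ (pow_ne_zero _ h0)]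
  rw [h]
  exact div_mem (pow_mem (first_mem_quotField_fMap hd) _)
    (add_mem (div_mem_quotField _ _ _) (IntermediateField.algebraMap_mem _ _))

lemma quotField_X_eq (hd : 3 ≤ d) : quotField X =
    quotField (fMap d p) ⊔ IntermediateField.adjoin Qbar {toRat (X 1) / toRat (X 2)} := by
  refine le_antisymm ?_ (sup_le (quotField_fMap_le hd) ?_)
  · set M := quotField (fMap d p) ⊔ IntermediateField.adjoin Qbar {toRat (X 1) / toRat (X 2)}
    have h2 := toRat_X_ne_zero 2
    have key : ∀ i, toRat (X i) / toRat (X 2) ∈ M := by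
      intro i
      fin_cases i
      · exact (le_sup_left : _ ≤ M) (first_mem_quotField_fMap hd)
      · exact (le_sup_right : _ ≤ M) (IntermediateField.subset_adjoin _ _ rfl)
      · change toRat (X 2) / toRat (X 2) ∈ M
        rw [div_self h2]
        exact one_mem _
    rw [quotField, IntermediateField.adjoin_le_iff]
    rintro _ ⟨i, j, rfl⟩
    have := div_mem (key i) (key j)
    rwa [div_div_div_cancel_right₀ h2] at this
  · rw [IntermediateField.adjoin_le_iff]
    rintro _ rfl
    exact div_mem_quotField X 1 2

/-- `k(ℙ²)` is obtained from `f^* k(ℙ²)` by adjoining `y / z`, a square root of an element there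
that does not itself lie there. -/
lemma topDegree_fMap (hd : 3 ≤ d) : topDegree (fMap d p) = 2 := by
  set v := toRat (X 1) / toRat (X 2) with hv
  have hle := quotField_fMap_le (p := p) hd
  rw [topDegree, IntermediateField.relfinrank_eq_finrank_of_le hle]
  have he : IntermediateField.extendScalars hle =
      IntermediateField.adjoin (quotField (fMap d p)) {v} := by
    apply IntermediateField.restrictScalars_injective Qbar
    rw [IntermediateField.restrictScalars_adjoin_eq_sup, IntermediateField.extendScalars_restrictScalars,
      quotField_X_eq hd]
  set w : quotField (fMap d p) := ⟨v ^ 2, second_sq_mem_quotField_fMap hd⟩ with hw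
  have hroot : Polynomial.aeval v (Polynomial.X ^ 2 - Polynomial.C w) = 0 := by
    simp only [map_sub, map_pow, Polynomial.aeval_X, Polynomial.aeval_C]
    exact sub_self _
  have hmonic : (Polynomial.X ^ 2 - Polynomial.C w).Monic := Polynomial.monic_X_pow_sub_C _ two_ne_zero
  have hint : IsIntegral (quotField (fMap d p)) v := ⟨_, hmonic, hroot⟩
  rw [he, IntermediateField.adjoin.finrank hint]
  apply le_antisymm
  · refine (Polynomial.natDegree_le_of_dvd (minpoly.dvd _ _ hroot) hmonic.ne_zero).trans ?_
    rw [Polynomial.natDegree_X_pow_sub_C]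
  · rw [minpoly.two_le_natDegree_iff hint]
    rintro ⟨q, hq⟩
    exact toRat_second_not_mem_quotField_fMap (d := d) (p := p) (hv ▸ hq ▸ q.2)

end TopologicalDegree

/-! ### Dynamical degrees as limits of exact powers. -/

section DynamicalDegrees

variable {d p : ℕ}

lemma tendsto_pow_rpow_one_div (a : ℕ) :
    Tendsto (fun n : ℕ => ((a ^ n : ℕ) : ℝ) ^ (1 / (n : ℝ))) atTop (𝓝 a) := by
  refine tendsto_const_nhds.congr' ?_
  filter_upwards [eventually_ge_atTop 1] with n hn
  rw [Nat.cast_pow, one_div, Real.pow_rpow_inv_natCast (Nat.cast_nonneg _) (by omega)]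

lemma hasDynDegree_one (hd : 3 ≤ d) (hp : p.Prime) : HasDynDegree (fMap d p) 1 d := by
  have : (fun n : ℕ => (degreeOf (iter (fMap d p) n) 1 : ℝ) ^ (1 / (n : ℝ))) =
      fun n : ℕ => ((d ^ n : ℕ) : ℝ) ^ (1 / (n : ℝ)) := by
    funext n
    rw [degreeOf, algDegree_iter_fMap hd hp]
  rw [HasDynDegree, this]
  exact tendsto_pow_rpow_one_div d

lemma hasDynDegree_two (hd : 3 ≤ d) : HasDynDegree (fMap d p) 2 2 := by
  have : (fun n : ℕ => (degreeOf (iter (fMap d p) n) 2 : ℝ) ^ (1 / (n : ℝ))) =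
      fun n : ℕ => ((2 ^ n : ℕ) : ℝ) ^ (1 / (n : ℝ)) := by
    funext n
    rw [degreeOf, topDegree_iter _ (bind₁_fMap_injective hd) (quotField_fMap_le hd),
      topDegree_fMap hd]
  rw [HasDynDegree, this]
  exact_mod_cast tendsto_pow_rpow_one_div 2

end DynamicalDegrees

end UnbddPreper

namespace UnbddPreper

/-! ### Regular functions -/

section Regular

variable {k X Y : Type*} {𝒳 : Basics k X} {S : Set X} {φ ψ : X → k}

lemma Basics.RegularOn.mono {S' : Set X} (h : 𝒳.RegularOn S φ) (hS : S' ⊆ S) :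
    𝒳.RegularOn S' φ := fun x hx => by
  obtain ⟨D, ψ, hD, hxD, hψ⟩ := h x (hS hx)
  exact ⟨D, ψ, hD, hxD, fun y hy => hψ y ⟨hS hy.1, hy.2⟩⟩

lemma Basics.RegularOn.congr (h : 𝒳.RegularOn S φ) (he : ∀ x ∈ S, ψ x = φ x) :
    𝒳.RegularOn S ψ := fun x hx => by
  obtain ⟨D, ψ, hD, hxD, hψ⟩ := h x hx
  exact ⟨D, ψ, hD, hxD, fun y hy => (he y hy.1).trans (hψ y hy)⟩

lemma Basics.OpenIn.isOpen {T : Set X} (h : 𝒳.OpenIn S T) (hS : IsOpen[𝒳.top] S) :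
    IsOpen[𝒳.top] T := by
  obtain ⟨O, hO, rfl⟩ := h
  exact TopologicalSpace.GenerateOpen.inter _ _ hS hO

variable [Field k]

/-- The basic regular functions of `𝒳` are the quotients `A / B`, for `(A, B)` in a collection `Φ`
of pairs which is stable under the arithmetic of fractions. -/
structure Basics.IsFractions (𝒳 : Basics k X) (Φ : Set ((X → k) × (X → k))) : Prop where
  mem_iff : ∀ q, q ∈ 𝒳 ↔ ∃ A B, (A, B) ∈ Φ ∧ q = ({x | B x ≠ 0}, fun x => A x / B x)
  const_mem : ∀ c : k, (fun _ => c, fun _ => 1) ∈ Φ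
  mul_mem : ∀ {A B A' B'}, (A, B) ∈ Φ → (A', B') ∈ Φ → (A * A', B * B') ∈ Φ
  add_mem : ∀ {A B A' B'}, (A, B) ∈ Φ → (A', B') ∈ Φ → (A * B' + A' * B, B * B') ∈ Φ
  inv_mem : ∀ {A B}, (A, B) ∈ Φ → (B * B, A * B) ∈ Φ

variable {Φ : Set ((X → k) × (X → k))}

namespace Basics.IsFractions

variable (h𝒳 : 𝒳.IsFractions Φ)

include h𝒳

lemma regularOn_iff : 𝒳.RegularOn S φ ↔ ∀ x ∈ S, ∃ A B, (A, B) ∈ Φ ∧ B x ≠ 0 ∧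
    ∀ y ∈ S, B y ≠ 0 → φ y = A y / B y := by
  constructor
  · intro h x hx
    obtain ⟨D, ψ, hD, hxD, hψ⟩ := h x hx
    obtain ⟨A, B, hAB, he⟩ := (h𝒳.mem_iff _).mp hD
    obtain ⟨rfl, rfl⟩ := Prod.mk.inj he
    exact ⟨A, B, hAB, hxD, fun y hy hB => hψ y ⟨hy, hB⟩⟩
  · intro h x hx
    obtain ⟨A, B, hAB, hB, hφ⟩ := h x hx
    exact ⟨_, _, (h𝒳.mem_iff _).mpr ⟨A, B, hAB, rfl⟩, hB, fun y hy => hφ y hy.1 hy.2⟩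

lemma const (c : k) : 𝒳.RegularOn S fun _ => c :=
  h𝒳.regularOn_iff.mpr fun _ _ => ⟨_, _, h𝒳.const_mem c, one_ne_zero, fun _ _ _ => by simp⟩

lemma mul (hφ : 𝒳.RegularOn S φ) (hψ : 𝒳.RegularOn S ψ) :
    𝒳.RegularOn S fun x => φ x * ψ x := by
  rw [h𝒳.regularOn_iff] at *
  intro x hx
  obtain ⟨A, B, hAB, hB, h⟩ := hφ x hx
  obtain ⟨A', B', hAB', hB', h'⟩ := hψ x hx
  refine ⟨_, _, h𝒳.mul_mem hAB hAB', mul_ne_zero hB hB', fun y hy hyB => ?_⟩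
  obtain ⟨h1, h2⟩ := mul_ne_zero_iff.mp hyB
  rw [h y hy h1, h' y hy h2, Pi.mul_apply, Pi.mul_apply, div_mul_div_comm]

lemma add (hφ : 𝒳.RegularOn S φ) (hψ : 𝒳.RegularOn S ψ) :
    𝒳.RegularOn S fun x => φ x + ψ x := by
  rw [h𝒳.regularOn_iff] at *
  intro x hx
  obtain ⟨A, B, hAB, hB, h⟩ := hφ x hx
  obtain ⟨A', B', hAB', hB', h'⟩ := hψ x hx
  refine ⟨_, _, h𝒳.add_mem hAB hAB', mul_ne_zero hB hB', fun y hy hyB => ?_⟩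
  obtain ⟨h1, h2⟩ := mul_ne_zero_iff.mp hyB
  rw [h y hy h1, h' y hy h2, Pi.add_apply, Pi.mul_apply, Pi.mul_apply, Pi.mul_apply,
    div_add_div _ _ h1 h2]
  ring

lemma inv (hφ : 𝒳.RegularOn S φ) (h0 : ∀ x ∈ S, φ x ≠ 0) : 𝒳.RegularOn S fun x => (φ x)⁻¹ := by
  rw [h𝒳.regularOn_iff] at *
  intro x hx
  obtain ⟨A, B, hAB, hB, h⟩ := hφ x hx
  have hA : A x ≠ 0 := fun hA => h0 x hx (by rw [h x hx hB, hA, zero_div])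
  refine ⟨_, _, h𝒳.inv_mem hAB, mul_ne_zero hA hB, fun y hy hyB => ?_⟩
  obtain ⟨h1, h2⟩ := mul_ne_zero_iff.mp hyB
  rw [h y hy h2, Pi.mul_apply, Pi.mul_apply, mul_div_mul_right _ _ h2, inv_div]

lemma div (hφ : 𝒳.RegularOn S φ) (hψ : 𝒳.RegularOn S ψ) (h0 : ∀ x ∈ S, ψ x ≠ 0) :
    𝒳.RegularOn S fun x => φ x / ψ x :=
  (h𝒳.mul hφ (h𝒳.inv hψ h0)).congr fun _ _ => div_eq_mul_inv _ _

lemma pow (hφ : 𝒳.RegularOn S φ) (n : ℕ) : 𝒳.RegularOn S fun x => φ x ^ n := by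
  induction n with
  | zero => simpa using h𝒳.const 1
  | succ n ih => simpa only [pow_succ] using h𝒳.mul ih hφ

lemma sum {ι : Type*} (s : Finset ι) {φ : ι → X → k} (hφ : ∀ i ∈ s, 𝒳.RegularOn S (φ i)) :
    𝒳.RegularOn S fun x => ∑ i ∈ s, φ i x := by
  classical
  induction s using Finset.induction_on with
  | empty => simpa using h𝒳.const 0
  | insert i s hi ih =>
    simp only [Finset.sum_insert hi]
    exact h𝒳.add (hφ i (Finset.mem_insert_self i s))
      (ih fun j hj => hφ j (Finset.mem_insert_of_mem hj))

lemma eval_regular {σ : Type*} {t : X → σ → k} (ht : ∀ i, 𝒳.RegularOn S fun x => t x i)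
    (Q : MvPolynomial σ k) : 𝒳.RegularOn S fun x => eval (t x) Q := by
  induction Q using MvPolynomial.induction_on with
  | C a => simpa using h𝒳.const a
  | add p q hp hq => simpa using h𝒳.add hp hq
  | mul_X p i hp => simpa using h𝒳.mul hp (ht i)

lemma basic_isOpen {A B : X → k} (h : (A, B) ∈ Φ) : IsOpen[𝒳.top] {x | B x ≠ 0} :=
  TopologicalSpace.GenerateOpen.basic _ ⟨_, (h𝒳.mem_iff _).mpr ⟨A, B, h, rfl⟩⟩

/-- Near a point where `φ = A / B` is nonzero, the inverse pair `(B², AB)` supplies a basic open set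
on which `φ` is both given by this fraction and nonzero. -/
lemma openIn_ne_zero (hφ : 𝒳.RegularOn S φ) : 𝒳.OpenIn S (S ∩ {x | φ x ≠ 0}) := by
  rw [h𝒳.regularOn_iff] at hφ
  refine ⟨⋃₀ {O | IsOpen[𝒳.top] O ∧ ∀ x ∈ S ∩ O, φ x ≠ 0},
    @isOpen_sUnion _ 𝒳.top _ fun O hO => hO.1, ?_⟩
  ext x
  constructor
  · rintro ⟨hx, hφx⟩
    obtain ⟨A, B, hAB, hB, h⟩ := hφ x hx
    have hA : A x ≠ 0 := fun hA => hφx (by rw [h x hx hB, hA, zero_div])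
    refine ⟨hx, _, ⟨h𝒳.basic_isOpen (h𝒳.inv_mem hAB), ?_⟩, mul_ne_zero hA hB⟩
    rintro y ⟨hy, hyB⟩
    obtain ⟨h1, h2⟩ := mul_ne_zero_iff.mp hyB
    rw [h y hy h2]
    exact div_ne_zero h1 h2
  · rintro ⟨hx, O, hO, hxO⟩
    exact ⟨hx, hO.2 x ⟨hx, hxO⟩⟩

lemma exists_basic_of_isOpen {O : Set X} (hO : IsOpen[𝒳.top] O) {x : X} (hx : x ∈ O) :
    ∃ A B, (A, B) ∈ Φ ∧ B x ≠ 0 ∧ ∀ y, B y ≠ 0 → y ∈ O := by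
  induction hO with
  | basic s hs =>
    obtain ⟨ψ, hψ⟩ := hs
    obtain ⟨A, B, hAB, he⟩ := (h𝒳.mem_iff _).mp hψ
    obtain ⟨rfl, rfl⟩ := Prod.mk.inj he
    exact ⟨A, B, hAB, hx, fun y hy => hy⟩
  | univ => exact ⟨_, _, h𝒳.const_mem 0, one_ne_zero, fun _ _ => trivial⟩
  | inter s t _ _ hs ht =>
    obtain ⟨A, B, hAB, hB, h⟩ := hs hx.1
    obtain ⟨A', B', hAB', hB', h'⟩ := ht hx.2
    refine ⟨_, _, h𝒳.mul_mem hAB hAB', mul_ne_zero hB hB', fun y hy => ?_⟩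
    obtain ⟨h1, h2⟩ := mul_ne_zero_iff.mp hy
    exact ⟨h y h1, h' y h2⟩
  | sUnion s _ hs =>
    obtain ⟨t, ht, hxt⟩ := hx
    obtain ⟨A, B, hAB, hB, h⟩ := hs t ht hxt
    exact ⟨A, B, hAB, hB, fun y hy => ⟨t, ht, h y hy⟩⟩

/-- Only the zero set of the denominator and the value of the quotient have to be matched. This
leaves room for the scalar by which a chosen homogeneous representative differs from explicit
coordinates. -/
lemma isMorphism {𝒴 : Basics k Y} {Ψ : Set ((Y → k) × (Y → k))} (h𝒴 : 𝒴.IsFractions Ψ)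
    {u : X → Y} {T : Set Y} (hu : Set.MapsTo u S T)
    (h : ∀ A B, (A, B) ∈ Ψ → ∃ A' B', 𝒳.RegularOn S A' ∧ 𝒳.RegularOn S B' ∧
      ∀ x ∈ S, (B (u x) ≠ 0 ↔ B' x ≠ 0) ∧ (B (u x) ≠ 0 → A (u x) / B (u x) = A' x / B' x)) :
    IsMorphism 𝒳 𝒴 u S T := by
  refine ⟨hu, fun D ψ hD => ?_⟩
  obtain ⟨A, B, hAB, he⟩ := (h𝒴.mem_iff _).mp hD
  obtain ⟨rfl, rfl⟩ := Prod.mk.inj he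
  obtain ⟨A', B', hA', hB', h'⟩ := h A B hAB
  have hS : S ∩ u ⁻¹' {y | B y ≠ 0} = S ∩ {x | B' x ≠ 0} := by
    ext x
    exact and_congr_right fun hx => (h' x hx).1
  rw [hS]
  refine ⟨h𝒳.openIn_ne_zero hB', ?_⟩
  refine (h𝒳.div (hA'.mono Set.inter_subset_left) (hB'.mono Set.inter_subset_left)
    fun x hx => hx.2).congr fun x hx => ?_
  exact (h' x hx.1).2 ((h' x hx.1).1.mpr hx.2)

end Basics.IsFractions

/-- The pairs of polynomial functions. -/
def affinePairs (k : Type*) [Field k] (m : ℕ) : Set (((Fin m → k) → k) × ((Fin m → k) → k)) :=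
  {q | ∃ A B : MvPolynomial (Fin m) k, q = (fun x => eval x A, fun x => eval x B)}

lemma affineSpace_isFractions (m : ℕ) : (affineSpace k m).IsFractions (affinePairs k m) where
  mem_iff q := by
    constructor
    · rintro ⟨A, B, rfl⟩
      exact ⟨_, _, ⟨A, B, rfl⟩, rfl⟩
    · rintro ⟨_, _, ⟨A, B, he⟩, rfl⟩
      obtain ⟨rfl, rfl⟩ := Prod.mk.inj he
      exact ⟨A, B, rfl⟩
  const_mem c := ⟨C c, 1, by simp⟩
  mul_mem := by
    rintro _ _ _ _ ⟨A, B, he⟩ ⟨A', B', he'⟩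
    obtain ⟨rfl, rfl⟩ := Prod.mk.inj he
    obtain ⟨rfl, rfl⟩ := Prod.mk.inj he'
    exact ⟨A * A', B * B', by ext <;> simp⟩
  add_mem := by
    rintro _ _ _ _ ⟨A, B, he⟩ ⟨A', B', he'⟩
    obtain ⟨rfl, rfl⟩ := Prod.mk.inj he
    obtain ⟨rfl, rfl⟩ := Prod.mk.inj he'
    exact ⟨A * B' + A' * B, B * B', by ext <;> simp⟩
  inv_mem := by
    rintro _ _ ⟨A, B, he⟩
    obtain ⟨rfl, rfl⟩ := Prod.mk.inj he
    exact ⟨B * B, A * B, by ext <;> simp⟩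

lemma Basics.IsFractions.isMorphism_affineSpace (h𝒳 : 𝒳.IsFractions Φ) {m : ℕ}
    {u : X → Fin m → k} {Z : Set (Fin m → k)} (hu : Set.MapsTo u S Z)
    (hreg : ∀ i, 𝒳.RegularOn S fun x => u x i) : IsMorphism 𝒳 (affineSpace k m) u S Z := by
  refine h𝒳.isMorphism (affineSpace_isFractions m) hu ?_
  rintro _ _ ⟨A, B, he⟩
  obtain ⟨rfl, rfl⟩ := Prod.mk.inj he
  exact ⟨_, _, h𝒳.eval_regular hreg A, h𝒳.eval_regular hreg B,
    fun x _ => ⟨Iff.rfl, fun _ => rfl⟩⟩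

lemma regularOn_coord {m : ℕ} (Z : Set (Fin m → k)) (i : Fin m) :
    (affineSpace k m).RegularOn Z fun x => x i :=
  (affineSpace_isFractions m).regularOn_iff.mpr fun _ _ =>
    ⟨_, _, ⟨MvPolynomial.X i, 1, rfl⟩, by simp, fun y _ _ => by simp⟩

lemma isClosed_zeros {m : ℕ} (I : Set (MvPolynomial (Fin m) k)) :
    IsClosed[(affineSpace k m).top] {x | ∀ q ∈ I, eval x q = 0} := by
  rw [← @isOpen_compl_iff _ _ (affineSpace k m).top]
  have : {x : Fin m → k | ∀ q ∈ I, eval x q = 0}ᶜ =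
      ⋃₀ {O | IsOpen[(affineSpace k m).top] O ∧ ∀ x ∈ O, ∃ q ∈ I, eval x q ≠ 0} := by
    ext x
    constructor
    · intro hx
      simp only [Set.mem_compl_iff, Set.mem_ofPred_eq, not_forall] at hx
      obtain ⟨q, hq, hx⟩ := hx
      exact ⟨_, ⟨(affineSpace_isFractions m).basic_isOpen ⟨1, q, rfl⟩,
        fun y hy => ⟨q, hq, hy⟩⟩, hx⟩
    · rintro ⟨O, hO, hx⟩ h
      obtain ⟨q, hq, hne⟩ := hO.2 x hx
      exact hne (h q hq)
  rw [this]
  exact @isOpen_sUnion _ (affineSpace k m).top _ fun O hO => hO.1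

/-- The regular functions on a closed subset of affine space are the polynomial functions. -/
lemma exists_polynomial_of_regularOn [IsAlgClosed k] {m : ℕ} (I : Set (MvPolynomial (Fin m) k))
    {φ : (Fin m → k) → k}
    (hφ : (affineSpace k m).RegularOn {x | ∀ q ∈ I, eval x q = 0} φ) :
    ∃ Q : MvPolynomial (Fin m) k, ∀ x, (∀ q ∈ I, eval x q = 0) → φ x = eval x Q := by
  rw [(affineSpace_isFractions m).regularOn_iff] at hφ
  set Z := {x : Fin m → k | ∀ q ∈ I, eval x q = 0} with hZ
  -- The ideal of denominators: those `b` for which `b φ` is polynomial on `Z`. The claim is that it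
  -- contains 1.
  let J : Ideal (MvPolynomial (Fin m) k) :=
    { carrier := {b | ∃ a, ∀ x ∈ Z, eval x b * φ x = eval x a}
      add_mem' := by
        rintro b b' ⟨a, ha⟩ ⟨a', ha'⟩
        exact ⟨a + a', fun x hx => by rw [map_add, map_add, add_mul, ha x hx, ha' x hx]⟩
      zero_mem' := ⟨0, fun x _ => by simp⟩
      smul_mem' := by
        rintro c b ⟨a, ha⟩
        exact ⟨c * a, fun x hx => by rw [smul_eq_mul, map_mul, map_mul, mul_assoc, ha x hx]⟩ }
  have hJ : J = ⊤ := by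
    have hempty : MvPolynomial.zeroLocus k J = ∅ := by
      rw [Set.eq_empty_iff_forall_notMem]
      intro x hx
      -- The equations of `Z` belong to `J`, with numerator 0, so a common zero of `J` lies in `Z`.
      have hxZ : x ∈ Z := fun q hq => by
        have := hx q ⟨0, fun y hy => by rw [hy q hq]; simp⟩
        simpa using this
      obtain ⟨_, _, ⟨A, B, he⟩, hB, hy⟩ := hφ x hxZ
      obtain ⟨rfl, rfl⟩ := Prod.mk.inj he
      -- `B φ = A` is known only where `B ≠ 0`; the identity `B² φ = A B` holds on all of `Z`.
      have := hx (B * B) ⟨A * B, fun y hyZ => ?_⟩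
      · simp only [map_mul, mul_self_eq_zero] at this
        exact hB (by simpa using this)
      · by_cases hBy : eval y B = 0
        · simp [hBy]
        · rw [hy y hyZ hBy, map_mul, map_mul]; field_simp
    have := MvPolynomial.vanishingIdeal_zeroLocus_eq_radical (K := k) J
    rw [hempty] at this
    rw [← Ideal.radical_eq_top, ← this]
    exact vanishingIdeal_empty
  obtain ⟨Q, hQ⟩ : (1 : MvPolynomial (Fin m) k) ∈ J := hJ ▸ Submodule.mem_top
  exact ⟨Q, fun x hx => by simpa using hQ x hx⟩

end Regular

end UnbddPreper

namespace UnbddPreper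

/-! ### The projective plane and its square -/

section PlaneFractions

variable {k : Type*} [Field k]

/-- A character of the grading monoid rescales each variable according to its weight. This treats
the scalings of `ℙ²` and of `ℙ² × ℙ²` uniformly. -/
lemma eval_mul_of_isWeightedHomogeneous {σ M : Type*} [AddCommMonoid M] {w : σ → M}
    {A : MvPolynomial σ k} {e : M} (hA : A.IsWeightedHomogeneous w e) (χ : Multiplicative M →* k)
    (v : σ → k) :
    eval (fun i => χ (Multiplicative.ofAdd (w i)) * v i) A =
      χ (Multiplicative.ofAdd e) * eval v A := by
  have hχ : ∀ m : σ →₀ ℕ, (m.prod fun i j => χ (Multiplicative.ofAdd (w i)) ^ j) =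
      χ (Multiplicative.ofAdd (Finsupp.weight w m)) := by
    intro m
    induction m using Finsupp.induction_linear with
    | zero => simp
    | add f g hf hg =>
      rw [Finsupp.prod_add_index' (by simp) (by simp [pow_add]), hf, hg, map_add, ofAdd_add, map_mul]
    | single i j => simp [Finsupp.weight_apply, ofAdd_nsmul]
  rw [eval_eq, eval_eq, Finset.mul_sum]
  refine Finset.sum_congr rfl fun m hm => ?_
  have hm' : Finsupp.weight w m = e := hA (mem_support_iff.mp hm)
  have := hχ m
  rw [hm'] at this
  rw [← this, Finsupp.prod]
  simp only [mul_pow, Finset.prod_mul_distrib]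
  ring

lemma eval_smul_of_isHomogeneous {σ : Type*} {A : MvPolynomial σ k} {e : ℕ} (hA : A.IsHomogeneous e)
    (c : k) (v : σ → k) : eval (c • v) A = c ^ e * eval v A := by
  have := eval_mul_of_isWeightedHomogeneous hA (powersHom k c) v
  simp only [powersHom_apply, Pi.one_apply, toAdd_ofAdd, pow_one] at this
  exact this

lemma eval_sumElim_smul {A : MvPolynomial (Fin 3 ⊕ Fin 3) k} {e : ℕ × ℕ}
    (hA : A.IsWeightedHomogeneous biweight e) (c c' : k) (v w : Fin 3 → k) :
    eval (Sum.elim (c • v) (c' • w)) A = c ^ e.1 * c' ^ e.2 * eval (Sum.elim v w) A := by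
  let χ : Multiplicative (ℕ × ℕ) →* k :=
    { toFun := fun m => c ^ m.toAdd.1 * c' ^ m.toAdd.2
      map_one' := by simp
      map_mul' := fun a b => by simp [pow_add]; ring }
  have := eval_mul_of_isWeightedHomogeneous hA χ (Sum.elim v w)
  have h : Sum.elim (c • v) (c' • w) =
      fun i => χ (Multiplicative.ofAdd (biweight i)) * Sum.elim v w i := by
    funext i
    rcases i with i | i <;> simp [χ, biweight]
  rw [h, this]
  rfl

/-- The pairs of homogeneous polynomials of the same degree. -/
def planePairs (k : Type*) [Field k] : Set ((P2 k → k) × (P2 k → k)) :=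
  {q | ∃ (e : ℕ) (A B : MvPolynomial (Fin 3) k), A.IsHomogeneous e ∧ B.IsHomogeneous e ∧
    q = (fun P => eval P.rep A, fun P => eval P.rep B)}

lemma plane_isFractions : (plane k).IsFractions (planePairs k) where
  mem_iff q := by
    constructor
    · rintro ⟨e, A, B, hA, hB, rfl⟩
      exact ⟨_, _, ⟨e, A, B, hA, hB, rfl⟩, rfl⟩
    · rintro ⟨_, _, ⟨e, A, B, hA, hB, he⟩, rfl⟩
      obtain ⟨rfl, rfl⟩ := Prod.mk.inj he
      exact ⟨e, A, B, hA, hB, rfl⟩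
  const_mem c := ⟨0, C c, 1, isHomogeneous_C _ _, isHomogeneous_one _ _, by simp⟩
  mul_mem := by
    rintro _ _ _ _ ⟨e, A, B, hA, hB, he⟩ ⟨e', A', B', hA', hB', he'⟩
    obtain ⟨rfl, rfl⟩ := Prod.mk.inj he
    obtain ⟨rfl, rfl⟩ := Prod.mk.inj he'
    exact ⟨e + e', A * A', B * B', hA.mul hA', hB.mul hB', by ext <;> simp⟩
  add_mem := by
    rintro _ _ _ _ ⟨e, A, B, hA, hB, he⟩ ⟨e', A', B', hA', hB', he'⟩
    obtain ⟨rfl, rfl⟩ := Prod.mk.inj he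
    obtain ⟨rfl, rfl⟩ := Prod.mk.inj he'
    exact ⟨e + e', A * B' + A' * B, B * B', (hA.mul hB').add (add_comm e e' ▸ hA'.mul hB),
      hB.mul hB', by ext <;> simp⟩
  inv_mem := by
    rintro _ _ ⟨e, A, B, hA, hB, he⟩
    obtain ⟨rfl, rfl⟩ := Prod.mk.inj he
    exact ⟨e + e, B * B, A * B, hB.mul hB, hA.mul hB, by ext <;> simp⟩

/-- The pairs of bihomogeneous polynomials of the same bidegree. -/
def planeSqPairs (k : Type*) [Field k] : Set ((P2 k × P2 k → k) × (P2 k × P2 k → k)) :=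
  {q | ∃ (e : ℕ × ℕ) (A B : MvPolynomial (Fin 3 ⊕ Fin 3) k),
    A.IsWeightedHomogeneous biweight e ∧ B.IsWeightedHomogeneous biweight e ∧
    q = (fun R => eval (Sum.elim R.1.rep R.2.rep) A, fun R => eval (Sum.elim R.1.rep R.2.rep) B)}

lemma planeSq_isFractions : (planeSq k).IsFractions (planeSqPairs k) where
  mem_iff q := by
    constructor
    · rintro ⟨e, A, B, hA, hB, rfl⟩
      exact ⟨_, _, ⟨e, A, B, hA, hB, rfl⟩, rfl⟩
    · rintro ⟨_, _, ⟨e, A, B, hA, hB, he⟩, rfl⟩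
      obtain ⟨rfl, rfl⟩ := Prod.mk.inj he
      exact ⟨e, A, B, hA, hB, rfl⟩
  const_mem c := ⟨0, C c, 1, isWeightedHomogeneous_C _ _, isWeightedHomogeneous_one _ _, by simp⟩
  mul_mem := by
    rintro _ _ _ _ ⟨e, A, B, hA, hB, he⟩ ⟨e', A', B', hA', hB', he'⟩
    obtain ⟨rfl, rfl⟩ := Prod.mk.inj he
    obtain ⟨rfl, rfl⟩ := Prod.mk.inj he'
    exact ⟨e + e', A * A', B * B', hA.mul hA', hB.mul hB', by ext <;> simp⟩
  add_mem := by
    rintro _ _ _ _ ⟨e, A, B, hA, hB, he⟩ ⟨e', A', B', hA', hB', he'⟩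
    obtain ⟨rfl, rfl⟩ := Prod.mk.inj he
    obtain ⟨rfl, rfl⟩ := Prod.mk.inj he'
    exact ⟨e + e', A * B' + A' * B, B * B', (hA.mul hB').add (add_comm e e' ▸ hA'.mul hB),
      hB.mul hB', by ext <;> simp⟩
  inv_mem := by
    rintro _ _ ⟨e, A, B, hA, hB, he⟩
    obtain ⟨rfl, rfl⟩ := Prod.mk.inj he
    exact ⟨e + e, B * B, A * B, hB.mul hB, hA.mul hB, by ext <;> simp⟩

lemma isWeightedHomogeneous_rename {σ τ M N : Type*} [AddCommMonoid M] [AddCommMonoid N]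
    {w : σ → M} {w' : τ → N} (f : σ → τ) (g : M →+ N) (hg : ∀ i, w' (f i) = g (w i))
    {A : MvPolynomial σ k} {e : M} (hA : A.IsWeightedHomogeneous w e) :
    (rename f A).IsWeightedHomogeneous w' (g e) := by
  have hw : ∀ m : σ →₀ ℕ, Finsupp.weight w' (m.mapDomain f) = g (Finsupp.weight w m) := by
    intro m
    induction m using Finsupp.induction_linear with
    | zero => simp
    | add a b ha hb => rw [Finsupp.mapDomain_add, map_add, map_add, map_add, ha, hb]
    | single i j => simp [Finsupp.weight_apply, hg]
  induction hA using IsWeightedHomogeneous.induction_on with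
  | zero => simpa using isWeightedHomogeneous_zero k w' (g e)
  | add p q _ _ hp hq => simpa using hp.add hq
  | monomial m r hr =>
    rw [rename_monomial]
    exact isWeightedHomogeneous_monomial _ _ _ (by rw [hw, hr])

lemma isWeightedHomogeneous_rename_inl {A : MvPolynomial (Fin 3) k} {e : ℕ}
    (hA : A.IsHomogeneous e) :
    (rename Sum.inl A : MvPolynomial (Fin 3 ⊕ Fin 3) k).IsWeightedHomogeneous biweight (e, 0) :=
  isWeightedHomogeneous_rename Sum.inl (AddMonoidHom.inl ℕ ℕ) (fun _ => rfl) hA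

lemma isWeightedHomogeneous_rename_inr {A : MvPolynomial (Fin 3) k} {e : ℕ}
    (hA : A.IsHomogeneous e) :
    (rename Sum.inr A : MvPolynomial (Fin 3 ⊕ Fin 3) k).IsWeightedHomogeneous biweight (0, e) :=
  isWeightedHomogeneous_rename Sum.inr (AddMonoidHom.inr ℕ ℕ) (fun _ => rfl) hA

lemma planeSqPairs_fst {A B : P2 k → k} (h : (A, B) ∈ planePairs k) :
    (fun R => A R.1, fun R => B R.1) ∈ planeSqPairs k := by
  obtain ⟨e, A, B, hA, hB, he⟩ := h
  obtain ⟨rfl, rfl⟩ := Prod.mk.inj he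
  exact ⟨_, _, _, isWeightedHomogeneous_rename_inl hA, isWeightedHomogeneous_rename_inl hB,
    by ext <;> simp [eval_rename]⟩

lemma planeSqPairs_snd {A B : P2 k → k} (h : (A, B) ∈ planePairs k) :
    (fun R => A R.2, fun R => B R.2) ∈ planeSqPairs k := by
  obtain ⟨e, A, B, hA, hB, he⟩ := h
  obtain ⟨rfl, rfl⟩ := Prod.mk.inj he
  exact ⟨_, _, _, isWeightedHomogeneous_rename_inr hA, isWeightedHomogeneous_rename_inr hB,
    by ext <;> simp [eval_rename]⟩

lemma regularOn_comp_fst {S : Set (P2 k × P2 k)} {T : Set (P2 k)} {φ : P2 k → k}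
    (hφ : (plane k).RegularOn T φ) (hS : ∀ R ∈ S, R.1 ∈ T) :
    (planeSq k).RegularOn S fun R => φ R.1 := by
  rw [plane_isFractions.regularOn_iff] at hφ
  rw [planeSq_isFractions.regularOn_iff]
  intro R hR
  obtain ⟨A, B, hAB, hB, h⟩ := hφ R.1 (hS R hR)
  exact ⟨_, _, planeSqPairs_fst hAB, hB, fun y hy hyB => h y.1 (hS y hy) hyB⟩

lemma regularOn_comp_snd {S : Set (P2 k × P2 k)} {T : Set (P2 k)} {φ : P2 k → k}
    (hφ : (plane k).RegularOn T φ) (hS : ∀ R ∈ S, R.2 ∈ T) :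
    (planeSq k).RegularOn S fun R => φ R.2 := by
  rw [plane_isFractions.regularOn_iff] at hφ
  rw [planeSq_isFractions.regularOn_iff]
  intro R hR
  obtain ⟨A, B, hAB, hB, h⟩ := hφ R.2 (hS R hR)
  exact ⟨_, _, planeSqPairs_snd hAB, hB, fun y hy hyB => h y.2 (hS y hy) hyB⟩

lemma isOpen_snd_preimage {U : Set (P2 k)} (hU : IsOpen[(plane k).top] U) :
    IsOpen[(planeSq k).top] (Prod.snd ⁻¹' U : Set (P2 k × P2 k)) := by
  have : (Prod.snd ⁻¹' U : Set (P2 k × P2 k)) =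
      ⋃₀ {O | IsOpen[(planeSq k).top] O ∧ O ⊆ Prod.snd ⁻¹' U} := by
    ext R
    constructor
    · intro hR
      obtain ⟨A, B, hAB, hB, h⟩ := plane_isFractions.exists_basic_of_isOpen hU hR
      exact ⟨_, ⟨planeSq_isFractions.basic_isOpen (planeSqPairs_snd hAB), fun y hy => h _ hy⟩, hB⟩
    · rintro ⟨O, hO, hR⟩
      exact hO.2 hR
  rw [this]
  exact @isOpen_sUnion _ (planeSq k).top _ fun O hO => hO.1

lemma isMorphism_snd {S : Set (P2 k × P2 k)} {T : Set (P2 k)} (h : Set.MapsTo Prod.snd S T) :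
    IsMorphism (planeSq k) (plane k) Prod.snd S T := by
  refine ⟨h, fun D ψ hD => ?_⟩
  obtain ⟨A, B, hAB, he⟩ := (plane_isFractions.mem_iff _).mp hD
  obtain ⟨rfl, rfl⟩ := Prod.mk.inj he
  refine ⟨⟨_, planeSq_isFractions.basic_isOpen (planeSqPairs_snd hAB), rfl⟩, ?_⟩
  rw [planeSq_isFractions.regularOn_iff]
  exact fun R hR => ⟨_, _, planeSqPairs_snd hAB, hR.2, fun y _ _ => rfl⟩

/-- The points where the last coordinate does not vanish. -/
def finitePart (k : Type*) [Field k] : Set (P2 k) := {P | P.rep 2 ≠ 0}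

lemma isOpen_finitePart : IsOpen[(plane k).top] (finitePart k) := by
  have := plane_isFractions.basic_isOpen (k := k)
    ⟨1, X 0, X 2, isHomogeneous_X _ _, isHomogeneous_X _ _, rfl⟩
  simpa [finitePart] using this

lemma regularOn_coord_div (i : Fin 3) :
    (plane k).RegularOn (finitePart k) fun P => P.rep i / P.rep 2 := by
  rw [plane_isFractions.regularOn_iff]
  intro P hP
  refine ⟨_, _, ⟨1, X i, X 2, isHomogeneous_X _ _, isHomogeneous_X _ _, rfl⟩, ?_, ?_⟩
  · rwa [eval_X]
  · intro y _ _
    simp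

/-- A set which meets every nonempty set `D₊(B)` is dense. -/
lemma dense_of_forall_exists {S : Set (P2 k)}
    (h : ∀ (e : ℕ) (B : MvPolynomial (Fin 3) k), B.IsHomogeneous e → B ≠ 0 →
      ∃ P ∈ S, eval P.rep B ≠ 0) : @Dense _ (plane k).top S := by
  let _ := (plane k).top
  rw [dense_iff_inter_open]
  rintro O hO ⟨P, hP⟩
  obtain ⟨_, _, ⟨e, A, B, hA, hB, he⟩, hBP, h'⟩ := plane_isFractions.exists_basic_of_isOpen hO hP
  obtain ⟨rfl, rfl⟩ := Prod.mk.inj he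
  obtain ⟨Q, hQ, hQB⟩ := h e B hB (by rintro rfl; simp at hBP)
  exact ⟨Q, h' Q hQB, hQ⟩

end PlaneFractions

/-! ### Affine coordinates on the plane and morphisms defined by them. -/

section AffinePoints

lemma mk_rep_eq_smul {k : Type*} [Field k] {v : Fin 3 → k} (hv : v ≠ 0) :
    ∃ c : k, c ≠ 0 ∧ (Projectivization.mk k v hv).rep = c • v := by
  obtain ⟨a, ha⟩ := Projectivization.exists_smul_eq_mk_rep k v hv
  exact ⟨a, a.ne_zero, ha.symm⟩

lemma affinePoint_rep (a b : Qbar) : ∃ c : Qbar, c ≠ 0 ∧ (affinePoint a b).rep = c • ![a, b, 1] :=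
  mk_rep_eq_smul _

lemma eq_affinePoint {P : P2 Qbar} (hP : P.rep 2 ≠ 0) :
    P = affinePoint (P.rep 0 / P.rep 2) (P.rep 1 / P.rep 2) := by
  conv_lhs => rw [← P.mk_rep]
  rw [affinePoint, Projectivization.mk_eq_mk_iff']
  refine ⟨P.rep 2, funext fun i => ?_⟩
  fin_cases i <;> simp [mul_div_cancel₀, hP]

lemma affinePoint_coords (a b : Qbar) : (affinePoint a b).rep 2 ≠ 0 ∧
    (affinePoint a b).rep 0 / (affinePoint a b).rep 2 = a ∧
    (affinePoint a b).rep 1 / (affinePoint a b).rep 2 = b := by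
  obtain ⟨c, hc, h⟩ := affinePoint_rep a b
  rw [h]
  simp [hc]

variable {X : Type*} {𝒳 : Basics Qbar X} {Φ : Set ((X → Qbar) × (X → Qbar))} {S : Set X}

lemma regularOn_vec (h𝒳 : 𝒳.IsFractions Φ) {a b : X → Qbar} (ha : 𝒳.RegularOn S a)
    (hb : 𝒳.RegularOn S b) (i : Fin 3) : 𝒳.RegularOn S fun x => (![a x, b x, 1] : Fin 3 → Qbar) i := by
  fin_cases i
  · exact ha
  · exact hb
  · exact h𝒳.const 1

lemma isMorphism_affinePoint (h𝒳 : 𝒳.IsFractions Φ) {a b : X → Qbar} (ha : 𝒳.RegularOn S a)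
    (hb : 𝒳.RegularOn S b) {T : Set (P2 Qbar)}
    (hu : Set.MapsTo (fun x => affinePoint (a x) (b x)) S T) :
    IsMorphism 𝒳 (plane Qbar) (fun x => affinePoint (a x) (b x)) S T := by
  refine h𝒳.isMorphism plane_isFractions hu ?_
  rintro _ _ ⟨e, A, B, hA, hB, he⟩
  obtain ⟨rfl, rfl⟩ := Prod.mk.inj he
  refine ⟨_, _, h𝒳.eval_regular (regularOn_vec h𝒳 ha hb) A,
    h𝒳.eval_regular (regularOn_vec h𝒳 ha hb) B, fun x _ => ?_⟩
  obtain ⟨c, hc, h⟩ := affinePoint_rep (a x) (b x)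
  have hc' := pow_ne_zero e hc
  simp only [h, eval_smul_of_isHomogeneous hA, eval_smul_of_isHomogeneous hB]
  exact ⟨by simp [hc], fun _ => mul_div_mul_left _ _ hc'⟩

lemma isMorphism_affinePoint_prod (h𝒳 : 𝒳.IsFractions Φ) {a b a' b' : X → Qbar}
    (ha : 𝒳.RegularOn S a) (hb : 𝒳.RegularOn S b) (ha' : 𝒳.RegularOn S a')
    (hb' : 𝒳.RegularOn S b') {T : Set (P2 Qbar × P2 Qbar)}
    (hu : Set.MapsTo (fun x => (affinePoint (a x) (b x), affinePoint (a' x) (b' x))) S T) :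
    IsMorphism 𝒳 (planeSq Qbar)
      (fun x => (affinePoint (a x) (b x), affinePoint (a' x) (b' x))) S T := by
  refine h𝒳.isMorphism planeSq_isFractions hu ?_
  rintro _ _ ⟨e, A, B, hA, hB, he⟩
  obtain ⟨rfl, rfl⟩ := Prod.mk.inj he
  have hreg : ∀ i, 𝒳.RegularOn S fun x =>
      (Sum.elim ![a x, b x, 1] ![a' x, b' x, 1] : Fin 3 ⊕ Fin 3 → Qbar) i := by
    rintro (i | i)
    · exact regularOn_vec h𝒳 ha hb i
    · exact regularOn_vec h𝒳 ha' hb' i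
  refine ⟨_, _, h𝒳.eval_regular hreg A, h𝒳.eval_regular hreg B, fun x _ => ?_⟩
  obtain ⟨c, hc, h⟩ := affinePoint_rep (a x) (b x)
  obtain ⟨c', hc', h'⟩ := affinePoint_rep (a' x) (b' x)
  have hcc := mul_ne_zero (pow_ne_zero e.1 hc) (pow_ne_zero e.2 hc')
  simp only [h, h', eval_sumElim_smul hA, eval_sumElim_smul hB]
  exact ⟨by simp [hc, hc'], fun _ => mul_div_mul_left _ _ hcc⟩

end AffinePoints

/-! ### Dominance and cohomological hyperbolicity. -/

section Dominance

variable {d p : ℕ}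

lemma sends_mk {F : Triple Qbar} {e : ℕ} (hF : Represents F F e) {v : Fin 3 → Qbar} (hv : v ≠ 0)
    (h : (fun i => eval v (F i)) ≠ 0) :
    Sends F (Projectivization.mk Qbar v hv) (Projectivization.mk Qbar _ h) := by
  obtain ⟨c, hc, hrep⟩ := mk_rep_eq_smul hv
  have he : (fun i => eval (Projectivization.mk Qbar v hv).rep (F i)) =
      c ^ e • fun i => eval v (F i) := by
    funext i
    rw [hrep, eval_smul_of_isHomogeneous (hF.2.1 i)]
    rfl
  refine ⟨e, F, hF, ?_, ?_⟩
  · rw [he]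
    exact smul_ne_zero (pow_ne_zero _ hc) h
  · rw [Projectivization.mk_eq_mk_iff']
    exact ⟨(c ^ e)⁻¹, by rw [he, inv_smul_smul₀ (pow_ne_zero _ hc)]⟩

lemma represents_fMap (hd : 3 ≤ d) : Represents (fMap d p) (fMap d p) d := by
  have := represents_iter_fMap (p := p) hd 1
  rw [pow_one] at this
  have h : iter (fMap d p) 1 = fMap d p := by
    funext i
    rw [iter_succ]
    simp [iter]
  rwa [h] at this

lemma isDominant_fMap (hd : 3 ≤ d) : IsDominant (fMap d p) := by
  refine dense_of_forall_exists fun e B hB hB0 => ?_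
  -- A vector off `imageForm = 0` is in the image, and one off `B = 0` is in the given open set; the
  -- product is a nonzero polynomial, so both can be had at once.
  obtain ⟨w, hw⟩ : ∃ w, eval w (imageForm d p * B) ≠ 0 := by
    by_contra! hcon
    exact mul_ne_zero imageForm_ne_zero hB0 (MvPolynomial.funext fun w => by simpa using hcon w)
  rw [map_mul] at hw
  obtain ⟨v, rfl⟩ := exists_eval_fMap_eq_of_imageForm hd (left_ne_zero_of_mul hw)
  have h0 : (fun i => eval v (fMap d p i)) ≠ 0 := by
    intro h0
    rw [h0] at hw
    simp [imageForm] at hw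
  have hv : v ≠ 0 := by
    rintro rfl
    refine h0 (funext fun i => ?_)
    have := eval_smul_of_isHomogeneous ((represents_fMap (p := p) hd).2.1 i) 0 0
    rw [zero_smul, zero_pow (by omega), zero_mul] at this
    exact this
  refine ⟨_, ⟨_, sends_mk (represents_fMap hd) hv h0⟩, ?_⟩
  obtain ⟨c, hc, hrep⟩ := mk_rep_eq_smul h0
  rw [hrep, eval_smul_of_isHomogeneous hB]
  exact mul_ne_zero (pow_ne_zero _ hc) (right_ne_zero_of_mul hw)

lemma isCohHyperbolic_fMap (hd : 3 ≤ d) (hp : p.Prime) : IsCohHyperbolic (fMap d p) 1 := by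
  refine ⟨isDominant_fMap hd, fun i => if i = 1 then d else 2, ?_, ?_⟩
  · intro i hi
    rw [Finset.mem_Icc] at hi
    obtain rfl | rfl : i = 1 ∨ i = 2 := by omega
    · simpa using hasDynDegree_one hd hp
    · simpa using hasDynDegree_two hd
  · have hd' : (3 : ℝ) ≤ d := by exact_mod_cast hd
    intro j
    constructor
    · rintro ⟨hj, h⟩
      by_contra hj1
      have := h 1 (by simp)
      simp only [if_true, if_neg hj1] at this
      linarith
    · rintro rfl
      refine ⟨by simp, fun i _ => ?_⟩
      simp only [if_true]
      split_ifs <;> linarith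

end Dominance

end UnbddPreper

namespace UnbddPreper

/-! ### A criterion for finiteness -/

section FiniteCriterion

/-- An element of a finitely generated algebra over an algebraically closed field which is not
killed by any character is a unit. -/
lemma isUnit_of_forall_algHom_ne_zero {k A : Type*} [Field k] [IsAlgClosed k] [CommRing A]
    [Algebra k A] [Algebra.FiniteType k A] {c : A} (hc : ∀ χ : A →ₐ[k] k, χ c ≠ 0) : IsUnit c := by
  by_contra hu
  obtain ⟨M, hM, hcM⟩ := exists_max_ideal_of_mem_nonunits hu
  let _ : Field (A ⧸ M) := Ideal.Quotient.field M
  have hfin : Module.Finite k (A ⧸ M) := finite_of_finite_type_of_isJacobsonRing k (A ⧸ M)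
  have hbij := IsAlgClosed.algebraMap_bijective_of_isIntegral (k := k) (K := A ⧸ M)
  let e := AlgEquiv.ofBijective (Algebra.ofId k (A ⧸ M)) hbij
  refine hc (e.symm.toAlgHom.comp (Ideal.Quotient.mkₐ k M)) ?_
  have : Ideal.Quotient.mkₐ k M c = 0 := Ideal.Quotient.eq_zero_iff_mem.mpr hcM
  change e.symm (Ideal.Quotient.mkₐ k M c) = 0
  rw [this, map_zero]

/-- The Nullstellensatz inverts `c` inside the `k`-algebra generated by `s`, all of whose elements
are integral over `R`. Hence only characters of this finitely generated algebra have to be tested,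
and `R` itself need not be of finite type. -/
lemma exists_inverse_isIntegral {k R A : Type*} [Field k] [IsAlgClosed k] [CommRing R]
    [CommRing A] [Algebra k R] [Algebra k A] [Algebra R A] [IsScalarTower k R A] {s : Set A}
    (hs : s.Finite) (hint : ∀ x ∈ s, IsIntegral R x) {c : A} (hc : c ∈ Algebra.adjoin k s)
    (hχ : ∀ χ : Algebra.adjoin k s →ₐ[k] k, χ ⟨c, hc⟩ ≠ 0) :
    ∃ c', c * c' = 1 ∧ IsIntegral R c' := by
  have : Algebra.FiniteType k (Algebra.adjoin k s) :=
    (Subalgebra.fg_iff_finiteType _).mp ⟨hs.toFinset, by simp⟩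
  obtain ⟨c', hc'⟩ := (isUnit_of_forall_algHom_ne_zero hχ).exists_right_inv
  refine ⟨c', congrArg Subtype.val hc', ?_⟩
  have hle : Algebra.adjoin k s ≤ (integralClosure R A).restrictScalars k :=
    Algebra.adjoin_le hint
  exact hle c'.2

variable {k X Y : Type*} [Field k] {𝒳 : Basics k X} {Φ : Set ((X → k) × (X → k))}
  {𝒴 : Basics k Y} {Ψ : Set ((Y → k) × (Y → k))}

lemma IsMorphism.comp_regularOn {g : X → Y} {S : Set X} {T : Set Y} (hg : IsMorphism 𝒳 𝒴 g S T)
    (h𝒳 : 𝒳.IsFractions Φ) {a : Y → k} (ha : 𝒴.RegularOn T a) : 𝒳.RegularOn S (a ∘ g) := by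
  rw [h𝒳.regularOn_iff]
  intro x hx
  obtain ⟨D, ψ, hD, hxD, hψ⟩ := ha (g x) (hg.1 hx)
  obtain ⟨⟨O, hO, hSO⟩, hreg⟩ := hg.2 D ψ hD
  have hx' : x ∈ S ∩ g ⁻¹' D := ⟨hx, hxD⟩
  obtain ⟨A, B, hAB, hB, hAB'⟩ := h𝒳.regularOn_iff.mp hreg x hx'
  rw [hSO] at hx'
  obtain ⟨A', B', hAB₂, hB', hO'⟩ := h𝒳.exists_basic_of_isOpen hO hx'.2
  -- Adding the zero fraction with denominator `B'` keeps the value and shrinks the domain into `O`.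
  refine ⟨_, _, h𝒳.add_mem hAB (h𝒳.mul_mem (h𝒳.const_mem 0) hAB₂), ?_, fun y hy hyB => ?_⟩
  · simpa using ⟨hB, hB'⟩
  · simp only [Pi.mul_apply, one_mul, ne_eq, mul_eq_zero, not_or] at hyB
    have hyO : y ∈ S ∩ g ⁻¹' D := by
      rw [hSO]
      exact ⟨hy, hO' y hyB.2⟩
    have h1 : a (g y) = A y / B y := (hψ _ ⟨hg.1 hy, hyO.2⟩).trans (hAB' y hyO hyB.1)
    simp only [Function.comp_apply, h1, Pi.add_apply, Pi.mul_apply, one_mul, zero_mul, add_zero]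
    rw [mul_div_mul_right _ _ hyB.2]

/-- The algebra of the functions which are regular on `T`. -/
def regularAlgebra (h𝒴 : 𝒴.IsFractions Ψ) (T : Set Y) : Subalgebra k (Y → k) where
  carrier := {a | 𝒴.RegularOn T a}
  mul_mem' := h𝒴.mul
  add_mem' := h𝒴.add
  algebraMap_mem' := h𝒴.const

/-- The pullback of regular functions on `T` to functions on `S`. -/
def pullback (h𝒴 : 𝒴.IsFractions Ψ) (T : Set Y) (g : X → Y) (S : Set X) :
    regularAlgebra h𝒴 T →ₐ[k] (S → k) where
  toFun a s := a.1 (g s)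
  map_one' := rfl
  map_mul' _ _ := rfl
  map_zero' := rfl
  map_add' _ _ := rfl
  commutes' _ := rfl

/-- Let `S` be isomorphic to a closed subset of an affine space, such that the coordinates are
integral over the regular functions on the affine set `T`. Then `S → T` is finite. -/
lemma isFiniteMorphism_of_isIntegralElem [IsAlgClosed k] (h𝒳 : 𝒳.IsFractions Φ)
    (h𝒴 : 𝒴.IsFractions Ψ) {g : X → Y} {S : Set X} {T : Set Y} (hg : IsMorphism 𝒳 𝒴 g S T)
    (hT : 𝒴.IsAffine T) {m : ℕ} (I : Set (MvPolynomial (Fin m) k)) {u : X → Fin m → k}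
    {v : (Fin m → k) → X} (hu : IsMorphism 𝒳 (affineSpace k m) u S {x | ∀ q ∈ I, eval x q = 0})
    (hureg : ∀ i, 𝒳.RegularOn S fun x => u x i)
    (hv : IsMorphism (affineSpace k m) 𝒳 v {x | ∀ q ∈ I, eval x q = 0} S)
    (hvu : ∀ x ∈ S, v (u x) = x) (huv : ∀ z, (∀ q ∈ I, eval z q = 0) → u (v z) = z)
    (hint : ∀ i, (pullback h𝒴 T g S).toRingHom.IsIntegralElem fun s => u s i) :
    IsFiniteMorphism 𝒳 𝒴 g S T := by
  have hST : S ∩ g ⁻¹' T = S := Set.inter_eq_left.mpr hg.1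
  refine ⟨hg, fun Q hQ => ⟨T, hQ, ⟨Set.univ, TopologicalSpace.GenerateOpen.univ,
    (Set.inter_univ T).symm⟩, hT, ?_⟩⟩
  rw [hST]
  refine ⟨⟨m, _, isClosed_zeros I, u, v, hu, hv, hvu, huv⟩, ?_⟩
  let _ : Algebra (regularAlgebra h𝒴 T) (S → k) := (pullback h𝒴 T g S).toRingHom.toAlgebra
  -- The algebra generated by the integral coordinates is a finite module. It contains every regular
  -- function on `S`, since these are polynomials in the coordinates.
  set N := Algebra.adjoin (regularAlgebra h𝒴 T) (Set.range fun i : Fin m => fun s : S => u s i)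
    with hN
  have hfg : N.toSubmodule.FG := fg_adjoin_of_finite (Set.finite_range _) (by
    rintro _ ⟨i, rfl⟩
    exact hint i)
  obtain ⟨r, b, hb⟩ := Submodule.fg_iff_exists_fin_generating_family.mp hfg
  have hreg : ∀ f ∈ N, ∃ f' : X → k, 𝒳.RegularOn S f' ∧ ∀ s : S, f' s = f s := by
    intro f hf
    induction hf using Algebra.adjoin_induction with
    | mem f hf =>
      obtain ⟨i, rfl⟩ := hf
      exact ⟨_, hureg i, fun _ => rfl⟩
    | algebraMap a =>
      exact ⟨_, hg.comp_regularOn h𝒳 a.2, fun _ => rfl⟩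
    | add f f' _ _ hf hf' =>
      obtain ⟨F, hF, hFe⟩ := hf
      obtain ⟨F', hF', hFe'⟩ := hf'
      exact ⟨_, h𝒳.add hF hF', fun s => by rw [hFe, hFe']; rfl⟩
    | mul f f' _ _ hf hf' =>
      obtain ⟨F, hF, hFe⟩ := hf
      obtain ⟨F', hF', hFe'⟩ := hf'
      exact ⟨_, h𝒳.mul hF hF', fun s => by rw [hFe, hFe']; rfl⟩
  have hbN : ∀ i, b i ∈ N := fun i => by
    have : b i ∈ N.toSubmodule := hb ▸ Submodule.subset_span ⟨i, rfl⟩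
    exact this
  choose b' hb' hbe using fun i => hreg (b i) (hbN i)
  refine ⟨r, b', hb', fun φ hφ => ?_⟩
  have hφv : (affineSpace k m).RegularOn {x | ∀ q ∈ I, eval x q = 0} (φ ∘ v) :=
    hv.comp_regularOn (affineSpace_isFractions m) hφ
  obtain ⟨P, hP⟩ := exists_polynomial_of_regularOn I hφv
  have hφN : (fun s : S => φ s) ∈ N := by
    have he : (fun s : S => φ s) = fun s : S => eval (u s) P := by
      funext s
      rw [← hP _ (hu.1 s.2), Function.comp_apply, hvu _ s.2]
    rw [he]
    clear hP hφv he
    induction P using MvPolynomial.induction_on with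
    | C c =>
      have : (fun s : S => eval (u s) (C c)) =
          algebraMap (regularAlgebra h𝒴 T) (S → k) (algebraMap k _ c) := by
        funext s
        rw [eval_C]
        rfl
      rw [this]
      exact Subalgebra.algebraMap_mem _ _
    | add p q hp hq =>
      simp only [map_add]
      exact N.add_mem hp hq
    | mul_X p i hp =>
      simp only [map_mul, eval_X]
      exact N.mul_mem hp (Algebra.subset_adjoin ⟨i, rfl⟩)
  have hφs : (fun s : S => φ s) ∈ Submodule.span (regularAlgebra h𝒴 T) (Set.range b) := hb ▸ hφN
  obtain ⟨a, ha⟩ := (Submodule.mem_span_range_iff_exists_fun _).mp hφs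
  refine ⟨fun i => (a i).1, fun i => (a i).2, fun x hx => ?_⟩
  have := congrFun ha ⟨x, hx⟩
  rw [Finset.sum_apply] at this
  rw [← this]
  refine Finset.sum_congr rfl fun i _ => ?_
  rw [hbe i ⟨x, hx⟩]
  rfl

end FiniteCriterion

end UnbddPreper

namespace UnbddPreper

/-! ### Backward branches -/

section Branches

/-- All backward branches of length `n` from the affine point `(a, b)` stay in the open set over
which the map is étale. -/
def BranchesRegular : ℕ → Qbar → Qbar → Prop
  | 0, a, b => b ≠ 0 ∧ a + 1 / 2 ≠ 0
  | n + 1, a, b => b ≠ 0 ∧ a + 1 / 2 ≠ 0 ∧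
      ∀ t, (a + 1 / 2) * t ^ 2 = b ^ 4 → BranchesRegular n b t

lemma BranchesRegular.ne_zero {n : ℕ} {a b : Qbar} (h : BranchesRegular n a b) :
    b ≠ 0 ∧ a + 1 / 2 ≠ 0 := by
  cases n with
  | zero => exact h
  | succ n => exact ⟨h.1, h.2.1⟩

lemma BranchesRegular.step {n : ℕ} {a b t : Qbar} (h : BranchesRegular (n + 1) a b)
    (ht : (a + 1 / 2) * t ^ 2 = b ^ 4) : BranchesRegular n b t := h.2.2 t ht

/-- The index serves both as position in the chain and as remaining branch length, so one step back
lowers both. The recurrence is required only for `j ≥ i`, because in the integrality induction the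
earlier terms are not yet available. -/
lemma BranchesRegular.of_chain {n i : ℕ} {z : ℕ → Qbar}
    (hz : ∀ j, i ≤ j → j < n → (z (j + 2) + 1 / 2) * z j ^ 2 = z (j + 1) ^ 4)
    (h : BranchesRegular n (z (n + 1)) (z n)) (hi : i ≤ n) :
    BranchesRegular i (z (i + 1)) (z i) := by
  induction hi using Nat.decreasingInduction with
  | self => exact h
  | of_succ j hj ih => exact (ih fun l hl => hz l (by omega)).step (hz j le_rfl hj)

/-- Splitting into even and odd parts in `t` makes the norm `h(x, t) h(x, -t)` equal to `p² - t²
q²`, a polynomial in `x` and `t²`. -/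
lemma exists_even_odd (h : MvPolynomial (Fin 2) Qbar) : ∃ p q : MvPolynomial (Fin 2) Qbar,
    ∀ x t, eval ![x, t] h = eval ![x, t ^ 2] p + t * eval ![x, t ^ 2] q := by
  induction h using MvPolynomial.induction_on with
  | C a => exact ⟨C a, 0, by simp⟩
  | add h h' hh hh' =>
    obtain ⟨p, q, hpq⟩ := hh
    obtain ⟨p', q', hpq'⟩ := hh'
    refine ⟨p + p', q + q', fun x t => ?_⟩
    rw [map_add, map_add, map_add, hpq, hpq']
    ring
  | mul_X h i hh =>
    obtain ⟨p, q, hpq⟩ := hh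
    fin_cases i
    · refine ⟨p * X 0, q * X 0, fun x t => ?_⟩
      rw [map_mul, hpq]
      simp
      ring
    · refine ⟨q * X 1, p, fun x t => ?_⟩
      rw [map_mul, hpq]
      simp
      ring

/-- For the substitution `t² = b⁴ / (a + 1/2)`, which is how a norm over the two backward branches
becomes a polynomial in the endpoint. -/
lemma exists_clear_denominator (h : MvPolynomial (Fin 2) Qbar) :
    ∃ (M : ℕ) (g : MvPolynomial (Fin 2) Qbar), ∀ a b : Qbar, a + 1 / 2 ≠ 0 →
      eval ![a, b] g = (a + 1 / 2) ^ M * eval ![b, b ^ 4 / (a + 1 / 2)] h := by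
  induction h using MvPolynomial.induction_on with
  | C a => exact ⟨0, C a, by simp⟩
  | add h h' hh hh' =>
    obtain ⟨M, g, hg⟩ := hh
    obtain ⟨M', g', hg'⟩ := hh'
    refine ⟨M + M', (X 0 + C (1 / 2)) ^ M' * g + (X 0 + C (1 / 2)) ^ M * g', fun a b hab => ?_⟩
    simp only [map_add, map_mul, map_pow, hg a b hab, hg' a b hab, eval_X, eval_C, Matrix.cons_val]
    ring
  | mul_X h i hh =>
    obtain ⟨M, g, hg⟩ := hh
    fin_cases i
    · refine ⟨M, g * X 1, fun a b hab => ?_⟩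
      rw [map_mul, map_mul, hg a b hab]
      simp [mul_assoc]
    · refine ⟨M + 1, g * X 1 ^ 4, fun a b hab => ?_⟩
      rw [map_mul, map_mul, hg a b hab]
      simp only [map_pow, eval_X, Fin.mk_one, Matrix.cons_val]
      generalize a + 1 / 2 = s at hab ⊢
      field_simp
      ring

/-- The two preimages of `(a, b)` are `(b, t)` and `(b, -t)`. Regularity of both is nonvanishing of
the norm of the previous polynomial, which becomes a polynomial in `a, b` once denominators are
cleared. -/
lemma exists_branchPolynomial (n : ℕ) : ∃ H : MvPolynomial (Fin 2) Qbar,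
    ∀ a b, eval ![a, b] H ≠ 0 ↔ BranchesRegular n a b := by
  induction n with
  | zero => exact ⟨X 1 * (X 0 + C (1 / 2)), fun a b => by simp [BranchesRegular]⟩
  | succ n ih =>
    obtain ⟨h, hh⟩ := ih
    obtain ⟨p, q, hpq⟩ := exists_even_odd h
    obtain ⟨M, g, hg⟩ := exists_clear_denominator (p ^ 2 - X 1 * q ^ 2)
    refine ⟨X 1 * (X 0 + C (1 / 2)) * g, fun a b => ?_⟩
    have hfac : eval ![a, b] (X 1 * (X 0 + C (1 / 2)) * g) ≠ 0 ↔
        b ≠ 0 ∧ a + 1 / 2 ≠ 0 ∧ eval ![a, b] g ≠ 0 := by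
      simp [and_assoc]
    rw [hfac]
    refine and_congr_right fun _ => and_congr_right fun ha => ?_
    have key : ∀ t, (a + 1 / 2) * t ^ 2 = b ^ 4 →
        (eval ![a, b] g ≠ 0 ↔ BranchesRegular n b t ∧ BranchesRegular n b (-t)) := by
      intro t ht
      have ht' : b ^ 4 / (a + 1 / 2) = t ^ 2 := by
        rw [← ht, mul_div_cancel_left₀ _ ha]
      have hprod : eval ![b, t ^ 2] (p ^ 2 - X 1 * q ^ 2) =
          eval ![b, t] h * eval ![b, -t] h := by
        rw [hpq, hpq, neg_sq]
        simp
        ring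
      rw [hg a b ha, ht', hprod, ← hh, ← hh]
      simp [ha, -one_div]
    constructor
    · intro hne t ht
      exact ((key t ht).mp hne).1
    · intro hall
      obtain ⟨t, ht⟩ := IsAlgClosed.exists_pow_nat_eq (b ^ 4 / (a + 1 / 2)) two_pos
      have ht1 : (a + 1 / 2) * t ^ 2 = b ^ 4 := by
        rw [ht]
        generalize a + 1 / 2 = s at ha ⊢
        field_simp
      exact (key t ht1).mpr ⟨hall t ht1, hall (-t) (by rw [neg_sq]; exact ht1)⟩

end Branches

/-! ### The coordinates of the iterates -/

section Coordinates

/-- The `i`-th coordinate of the `n`-th iterate at the vector `v`. -/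
noncomputable def coordIter (n : ℕ) (i : Fin 3) (v : Fin 3 → Qbar) : Qbar :=
  eval v (iter (fMap 4 2) n i)

variable {n : ℕ} {v : Fin 3 → Qbar} {P Q : P2 Qbar}

lemma coordIter_zero (i : Fin 3) : coordIter 0 i v = v i := by
  simp [coordIter, iter]

lemma coordIter_succ_zero : coordIter (n + 1) 0 v =
    coordIter n 0 v ^ 4 - 1 / 2 * coordIter n 1 v ^ 2 * coordIter n 2 v ^ 2 := by
  simp [coordIter, iter_fMap_succ_zero]

lemma coordIter_succ_one : coordIter (n + 1) 1 v =
    coordIter n 0 v * coordIter n 1 v ^ 2 * coordIter n 2 v := by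
  simp [coordIter, iter_fMap_succ_one]

lemma coordIter_succ_two : coordIter (n + 1) 2 v = coordIter n 1 v ^ 2 * coordIter n 2 v ^ 2 := by
  simp [coordIter, iter_fMap_succ_two]

lemma coordIter_succ_two_ne_zero :
    coordIter (n + 1) 2 v ≠ 0 ↔ coordIter n 1 v ≠ 0 ∧ coordIter n 2 v ≠ 0 := by
  rw [coordIter_succ_two]
  simp

/-- The next third coordinate is the square of the product of the last two. So one nonvanishing at
level `n + 1` records that the last two coordinates of all iterates up to `n` are nonzero. -/
lemma coordIter_ne_zero_of_le (h : coordIter (n + 1) 2 v ≠ 0) {i : ℕ} (hi : i ≤ n) :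
    coordIter i 1 v ≠ 0 ∧ coordIter i 2 v ≠ 0 := by
  induction hi using Nat.decreasingInduction with
  | self => exact coordIter_succ_two_ne_zero.mp h
  | of_succ j hj ih => exact coordIter_succ_two_ne_zero.mp ih.2

/-- The second affine coordinate of the `i`-th iterate. -/
noncomputable def tau (i : ℕ) (P : P2 Qbar) : Qbar := coordIter i 1 P.rep / coordIter i 2 P.rep

/-- The map shifts coordinates, so the sequence `tau` alone determines all the affine iterates. -/
lemma tau_succ (h : coordIter (n + 1) 2 P.rep ≠ 0) :
    tau (n + 1) P = coordIter n 0 P.rep / coordIter n 2 P.rep := by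
  obtain ⟨h1, h2⟩ := coordIter_succ_two_ne_zero.mp h
  rw [tau, coordIter_succ_one, coordIter_succ_two]
  field_simp

lemma tau_recurrence (h : coordIter (n + 1) 2 P.rep ≠ 0) {i : ℕ} (hi : i < n) :
    (tau (i + 2) P + 1 / 2) * tau i P ^ 2 = tau (i + 1) P ^ 4 := by
  have h2 : coordIter (i + 2) 2 P.rep ≠ 0 := by
    obtain rfl | hlt := Nat.eq_or_lt_of_le (show i + 1 ≤ n from hi)
    · exact h
    · exact (coordIter_ne_zero_of_le h (show i + 2 ≤ n from hlt)).2
  have h1 := (coordIter_ne_zero_of_le h (show i + 1 ≤ n from hi)).2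
  have h0 := coordIter_ne_zero_of_le h hi.le
  rw [tau_succ h2, tau_succ h1, coordIter_succ_zero, coordIter_succ_two, tau]
  have := h0.1
  have := h0.2
  field_simp
  ring

lemma tau_ne_zero (h : coordIter (n + 1) 2 P.rep ≠ 0) {i : ℕ} (hi : i ≤ n) : tau i P ≠ 0 :=
  div_ne_zero (coordIter_ne_zero_of_le h hi).1 (coordIter_ne_zero_of_le h hi).2

lemma coordIter_isHomogeneous (n : ℕ) (i : Fin 3) :
    (iter (fMap 4 2) n i).IsHomogeneous (4 ^ n) :=
  iter_fMap_isHomogeneous (by norm_num) n i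

lemma coordIter_smul (c : Qbar) (i : Fin 3) :
    coordIter n i (c • v) = c ^ 4 ^ n * coordIter n i v :=
  eval_smul_of_isHomogeneous (coordIter_isHomogeneous n i) c v

/-- The coordinates of the iterates at the end of a chain of preimages. -/
lemma coordIter_chain {z : ℕ → Qbar} (hz0 : ∀ i ≤ n, z i ≠ 0)
    (hz : ∀ i < n, (z (i + 2) + 1 / 2) * z i ^ 2 = z (i + 1) ^ 4) {i : ℕ} (hi : i ≤ n) :
    coordIter i 2 ![z 1, z 0, 1] ≠ 0 ∧
      coordIter i 1 ![z 1, z 0, 1] = z i * coordIter i 2 ![z 1, z 0, 1] ∧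
      coordIter i 0 ![z 1, z 0, 1] = z (i + 1) * coordIter i 2 ![z 1, z 0, 1] := by
  induction i with
  | zero => simp [coordIter_zero]
  | succ i ih =>
    obtain ⟨h2, h1, h0⟩ := ih (by omega)
    have hzi := hz0 i (by omega)
    rw [coordIter_succ_two, coordIter_succ_one, coordIter_succ_zero, h1, h0]
    refine ⟨by simp [hzi, h2], by ring, ?_⟩
    linear_combination (-coordIter i 2 ![z 1, z 0, 1] ^ 4) * hz i (by omega)

lemma tau_affinePoint_chain {z : ℕ → Qbar} (hz0 : ∀ i ≤ n, z i ≠ 0)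
    (hz : ∀ i < n, (z (i + 2) + 1 / 2) * z i ^ 2 = z (i + 1) ^ 4) :
    coordIter (n + 1) 2 (affinePoint (z 1) (z 0)).rep ≠ 0 ∧
      ∀ i ≤ n + 1, tau i (affinePoint (z 1) (z 0)) = z i := by
  obtain ⟨c, hc, hrep⟩ := affinePoint_rep (z 1) (z 0)
  have key : ∀ i ≤ n, coordIter i 2 (affinePoint (z 1) (z 0)).rep ≠ 0 ∧
      coordIter i 1 (affinePoint (z 1) (z 0)).rep =
        z i * coordIter i 2 (affinePoint (z 1) (z 0)).rep ∧
      coordIter i 0 (affinePoint (z 1) (z 0)).rep =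
        z (i + 1) * coordIter i 2 (affinePoint (z 1) (z 0)).rep := by
    intro i hi
    obtain ⟨h2, h1, h0⟩ := coordIter_chain hz0 hz hi
    rw [hrep, coordIter_smul, coordIter_smul, coordIter_smul, h1, h0]
    exact ⟨mul_ne_zero (pow_ne_zero _ hc) h2, by ring, by ring⟩
  have hn : coordIter (n + 1) 2 (affinePoint (z 1) (z 0)).rep ≠ 0 := by
    obtain ⟨h2, h1, -⟩ := key n le_rfl
    rw [coordIter_succ_two_ne_zero, h1]
    exact ⟨mul_ne_zero (hz0 n le_rfl) h2, h2⟩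
  refine ⟨hn, fun i hi => ?_⟩
  obtain rfl | hlt := Nat.eq_or_lt_of_le hi
  · obtain ⟨h2, -, h0⟩ := key n le_rfl
    rw [tau_succ hn, h0, mul_div_cancel_right₀ _ h2]
  · obtain ⟨h2, h1, -⟩ := key i (by omega)
    rw [tau, h1, mul_div_cancel_right₀ _ h2]

/-- Every representative is a multiple of the coprime one, so the iterate is defined exactly where
the coprime coordinates do not all vanish. -/
lemma sends_iter_iff : Sends (iter (fMap 4 2) n) P Q ↔
    ∃ h : (fun i => coordIter n i P.rep) ≠ 0, Q = Projectivization.mk Qbar _ h := by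
  constructor
  · rintro ⟨e, G, hG, h, rfl⟩
    obtain ⟨q, hq⟩ := hG.exists_eq_mul (by norm_num) Nat.prime_two
    have he : (fun i => eval P.rep (G i)) = eval P.rep q • fun i => coordIter n i P.rep := by
      funext i
      rw [hq, map_mul]
      rfl
    have h' : (fun i => coordIter n i P.rep) ≠ 0 := by
      intro h0
      rw [he, h0, smul_zero] at h
      exact h rfl
    refine ⟨h', ?_⟩
    rw [Projectivization.mk_eq_mk_iff']
    exact ⟨_, he.symm⟩
  · rintro ⟨h, rfl⟩
    exact ⟨_, _, represents_iter_fMap (by norm_num) n, h, rfl⟩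

/-- The affine points all of whose backward branches of length `n` are regular. -/
def branchSet (n : ℕ) : Set (P2 Qbar) :=
  {Q | Q.rep 2 ≠ 0 ∧ BranchesRegular n (Q.rep 0 / Q.rep 2) (Q.rep 1 / Q.rep 2)}

/-- The pairs consisting of a point and its image in `branchSet n` under the `n`-th iterate. -/
def chainSet (n : ℕ) : Set (P2 Qbar × P2 Qbar) :=
  {R | coordIter (n + 1) 2 R.1.rep ≠ 0 ∧ R.2 = affinePoint (tau (n + 1) R.1) (tau n R.1) ∧
    BranchesRegular n (tau (n + 1) R.1) (tau n R.1)}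

lemma affinePoint_mem_branchSet {a b : Qbar} :
    affinePoint a b ∈ branchSet n ↔ BranchesRegular n a b := by
  obtain ⟨h2, h0, h1⟩ := affinePoint_coords a b
  change (_ ≠ 0 ∧ BranchesRegular n _ _) ↔ _
  rw [h0, h1]
  exact and_iff_right h2

lemma snd_mem_branchSet {R : P2 Qbar × P2 Qbar} (hR : R ∈ chainSet n) : R.2 ∈ branchSet n := by
  rw [hR.2.1, affinePoint_mem_branchSet]
  exact hR.2.2

lemma mk_coordIter (h : (fun i => coordIter n i P.rep) ≠ 0) (h2 : coordIter (n + 1) 2 P.rep ≠ 0) :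
    Projectivization.mk Qbar _ h = affinePoint (tau (n + 1) P) (tau n P) := by
  have h3 := (coordIter_succ_two_ne_zero.mp h2).2
  rw [affinePoint, Projectivization.mk_eq_mk_iff']
  refine ⟨coordIter n 2 P.rep, funext fun i => ?_⟩
  rw [tau_succ h2, tau]
  fin_cases i <;> simp [mul_div_cancel₀, h3]

lemma sends_iter_iff_mem_chainSet (hQ : Q ∈ branchSet n) :
    Sends (iter (fMap 4 2) n) P Q ↔ (P, Q) ∈ chainSet n := by
  rw [sends_iter_iff]
  constructor
  · rintro ⟨h, rfl⟩
    obtain ⟨c, hc, hrep⟩ := mk_rep_eq_smul h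
    obtain ⟨hQ2, hQb⟩ := hQ
    rw [hrep] at hQ2 hQb
    have h2 : coordIter n 2 P.rep ≠ 0 := right_ne_zero_of_mul hQ2
    have h1 : coordIter n 1 P.rep ≠ 0 := fun h1 => hQb.ne_zero.1 (by simp [h1])
    have h3 := coordIter_succ_two_ne_zero.mpr ⟨h1, h2⟩
    have he := mk_coordIter h h3
    refine ⟨h3, he, ?_⟩
    change BranchesRegular n (tau (n + 1) P) (tau n P)
    rw [tau_succ h3, tau]
    simpa [mul_div_mul_left _ _ hc] using hQb
  · rintro ⟨h2, he, -⟩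
    have h3 := (coordIter_succ_two_ne_zero.mp h2).2
    have h : (fun i => coordIter n i P.rep) ≠ 0 := fun h => h3 (congrFun h 2)
    exact ⟨h, he.trans (mk_coordIter h h2).symm⟩

end Coordinates

end UnbddPreper

namespace UnbddPreper

/-! ### Finiteness of the iterates over `branchSet` -/

section BranchSet

variable {n : ℕ}

lemma branchSet_subset_finitePart : branchSet n ⊆ finitePart Qbar := fun _ hQ => hQ.1

lemma regularOn_affine_eval (H : MvPolynomial (Fin 2) Qbar) : (plane Qbar).RegularOn
    (finitePart Qbar) fun Q => eval ![Q.rep 0 / Q.rep 2, Q.rep 1 / Q.rep 2] H := by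
  refine plane_isFractions.eval_regular (fun i => ?_) H
  fin_cases i
  · exact regularOn_coord_div 0
  · exact regularOn_coord_div 1

lemma isOpen_branchSet : IsOpen[(plane Qbar).top] (branchSet n) := by
  obtain ⟨H, hH⟩ := exists_branchPolynomial n
  have h := (plane_isFractions.openIn_ne_zero (regularOn_affine_eval H)).isOpen isOpen_finitePart
  convert h using 1
  ext Q
  exact and_congr_right fun _ => (hH _ _).symm

lemma isAffine_branchSet : (plane Qbar).IsAffine (branchSet n) := by
  obtain ⟨H, hH⟩ := exists_branchPolynomial n
  -- Rabinowitsch's trick: the principal open set `H ≠ 0` of the affine plane is the surface `z₂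
  -- H(z₀, z₁) = 1` in affine 3-space.
  let I : Set (MvPolynomial (Fin 3) Qbar) := {X 2 * rename ![0, 1] H - 1}
  have hI : ∀ z : Fin 3 → Qbar, (∀ q ∈ I, eval z q = 0) ↔ z 2 * eval ![z 0, z 1] H = 1 := by
    intro z
    have : z ∘ ![0, 1] = ![z 0, z 1] := by
      funext i
      fin_cases i <;> rfl
    simp [I, eval_rename, this, sub_eq_zero]
  have hreg := (regularOn_affine_eval H).mono (branchSet_subset_finitePart (n := n))
  have hinv := plane_isFractions.inv hreg fun Q hQ => (hH _ _).mpr hQ.2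
  refine ⟨3, _, isClosed_zeros I, fun Q => ![Q.rep 0 / Q.rep 2, Q.rep 1 / Q.rep 2,
    (eval ![Q.rep 0 / Q.rep 2, Q.rep 1 / Q.rep 2] H)⁻¹], fun z => affinePoint (z 0) (z 1),
    plane_isFractions.isMorphism_affineSpace ?_ ?_,
    isMorphism_affinePoint (affineSpace_isFractions 3) (regularOn_coord _ 0) (regularOn_coord _ 1) ?_,
    ?_, ?_⟩
  · intro Q hQ
    exact (hI _).mpr (inv_mul_cancel₀ ((hH _ _).mpr hQ.2))
  · intro i
    fin_cases i
    · exact (regularOn_coord_div 0).mono branchSet_subset_finitePart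
    · exact (regularOn_coord_div 1).mono branchSet_subset_finitePart
    · exact hinv
  · intro z hz
    refine affinePoint_mem_branchSet.mpr ((hH _ _).mp ?_)
    exact right_ne_zero_of_mul_eq_one ((hI z).mp hz)
  · intro Q hQ
    exact (eq_affinePoint hQ.1).symm
  · intro z hz
    obtain ⟨-, h0, h1⟩ := affinePoint_coords (z 0) (z 1)
    have hw : (eval ![z 0, z 1] H)⁻¹ = z 2 := (eq_inv_of_mul_eq_one_left ((hI z).mp hz)).symm
    simp only [h0, h1, hw]
    funext i
    fin_cases i <;> rfl

lemma coordIter_two_ne_zero {R : P2 Qbar × P2 Qbar} (hR : R ∈ chainSet n) {i : ℕ} (hi : i ≤ n + 1) :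
    coordIter i 2 R.1.rep ≠ 0 := by
  obtain rfl | hlt := Nat.eq_or_lt_of_le hi
  · exact hR.1
  · exact (coordIter_ne_zero_of_le hR.1 (Nat.lt_succ_iff.mp hlt)).2

lemma regularOn_quotient {e : ℕ} {A B : MvPolynomial (Fin 3) Qbar} (hA : A.IsHomogeneous e)
    (hB : B.IsHomogeneous e) :
    (plane Qbar).RegularOn {P | eval P.rep B ≠ 0} fun P => eval P.rep A / eval P.rep B :=
  plane_isFractions.regularOn_iff.mpr fun _ hP => ⟨_, _, ⟨e, A, B, hA, hB, rfl⟩, hP, fun _ _ _ => rfl⟩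

lemma regularOn_tau {i : ℕ} (hi : i ≤ n + 1) :
    (planeSq Qbar).RegularOn (chainSet n) fun R => tau i R.1 :=
  regularOn_comp_fst (regularOn_quotient (coordIter_isHomogeneous i 1) (coordIter_isHomogeneous i 2))
    fun _ hR => coordIter_two_ne_zero hR hi

/-- The pullback of the regular functions on `branchSet n` to the graph of the `n`-th iterate. -/
noncomputable def chainPullback (n : ℕ) :
    regularAlgebra plane_isFractions (branchSet n) →ₐ[Qbar] (chainSet n → Qbar) :=
  pullback plane_isFractions (branchSet n) Prod.snd (chainSet n)

lemma snd_coords {R : P2 Qbar × P2 Qbar} (hR : R ∈ chainSet n) :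
    R.2.rep 0 / R.2.rep 2 = tau (n + 1) R.1 ∧ R.2.rep 1 / R.2.rep 2 = tau n R.1 := by
  rw [hR.2.1]
  exact (affinePoint_coords _ _).2

lemma isIntegralElem_of_regularOn {φ : P2 Qbar → Qbar} (hφ : (plane Qbar).RegularOn (branchSet n) φ)
    {f : chainSet n → Qbar} (h : ∀ s : chainSet n, φ s.1.2 = f s) :
    (chainPullback n).toRingHom.IsIntegralElem f := by
  have : f = (chainPullback n).toRingHom ⟨φ, hφ⟩ := funext fun s => (h s).symm
  rw [this]
  exact RingHom.isIntegralElem_map _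

/-- Descending induction. The last two terms are coordinates of the target; earlier ones come from
`tau i ^ 2 = tau (i+1) ^ 4 / (tau (i+2) + 1/2)`, so the point is integrality of the inverse of the
denominator. Inverses are claimed only for `j ≤ n`: the first coordinate `tau (n+1)` of the target
may vanish. -/
lemma isIntegralElem_tau (n : ℕ) {i : ℕ} (hi : i ≤ n) : ∀ j, i ≤ j → j ≤ n + 1 →
    (chainPullback n).toRingHom.IsIntegralElem (fun s => tau j s.1.1) ∧
      (j ≤ n → (chainPullback n).toRingHom.IsIntegralElem fun s => (tau j s.1.1)⁻¹) := by
  obtain ⟨H, hH⟩ := exists_branchPolynomial n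
  have hreg0 := (regularOn_coord_div (k := Qbar) 0).mono (branchSet_subset_finitePart (n := n))
  have hreg1 := (regularOn_coord_div (k := Qbar) 1).mono (branchSet_subset_finitePart (n := n))
  induction hi using Nat.decreasingInduction with
  | self =>
    intro j hj hj'
    obtain rfl | rfl : j = n ∨ j = n + 1 := by omega
    · refine ⟨isIntegralElem_of_regularOn hreg1 fun s => (snd_coords s.2).2, fun _ => ?_⟩
      exact isIntegralElem_of_regularOn (plane_isFractions.inv hreg1 fun Q hQ => hQ.2.ne_zero.1)
        fun s => congrArg _ (snd_coords s.2).2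
    · exact ⟨isIntegralElem_of_regularOn hreg0 fun s => (snd_coords s.2).1, fun h => by omega⟩
  | of_succ i hi ih =>
    intro j hij hj
    obtain rfl | hlt := Nat.eq_or_lt_of_le hij
    swap
    · exact ih j hlt hj
    let _ : Algebra (regularAlgebra plane_isFractions (branchSet n)) (chainSet n → Qbar) :=
      (chainPullback n).toRingHom.toAlgebra
    have hst : IsScalarTower Qbar (regularAlgebra plane_isFractions (branchSet n))
      (chainSet n → Qbar) := IsScalarTower.of_algebraMap_eq fun x => ((chainPullback n).commutes x).symm
    let c : ℕ → chainSet n → Qbar := fun j s => tau j s.1.1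
    -- Adjoining the inverse of `H` forces every character of `B` to send the endpoint of the chain
    -- into the regular locus.
    let w : chainSet n → Qbar := fun s => (eval ![tau (n + 1) s.1.1, tau n s.1.1] H)⁻¹
    have hw : IsIntegral (regularAlgebra plane_isFractions (branchSet n)) w := by
      refine isIntegralElem_of_regularOn (plane_isFractions.inv
        ((regularOn_affine_eval H).mono branchSet_subset_finitePart) fun Q hQ => (hH _ _).mpr hQ.2)
        fun s => ?_
      rw [(snd_coords s.2).1, (snd_coords s.2).2]
    have hrel : ∀ l < n, (c (l + 2) + algebraMap Qbar _ (1 / 2)) * c l ^ 2 = c (l + 1) ^ 4 :=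
      fun l hl => funext fun s => tau_recurrence s.2.1 hl
    set B := Algebra.adjoin Qbar (insert w (c '' Set.Icc (i + 1) (n + 1))) with hB
    have hwB : w ∈ B := Algebra.subset_adjoin (Set.mem_insert _ _)
    have hcB : ∀ l, i + 1 ≤ l → l ≤ n + 1 → c l ∈ B := fun l h1 h2 =>
      Algebra.subset_adjoin (Set.mem_insert_of_mem _ ⟨l, ⟨h1, h2⟩, rfl⟩)
    obtain ⟨γ, hγ⟩ : ∃ γ : ℕ → B, ∀ l, i + 1 ≤ l → l ≤ n + 1 → (γ l : chainSet n → Qbar) = c l := by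
      classical
      refine ⟨fun l => if h : i + 1 ≤ l ∧ l ≤ n + 1 then ⟨c l, hcB l h.1 h.2⟩ else 0,
        fun l h1 h2 => ?_⟩
      simp only [dif_pos (And.intro h1 h2)]
    have hint : ∀ x ∈ insert w (c '' Set.Icc (i + 1) (n + 1)),
        IsIntegral (regularAlgebra plane_isFractions (branchSet n)) x := by
      rintro x (rfl | ⟨l, ⟨h1, h2⟩, rfl⟩)
      · exact hw
      · exact (ih l h1 h2).1
    have hmem : c (i + 2) + algebraMap Qbar _ (1 / 2) ∈ B :=
      B.add_mem (hcB _ (by omega) (by omega)) (B.algebraMap_mem _)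
    -- A character of `B` turns the functions `c l` into numbers satisfying the same recurrence and
    -- ending at a regular pair. Regularity propagates back along this chain, so the denominator
    -- cannot be sent to 0.
    obtain ⟨e, he, heint⟩ := exists_inverse_isIntegral
      (((Set.finite_Icc _ _).image _).insert _) hint hmem (fun χ hχ => by
        have hz : ∀ l, i + 1 ≤ l → l < n →
            (χ (γ (l + 2)) + 1 / 2) * χ (γ l) ^ 2 = χ (γ (l + 1)) ^ 4 := by
          intro l h1 h2
          have : (γ (l + 2) + algebraMap Qbar B (1 / 2)) * γ l ^ 2 = γ (l + 1) ^ 4 := by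
            apply Subtype.ext
            push_cast
            rw [hγ _ (by omega) (by omega), hγ _ (by omega) (by omega), hγ _ (by omega) (by omega)]
            exact hrel l h2
          have := congrArg χ this
          rw [map_mul, map_add, map_pow, map_pow, AlgHom.commutes] at this
          exact this
        have hone : (⟨w, hwB⟩ : B) * aeval ![γ (n + 1), γ n] H = 1 := by
          apply Subtype.ext
          funext s
          have h1 : ((aeval ![γ (n + 1), γ n] H : B) : chainSet n → Qbar) s =
              eval ![tau (n + 1) s.1.1, tau n s.1.1] H := by
            let ev : B →ₐ[Qbar] Qbar := (Pi.evalAlgHom Qbar (fun _ => Qbar) s).comp B.val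
            change ev (aeval ![γ (n + 1), γ n] H) = _
            rw [← AlgHom.comp_apply, comp_aeval, ← coe_aeval_eq_eval]
            change aeval _ H = aeval _ H
            congr 2
            funext l
            fin_cases l
            · exact congrFun (hγ (n + 1) (by omega) le_rfl) s
            · exact congrFun (hγ n (by omega) (by omega)) s
          change w s * _ = 1
          rw [h1]
          exact inv_mul_cancel₀ ((hH _ _).mpr s.2.2.2)
        have hHz : eval ![χ (γ (n + 1)), χ (γ n)] H ≠ 0 := by
          have := congrArg χ hone
          rw [map_mul, map_one, ← AlgHom.comp_apply, comp_aeval] at this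
          have h2 : (fun l => χ (![γ (n + 1), γ n] l)) = ![χ (γ (n + 1)), χ (γ n)] := by
            funext l
            fin_cases l <;> rfl
          rw [h2] at this
          exact right_ne_zero_of_mul_eq_one this
        have hbr := BranchesRegular.of_chain (z := fun l => χ (γ l)) hz ((hH _ _).mp hHz)
          (show i + 1 ≤ n from hi)
        refine hbr.ne_zero.2 ?_
        have : (⟨_, hmem⟩ : B) = γ (i + 2) + algebraMap Qbar B (1 / 2) := by
          apply Subtype.ext
          push_cast
          rw [hγ _ (by omega) (by omega)]
        rw [this, map_add, AlgHom.commutes] at hχ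
        exact hχ)
    have hci : IsIntegral (regularAlgebra plane_isFractions (branchSet n)) (c (i + 1)) :=
      (ih (i + 1) le_rfl (by omega)).1
    have hci' : IsIntegral (regularAlgebra plane_isFractions (branchSet n)) (c (i + 1))⁻¹ :=
      (ih (i + 1) le_rfl (by omega)).2 hi
    have hc2 : IsIntegral (regularAlgebra plane_isFractions (branchSet n)) (c (i + 2)) :=
      (ih (i + 2) (by omega) (by omega)).1
    constructor
    · have : c i ^ 2 = c (i + 1) ^ 4 * e := by
        rw [← hrel i hi]
        linear_combination (-c i ^ 2) * he
      have h2 : IsIntegral (regularAlgebra plane_isFractions (branchSet n)) (c i ^ 2) := by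
        rw [this]
        exact (hci.pow 4).mul heint
      exact IsIntegral.of_pow two_pos h2
    · intro _
      have : (c i)⁻¹ ^ 2 = (c (i + 2) + algebraMap Qbar _ (1 / 2)) * (c (i + 1))⁻¹ ^ 4 := by
        funext s
        have h0 := tau_ne_zero s.2.1 hi.le
        have h1 := tau_ne_zero s.2.1 (show i + 1 ≤ n from hi)
        have h2 := tau_recurrence s.2.1 hi
        change (tau i s.1.1)⁻¹ ^ 2 = (tau (i + 2) s.1.1 + 1 / 2) * (tau (i + 1) s.1.1)⁻¹ ^ 4
        rw [inv_pow, inv_pow, ← h2, mul_inv, ← mul_assoc, mul_inv_cancel₀, one_mul]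
        intro h3
        rw [h3, zero_mul] at h2
        exact pow_ne_zero 4 h1 h2.symm
      have h2 : IsIntegral (regularAlgebra plane_isFractions (branchSet n)) ((c i)⁻¹ ^ 2) := by
        rw [this]
        refine (hc2.add ?_).mul (hci'.pow 4)
        rw [IsScalarTower.algebraMap_apply Qbar (regularAlgebra plane_isFractions (branchSet n))]
        exact isIntegral_algebraMap
      exact IsIntegral.of_pow two_pos h2

end BranchSet

end UnbddPreper

namespace UnbddPreper

/-! ### The closure of the graph adds no points over `branchSet n`. -/

section GraphClosure

variable {n : ℕ}

/-- A regular function which does not vanish at a point of the graph over `branchSet n` does not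
vanish at some point of `chainSet n`. -/
lemma exists_mem_chainSet_ne_zero {R : P2 Qbar × P2 Qbar} (hR : R ∈ graph (iter (fMap 4 2) n))
    (hRU : R.2 ∈ branchSet n) {O : Set (P2 Qbar × P2 Qbar)} (hO : IsOpen[(planeSq Qbar).top] O)
    (hRO : R ∈ O) {φ : P2 Qbar × P2 Qbar → Qbar} (hφ : (planeSq Qbar).RegularOn O φ)
    (hφR : φ R ≠ 0) : ∃ R' ∈ chainSet n, R' ∈ O ∧ φ R' ≠ 0 := by
  have h1 := (planeSq_isFractions.openIn_ne_zero hφ).isOpen hO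
  have h2 := TopologicalSpace.GenerateOpen.inter _ _ h1 (isOpen_snd_preimage (isOpen_branchSet (n := n)))
  obtain ⟨R', ⟨⟨hR'O, hR'φ⟩, hR'U⟩, hR'⟩ :=
    (@mem_closure_iff _ (planeSq Qbar).top _ _).mp hR _ h2 ⟨⟨hRO, hφR⟩, hRU⟩
  exact ⟨R', (sends_iter_iff_mem_chainSet hR'U).mp hR', hR'O, hR'φ⟩

/-- A valuative argument without valuations: dividing the integral equation of `A / B` by its top
power gives a monic-type relation in `B / A` that holds on `chainSet n`. By density it persists at
the limit point `R`; if `B` vanished there and `A` did not, it would read `1 = 0`. -/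
lemma eval_eq_zero_of_isIntegralElem {R : P2 Qbar × P2 Qbar}
    (hR : R ∈ graph (iter (fMap 4 2) n)) (hRU : R.2 ∈ branchSet n) {e : ℕ}
    {A B : MvPolynomial (Fin 3) Qbar} (hA : A.IsHomogeneous e) (hB : B.IsHomogeneous e)
    (hB0 : ∀ R' ∈ chainSet n, eval R'.1.rep B ≠ 0)
    (hint : (chainPullback n).toRingHom.IsIntegralElem
      fun s => eval s.1.1.rep A / eval s.1.1.rep B)
    (h : eval R.1.rep B = 0) : eval R.1.rep A = 0 := by
  by_contra hne
  obtain ⟨q, hq, hq0⟩ := hint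
  set r := q.natDegree with hr
  let O : Set (P2 Qbar × P2 Qbar) := {R | eval R.1.rep A ≠ 0} ∩ Prod.snd ⁻¹' branchSet n
  have hO : IsOpen[(planeSq Qbar).top] O := TopologicalSpace.GenerateOpen.inter _ _
    (planeSq_isFractions.basic_isOpen (planeSqPairs_fst ⟨e, A, A, hA, hA, rfl⟩))
    (isOpen_snd_preimage isOpen_branchSet)
  let φ : P2 Qbar × P2 Qbar → Qbar := fun R => ∑ i ∈ Finset.range (r + 1),
    (q.coeff i).1 R.2 * (eval R.1.rep B / eval R.1.rep A) ^ (r - i)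
  have hφ : (planeSq Qbar).RegularOn O φ := by
    refine planeSq_isFractions.sum _ fun i _ => planeSq_isFractions.mul ?_
      (planeSq_isFractions.pow ?_ _)
    · exact regularOn_comp_snd (q.coeff i).2 fun _ hR => hR.2
    · exact regularOn_comp_fst (regularOn_quotient hB hA) fun _ hR => hR.1
  have hφR : φ R ≠ 0 := by
    have : φ R = 1 := by
      change ∑ i ∈ Finset.range (r + 1), _ = _
      rw [Finset.sum_range_succ, Finset.sum_eq_zero, hr, hq.coeff_natDegree]
      · simp
      · intro i hi
        rw [h, zero_div, zero_pow (by have := Finset.mem_range.mp hi; omega), mul_zero]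
    rw [this]
    exact one_ne_zero
  obtain ⟨R', hR', hR'O, hne'⟩ := exists_mem_chainSet_ne_zero hR hRU hO ⟨hne, hRU⟩ hφ hφR
  apply hne'
  have h0 := congrFun hq0 ⟨R', hR'⟩
  rw [Polynomial.eval₂_eq_sum_range, Finset.sum_apply] at h0
  have hA' : eval R'.1.rep A ≠ 0 := hR'O.1
  have hB' := hB0 R' hR'
  have : φ R' = (eval R'.1.rep B / eval R'.1.rep A) ^ r * ∑ i ∈ Finset.range (r + 1),
      (q.coeff i).1 R'.2 * (eval R'.1.rep A / eval R'.1.rep B) ^ i := by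
    rw [Finset.mul_sum]
    refine Finset.sum_congr rfl fun i hi => ?_
    have hi' : i ≤ r := Nat.lt_succ_iff.mp (Finset.mem_range.mp hi)
    have hpow : (eval R'.1.rep B / eval R'.1.rep A) ^ r =
        (eval R'.1.rep B / eval R'.1.rep A) ^ (r - i) *
          (eval R'.1.rep B / eval R'.1.rep A) ^ i := by
      rw [← pow_add, Nat.sub_add_cancel hi']
    have hinv : (eval R'.1.rep B / eval R'.1.rep A) ^ i *
        (eval R'.1.rep A / eval R'.1.rep B) ^ i = 1 := by
      rw [← mul_pow, div_mul_div_cancel₀ hA', div_self hB', one_pow]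
    rw [hpow]
    linear_combination (-(q.coeff i).1 R'.2 *
      (eval R'.1.rep B / eval R'.1.rep A) ^ (r - i)) * hinv
  rw [this]
  exact mul_eq_zero_of_right _ h0

lemma tau_one {P : P2 Qbar} (h : coordIter 1 2 P.rep ≠ 0) : tau 1 P = P.rep 0 / P.rep 2 := by
  rw [tau_succ h, coordIter_zero, coordIter_zero]

lemma tau_zero (P : P2 Qbar) : tau 0 P = P.rep 1 / P.rep 2 := by
  rw [tau, coordIter_zero, coordIter_zero]

/-- Integrality of `x/z` and `y/z` excludes `z = 0`, as all coordinates would then vanish;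
integrality of `z/y` excludes `y = 0`. For later iterates, the integral inverse of `tau (i+1)` keeps
the first coordinate nonzero. -/
lemma coordIter_ne_zero_of_mem_graph (hn : 1 ≤ n) {R : P2 Qbar × P2 Qbar}
    (hR : R ∈ graph (iter (fMap 4 2) n)) (hRU : R.2 ∈ branchSet n) :
    coordIter (n + 1) 2 R.1.rep ≠ 0 := by
  have hrep : ∀ i, eval R.1.rep (X i) = R.1.rep i := fun i => eval_X i
  have hC0 : ∀ R' ∈ chainSet n, R'.1.rep 2 ≠ 0 := fun R' hR' => by
    have := coordIter_two_ne_zero hR' (Nat.zero_le _)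
    rwa [coordIter_zero] at this
  have hB0 : ∀ R' ∈ chainSet n, R'.1.rep 1 ≠ 0 := fun R' hR' => by
    have := (coordIter_ne_zero_of_le hR'.1 (Nat.zero_le _)).1
    rwa [coordIter_zero] at this
  have key := fun i => isIntegralElem_tau n (Nat.zero_le n) i (Nat.zero_le i)
  have hz : R.1.rep 2 ≠ 0 := by
    intro h2
    have h1 : eval R.1.rep (X 1) = 0 := by
      refine eval_eq_zero_of_isIntegralElem hR hRU (isHomogeneous_X _ 1) (isHomogeneous_X _ 2)
        (by simpa using hC0) ?_ (by simpa using h2)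
      simpa only [tau_zero, eval_X] using (key 0 (by omega)).1
    have h0 : eval R.1.rep (X 0) = 0 := by
      refine eval_eq_zero_of_isIntegralElem hR hRU (isHomogeneous_X _ 0) (isHomogeneous_X _ 2)
        (by simpa using hC0) ?_ (by simpa using h2)
      convert (key 1 (by omega)).1 using 1
      funext s
      rw [tau_one (coordIter_two_ne_zero s.2 (by omega)), eval_X, eval_X]
    refine R.1.rep_nonzero (funext fun i => ?_)
    rw [hrep] at h0 h1
    fin_cases i
    · exact h0
    · exact h1
    · exact h2
  have hy : R.1.rep 1 ≠ 0 := by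
    intro h1
    apply hz
    rw [← hrep]
    refine eval_eq_zero_of_isIntegralElem hR hRU (isHomogeneous_X _ 2) (isHomogeneous_X _ 1)
      (by simpa using hB0) ?_ (by simpa using h1)
    simpa only [tau_zero, eval_X, inv_div] using (key 0 (by omega)).2 (by omega)
  have hall : ∀ i ≤ n, coordIter i 1 R.1.rep ≠ 0 ∧ coordIter i 2 R.1.rep ≠ 0 := by
    intro i
    induction i with
    | zero =>
      intro _
      rw [coordIter_zero, coordIter_zero]
      exact ⟨hy, hz⟩
    | succ i ih =>
      intro hi
      obtain ⟨h1, h2⟩ := ih (by omega)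
      have htau : ∀ s : chainSet n, tau (i + 1) s.1.1 =
          coordIter i 0 s.1.1.rep / coordIter i 2 s.1.1.rep := fun s =>
        tau_succ (coordIter_two_ne_zero s.2 (by omega))
      have h0 : coordIter i 0 R.1.rep ≠ 0 := by
        intro h0
        apply h2
        refine eval_eq_zero_of_isIntegralElem hR hRU (coordIter_isHomogeneous i 2)
          (coordIter_isHomogeneous i 0) ?_ ?_ h0
        · intro R' hR' h
          refine tau_ne_zero hR'.1 hi ?_
          rw [htau ⟨R', hR'⟩]
          exact div_eq_zero_iff.mpr (Or.inl h)
        · convert (key (i + 1) (by omega)).2 hi using 1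
          funext s
          rw [htau s, inv_div]
          rfl
      rw [coordIter_succ_one, coordIter_succ_two]
      exact ⟨mul_ne_zero (mul_ne_zero h0 (pow_ne_zero _ h1)) h2,
        mul_ne_zero (pow_ne_zero _ h1) (pow_ne_zero _ h2)⟩
  exact coordIter_succ_two_ne_zero.mpr (hall n le_rfl)

lemma graph_inter_eq_chainSet (hn : 1 ≤ n) :
    graph (iter (fMap 4 2) n) ∩ Prod.snd ⁻¹' branchSet n = chainSet n := by
  ext R
  constructor
  · rintro ⟨hR, hRU⟩
    have hC := coordIter_ne_zero_of_mem_graph hn hR hRU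
    let O : Set (P2 Qbar × P2 Qbar) :=
      {R | coordIter (n + 1) 2 R.1.rep ≠ 0} ∩ Prod.snd ⁻¹' branchSet n
    have hO : IsOpen[(planeSq Qbar).top] O := TopologicalSpace.GenerateOpen.inter _ _
      (planeSq_isFractions.basic_isOpen (planeSqPairs_fst ⟨_, _, _, coordIter_isHomogeneous (n + 1) 2,
        coordIter_isHomogeneous (n + 1) 2, rfl⟩)) (isOpen_snd_preimage isOpen_branchSet)
    have hcoord : ∀ i, (planeSq Qbar).RegularOn O fun R => R.2.rep i / R.2.rep 2 := fun i =>
      regularOn_comp_snd (regularOn_coord_div i) fun _ hR => hR.2.1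
    have htau : ∀ i ≤ n + 1, (planeSq Qbar).RegularOn O fun R => tau i R.1 := fun i hi =>
      regularOn_comp_fst
        (regularOn_quotient (coordIter_isHomogeneous i 1) (coordIter_isHomogeneous i 2)) fun _ hR => by
          obtain rfl | hlt := Nat.eq_or_lt_of_le hi
          · exact hR.1
          · exact (coordIter_ne_zero_of_le hR.1 (Nat.lt_succ_iff.mp hlt)).2
    -- Equality of regular functions is a closed condition, so identities on `chainSet n` extend to
    -- the limit point.
    have hsub : ∀ j i, i ≤ n + 1 → (∀ R' ∈ chainSet n, R'.2.rep j / R'.2.rep 2 = tau i R'.1) →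
        R.2.rep j / R.2.rep 2 = tau i R.1 := by
      intro j i hi hR'
      by_contra hne
      obtain ⟨R', hmem, -, hne'⟩ := exists_mem_chainSet_ne_zero hR hRU hO ⟨hC, hRU⟩
        (planeSq_isFractions.add (hcoord j) (planeSq_isFractions.mul
          (planeSq_isFractions.const (-1)) (htau i hi)))
        (by
          intro h
          exact hne (by linear_combination h))
      exact hne' (by rw [hR' R' hmem]; ring)
    have h0 := hsub 0 (n + 1) le_rfl fun R' hR' => (snd_coords hR').1
    have h1 := hsub 1 n (by omega) fun R' hR' => (snd_coords hR').2
    refine ⟨hC, ?_, ?_⟩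
    · rw [← h0, ← h1]
      exact eq_affinePoint hRU.1
    · rw [← h0, ← h1]
      exact hRU.2
  · intro hR
    have hU := snd_mem_branchSet hR
    exact ⟨@subset_closure _ (planeSq Qbar).top _ _ ((sends_iter_iff_mem_chainSet hU).mpr hR), hU⟩

end GraphClosure

/-! ### Finiteness of the iterates over `branchSet n`. -/

section Finiteness

variable {n : ℕ}

lemma isFiniteMorphism_snd_chainSet (n : ℕ) :
    IsFiniteMorphism (planeSq Qbar) (plane Qbar) Prod.snd (chainSet n) (branchSet n) := by
  obtain ⟨H, hH⟩ := exists_branchPolynomial n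
  -- Coordinates `0, …, n + 1` carry the chain `tau`, and coordinate `n + 2` carries the inverse of
  -- `H`.
  let ι : ℕ → Fin (n + 3) := Fin.ofNat (n + 3)
  have hι : ∀ j, j < n + 3 → (ι j).1 = j := fun j hj => Nat.mod_eq_of_lt hj
  have hι' : ∀ i : Fin (n + 3), ι i.1 = i := fun i => Fin.ext (hι _ i.2)
  let I : Set (MvPolynomial (Fin (n + 3)) Qbar) :=
    {q | (∃ j < n, q = (X (ι (j + 2)) + C (1 / 2)) * X (ι j) ^ 2 - X (ι (j + 1)) ^ 4) ∨
      q = X (ι (n + 2)) * rename ![ι (n + 1), ι n] H - 1}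
  have hI : ∀ z : Fin (n + 3) → Qbar, (∀ q ∈ I, eval z q = 0) ↔
      (∀ j < n, (z (ι (j + 2)) + 1 / 2) * z (ι j) ^ 2 = z (ι (j + 1)) ^ 4) ∧
        z (ι (n + 2)) * eval ![z (ι (n + 1)), z (ι n)] H = 1 := by
    intro z
    have hcomp : z ∘ ![ι (n + 1), ι n] = ![z (ι (n + 1)), z (ι n)] := by
      funext i
      fin_cases i <;> rfl
    constructor
    · intro h
      refine ⟨fun j hj => ?_, ?_⟩
      · have := h _ (Or.inl ⟨j, hj, rfl⟩)
        simp only [map_sub, map_mul, map_add, map_pow, eval_X, eval_C] at this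
        exact sub_eq_zero.mp this
      · have := h _ (Or.inr rfl)
        simp only [map_sub, map_mul, eval_X, eval_rename, hcomp, map_one] at this
        exact sub_eq_zero.mp this
    · rintro ⟨h1, h2⟩ q (⟨j, hj, rfl⟩ | rfl)
      · simp only [map_sub, map_mul, map_add, map_pow, eval_X, eval_C]
        exact sub_eq_zero.mpr (h1 j hj)
      · simp only [map_sub, map_mul, eval_X, eval_rename, hcomp, map_one]
        exact sub_eq_zero.mpr h2
  let u : P2 Qbar × P2 Qbar → Fin (n + 3) → Qbar := fun R i =>
    if i.1 ≤ n + 1 then tau i.1 R.1 else (eval ![tau (n + 1) R.1, tau n R.1] H)⁻¹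
  have hu1 : ∀ R, ∀ j ≤ n + 1, u R (ι j) = tau j R.1 := fun R j hj => by
    simp only [u, hι j (by omega), if_pos hj]
  have hu2 : ∀ R, u R (ι (n + 2)) = (eval ![tau (n + 1) R.1, tau n R.1] H)⁻¹ := fun R => by
    simp only [u, hι (n + 2) (by omega)]
    exact if_neg (by omega)
  have hreg : ∀ i, (planeSq Qbar).RegularOn (chainSet n) fun R => u R i := by
    intro i
    by_cases hi : i.1 ≤ n + 1
    · exact (regularOn_tau hi).congr fun R _ => if_pos hi
    · refine (planeSq_isFractions.inv (planeSq_isFractions.eval_regular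
        (t := fun R : P2 Qbar × P2 Qbar => ![tau (n + 1) R.1, tau n R.1]) (fun l => ?_) H)
        fun R hR => (hH _ _).mpr hR.2.2).congr fun R _ => if_neg hi
      fin_cases l
      · exact regularOn_tau le_rfl
      · exact regularOn_tau (Nat.le_succ n)
  have hchain : ∀ z : Fin (n + 3) → Qbar, (∀ q ∈ I, eval z q = 0) →
      BranchesRegular n (z (ι (n + 1))) (z (ι n)) ∧
      coordIter (n + 1) 2 (affinePoint (z (ι 1)) (z (ι 0))).rep ≠ 0 ∧
      ∀ i ≤ n + 1, tau i (affinePoint (z (ι 1)) (z (ι 0))) = z (ι i) := by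
    intro z hz
    obtain ⟨h1, h2⟩ := (hI z).mp hz
    have hbr := (hH _ _).mp (right_ne_zero_of_mul_eq_one h2)
    have hne : ∀ i ≤ n, z (ι i) ≠ 0 := fun i hi =>
      (BranchesRegular.of_chain (z := fun j => z (ι j)) (i := i) (fun j _ hj => h1 j hj)
        hbr hi).ne_zero.1
    exact ⟨hbr, tau_affinePoint_chain (z := fun j => z (ι j)) hne h1⟩
  refine isFiniteMorphism_of_isIntegralElem planeSq_isFractions plane_isFractions
    (isMorphism_snd fun _ => snd_mem_branchSet) isAffine_branchSet I (u := u)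
    (v := fun z => (affinePoint (z (ι 1)) (z (ι 0)), affinePoint (z (ι (n + 1))) (z (ι n))))
    (planeSq_isFractions.isMorphism_affineSpace ?_ hreg) hreg
    (isMorphism_affinePoint_prod (affineSpace_isFractions _) (regularOn_coord _ _)
      (regularOn_coord _ _) (regularOn_coord _ _) (regularOn_coord _ _) ?_) ?_ ?_ ?_
  · intro R hR
    refine (hI _).mpr ⟨fun j hj => ?_, ?_⟩
    · rw [hu1 R _ (by omega), hu1 R _ (by omega), hu1 R _ (by omega)]
      exact tau_recurrence hR.1 hj
    · rw [hu2, hu1 R _ le_rfl, hu1 R _ (by omega)]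
      exact inv_mul_cancel₀ ((hH _ _).mpr hR.2.2)
  · intro z hz
    obtain ⟨hbr, hne, htau⟩ := hchain z hz
    refine ⟨hne, ?_, ?_⟩
    · change affinePoint _ _ = affinePoint (tau (n + 1) _) (tau n _)
      rw [htau _ le_rfl, htau _ (by omega)]
    · simp only [htau _ le_rfl, htau _ (Nat.le_succ n)]
      exact hbr
  · intro R hR
    have h0 := coordIter_two_ne_zero hR (Nat.zero_le _)
    rw [coordIter_zero] at h0
    have h1 := coordIter_two_ne_zero hR (show 1 ≤ n + 1 by omega)
    refine Prod.ext ?_ ?_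
    · change affinePoint (u R (ι 1)) (u R (ι 0)) = R.1
      rw [hu1 R _ (by omega), hu1 R _ (by omega), tau_one h1, tau_zero]
      exact (eq_affinePoint h0).symm
    · change affinePoint (u R (ι (n + 1))) (u R (ι n)) = R.2
      rw [hu1 R _ le_rfl, hu1 R _ (by omega)]
      exact hR.2.1.symm
  · intro z hz
    obtain ⟨-, -, htau⟩ := hchain z hz
    obtain ⟨-, h2⟩ := (hI z).mp hz
    funext i
    by_cases hi : i.1 ≤ n + 1
    · rw [← hι' i, hu1 _ _ hi, htau _ hi]
    · have : i = ι (n + 2) := by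
        rw [← hι' i]
        congr 1
        have := i.2
        omega
      rw [this, hu2, htau _ le_rfl, htau _ (by omega)]
      exact (eq_inv_of_mul_eq_one_left h2).symm
  · intro i
    by_cases hi : i.1 ≤ n + 1
    · simp only [u, if_pos hi]
      exact (isIntegralElem_tau n (Nat.zero_le n) i (Nat.zero_le _) hi).1
    · simp only [u, if_neg hi]
      refine isIntegralElem_of_regularOn (plane_isFractions.inv
        ((regularOn_affine_eval H).mono branchSet_subset_finitePart) fun Q hQ => (hH _ _).mpr hQ.2)
        fun s => ?_
      rw [(snd_coords s.2).1, (snd_coords s.2).2]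

lemma finiteOver_branchSet (hn : 1 ≤ n) : FiniteOver (iter (fMap 4 2) n) (branchSet n) := by
  have hg := graph_inter_eq_chainSet hn
  refine ⟨?_, fun R hR hRU hindet => ?_⟩
  · rw [hg]
    exact isFiniteMorphism_snd_chainSet n
  · have hmem : R ∈ chainSet n := hg ▸ ⟨hR, hRU⟩
    exact hindet ⟨_, (sends_iter_iff_mem_chainSet hRU).mpr hmem⟩

lemma mem_backLocus {a b : Qbar} (h : ∀ n, BranchesRegular n a b) :
    affinePoint a b ∈ backLocus (fMap 4 2) := fun n hn =>
  ⟨branchSet n, isOpen_branchSet, affinePoint_mem_branchSet.mpr (h n), finiteOver_branchSet hn⟩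

end Finiteness

end UnbddPreper

namespace UnbddPreper

/-! ### Absolute values along backward orbits -/

section Valuations

lemma absoluteValue_add_eq_of_lt {L : Type*} [Field L] {v : AbsoluteValue L ℝ}
    (hv : IsNonarchimedean v) {a b : L} (h : v a < v b) : v (a + b) = v b := by
  rw [IsNonarchimedean.add_eq_max_of_ne' v hv (fun a => (v.map_neg a).symm) h.ne, max_eq_right h.le]

/-- Pull back the norm of an algebraic closure of `ℚ_p` along an embedding of the algebraic numbers.
-/
lemma exists_padic_absoluteValue (p : ℕ) [Fact p.Prime] :
    ∃ v : AbsoluteValue Qbar ℝ, IsNonarchimedean v ∧ v p = (p : ℝ)⁻¹ := by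
  have : Algebra.IsAlgebraic ℚ Qbar := AlgebraicClosure.isAlgebraic ℚ
  let φ : Qbar →ₐ[ℚ] PadicAlgCl p := IsAlgClosed.lift
  refine ⟨(NormedField.toAbsoluteValue (PadicAlgCl p)).comp φ.injective, fun a b => ?_, ?_⟩
  · change ‖φ (a + b)‖ ≤ max ‖φ a‖ ‖φ b‖
    rw [map_add]
    exact PadicAlgCl.isNonarchimedean p _ _
  · change ‖φ p‖ = _
    rw [map_natCast]
    have := PadicAlgCl.norm_extends p (p : ℚ_[p])
    rw [map_natCast] at this
    rw [this, Padic.norm_p]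

/-- The condition `|a| = |b| = √2` is stable backwards: `|a| < |1/2| = 2` gives `|a + 1/2| = 2`, so
`|t|² = |b|⁴ / 2 = 2`. -/
lemma branchesRegular_of_absoluteValue {v : AbsoluteValue Qbar ℝ} (hv : IsNonarchimedean v)
    (h2 : v 2 = 2⁻¹) (n : ℕ) {a b : Qbar} (ha : v a ^ 2 = 2) (hb : v b ^ 2 = 2) :
    BranchesRegular n a b := by
  have hhalf : v (1 / 2) = 2 := by rw [map_div₀, map_one, h2]; norm_num
  have key : ∀ {a b : Qbar}, v a ^ 2 = 2 → v b ^ 2 = 2 →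
      b ≠ 0 ∧ v (a + 1 / 2) = 2 := by
    intro a b ha hb
    refine ⟨?_, ?_⟩
    · rintro rfl
      simp at hb
    · rw [absoluteValue_add_eq_of_lt hv, hhalf]
      rw [hhalf]
      exact lt_of_pow_lt_pow_left₀ 2 (by norm_num) (by rw [ha]; norm_num)
  have hne : ∀ {a : Qbar}, v (a + 1 / 2) = 2 → a + 1 / 2 ≠ 0 := by
    intro a h h0
    rw [h0, map_zero] at h
    norm_num at h
  induction n generalizing a b with
  | zero => exact ⟨(key ha hb).1, hne (key ha hb).2⟩
  | succ n ih =>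
    refine ⟨(key ha hb).1, hne (key ha hb).2, fun t ht => ih hb ?_⟩
    have := congrArg v ht
    rw [map_mul, map_pow, map_pow, (key ha hb).2] at this
    have h4 : v b ^ 4 = (v b ^ 2) ^ 2 := by ring
    rw [h4, hb] at this
    linarith

/-- The exponents of the absolute values along the orbit. -/
noncomputable def orbitExponent (n : ℕ) : ℝ :=
  ((1 + √2) * (1 + √2 / 2) ^ n + (1 - √2) * (1 - √2 / 2) ^ n) / 8

lemma orbitExponent_zero : orbitExponent 0 = 1 / 4 := by
  simp [orbitExponent]
  ring

lemma orbitExponent_one : orbitExponent 1 = 1 / 2 := by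
  have h : √2 ^ 2 = 2 := Real.sq_sqrt (by norm_num)
  simp only [orbitExponent, pow_one]
  linear_combination h / 8

lemma orbitExponent_add_two (n : ℕ) :
    orbitExponent (n + 2) = 2 * orbitExponent (n + 1) - orbitExponent n / 2 := by
  have h : √2 ^ 2 = 2 := Real.sq_sqrt (by norm_num)
  simp only [orbitExponent, pow_succ]
  linear_combination ((1 + √2) * (1 + √2 / 2) ^ n + (1 - √2) * (1 - √2 / 2) ^ n) / 32 * h

lemma orbitExponent_growth (n : ℕ) :
    0 < orbitExponent n ∧ 3 / 2 * orbitExponent n ≤ orbitExponent (n + 1) := by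
  induction n with
  | zero => rw [orbitExponent_zero, zero_add, orbitExponent_one]; norm_num
  | succ n ih =>
    rw [orbitExponent_add_two]
    constructor <;> linarith

lemma tendsto_orbitExponent : Tendsto orbitExponent atTop atTop := by
  have h : ∀ n : ℕ, 1 / 4 * (3 / 2 : ℝ) ^ n ≤ orbitExponent n := by
    intro n
    induction n with
    | zero => rw [orbitExponent_zero]; norm_num
    | succ n ih =>
      have := (orbitExponent_growth n).2
      rw [pow_succ]
      linarith
  exact tendsto_atTop_mono h
    ((tendsto_pow_atTop_atTop_of_one_lt (by norm_num)).const_mul_atTop (by norm_num))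

/-- Nontrivial integral linear forms in successive exponents are unbounded, since their growth rate
is irrational. -/
lemma tendsto_abs_linear_orbitExponent {m l : ℤ} (h : m ≠ 0 ∨ l ≠ 0) :
    Tendsto (fun n => |m * orbitExponent n + l * orbitExponent (n + 1)|) atTop atTop := by
  have h1 : 1 < √2 := by
    rw [Real.lt_sqrt (by norm_num)]; norm_num
  have h2 : √2 < 2 := by
    rw [Real.sqrt_lt' (by norm_num)]; norm_num
  set κ : ℝ := (1 + √2) * (m + l * (1 + √2 / 2)) / 8 with hκ
  set η : ℝ := (1 - √2) * (m + l * (1 - √2 / 2)) / 8 with hη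
  have hκ0 : κ ≠ 0 := by
    have hne : (m : ℝ) + l * (1 + √2 / 2) ≠ 0 := by
      intro h0
      by_cases hl : l = 0
      · subst hl
        simp at h0
        omega
      · have hl' : (l : ℝ) ≠ 0 := by exact_mod_cast hl
        apply irrational_sqrt_two
        -- Vanishing of `m + l (1 + √2/2)` with `l ≠ 0` would give this rational value of `√2`.
        refine ⟨-2 * (m + l) / l, ?_⟩
        push_cast
        field_simp
        linear_combination -2 * h0
    rw [hκ]
    have : 1 + √2 ≠ 0 := by positivity
    exact div_ne_zero (mul_ne_zero this hne) (by norm_num)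
  have hform : ∀ n, m * orbitExponent n + l * orbitExponent (n + 1) =
      κ * (1 + √2 / 2) ^ n + η * (1 - √2 / 2) ^ n := by
    intro n
    simp only [orbitExponent, hκ, hη, pow_succ]
    ring
  have hlow : ∀ n : ℕ, |κ| * (1 + √2 / 2) ^ n + -|η| ≤
      |m * orbitExponent n + l * orbitExponent (n + 1)| := by
    intro n
    rw [hform]
    have hμ : |η * (1 - √2 / 2) ^ n| ≤ |η| := by
      rw [abs_mul, abs_pow]
      refine mul_le_of_le_one_right (abs_nonneg _) (pow_le_one₀ (abs_nonneg _) ?_)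
      rw [abs_le]
      constructor <;> linarith
    have hpow : |κ * (1 + √2 / 2) ^ n| = |κ| * (1 + √2 / 2) ^ n := by
      rw [abs_mul, abs_of_nonneg (pow_nonneg (by linarith) n : 0 ≤ (1 + √2 / 2) ^ n)]
    have := abs_sub_abs_le_abs_sub (κ * (1 + √2 / 2) ^ n) (-(η * (1 - √2 / 2) ^ n))
    rw [abs_neg, sub_neg_eq_add] at this
    linarith
  refine tendsto_atTop_mono hlow (tendsto_atTop_add_const_right _ _ ?_)
  exact (tendsto_pow_atTop_atTop_of_one_lt (by linarith)).const_mul_atTop (abs_pos.mpr hκ0)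

/-- The absolute values above `3` along the orbit. -/
lemma log_absoluteValue_orbit {L : Type*} [Field L] [CharZero L] {v : AbsoluteValue L ℝ}
    (hv : IsNonarchimedean v) (h3 : v 3 < 1) {a : ℕ → L} {N : ℕ} (h0 : a 0 ^ 2 = a 0 + 1 / 2)
    (h2 : a 2 = -a 0) (h3' : a 3 = a 0)
    (hrel : ∀ j, j + 2 ≤ N → (a j + 1 / 2) * a (j + 2) ^ 2 = a (j + 1) ^ 4) (n : ℕ)
    (hn : n + 4 ≤ N) : Real.log (v (a (n + 4))) = orbitExponent n * -Real.log (v 3) := by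
  have h30 : 0 < v 3 := v.pos (by norm_num)
  have hℓ : 0 < -Real.log (v 3) := neg_pos.mpr (Real.log_neg h30 h3)
  have hv2 : v 2 = 1 := by
    have h1 : v (-1) = 1 := by rw [v.map_neg, map_one]
    have : (2 : L) = 3 + -1 := by norm_num
    rw [this, absoluteValue_add_eq_of_lt hv (by rwa [h1]), h1]
  have hhalf : v (1 / 2) = 1 := by rw [map_div₀, map_one, hv2, div_one]
  -- The equation of `a 0` says `(2 a₀ - 1)² = 3`.
  have hs : v (2 * a 0 - 1) ^ 2 = v 3 := by
    rw [← map_pow]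
    congr 1
    linear_combination 4 * h0
  have hs1 : v (2 * a 0 - 1) < 1 :=
    lt_of_pow_lt_pow_left₀ 2 (by norm_num) (by rw [hs, one_pow]; exact h3)
  have hs0 : v (2 * a 0 - 1) ≠ 0 := fun h => by
    rw [h] at hs
    norm_num at hs
    linarith
  have hlogs : 2 * Real.log (v (2 * a 0 - 1)) = Real.log (v 3) := by
    rw [← hs, Real.log_pow]
    norm_num
  have ha0half : v (a 0 + 1 / 2) = 1 := by
    have : a 0 + 1 / 2 = (2 * a 0 - 1 + 2) * (1 / 2) := by ring
    rw [this, map_mul, absoluteValue_add_eq_of_lt hv (by rwa [hv2]), hv2, hhalf, one_mul]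
  have ha0 : v (a 0) = 1 := by
    have : v (a 0) ^ 2 = 1 := by rw [← map_pow, h0, ha0half]
    exact (pow_eq_one_iff_of_nonneg (v.nonneg _) two_ne_zero).mp this
  -- The sign in `a 2 = -a 0` is what matters: `a 2 + 1/2 = -(2 a₀ - 1)/2` has absolute value
  -- `|3|^(1/2)`, so solving for `a 4` divides by a small number.
  have ha4 : 4 ≤ N → Real.log (v (a 4)) = 1 / 4 * -Real.log (v 3) := by
    intro hN
    have h := hrel 2 hN
    have h2half : a 2 + 1 / 2 = -((2 * a 0 - 1) * (1 / 2)) := by rw [h2]; ring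
    have h' := congrArg v h
    rw [h2half, h3', map_mul, map_pow, map_pow, v.map_neg, map_mul, hhalf, mul_one, ha0,
      one_pow] at h'
    have hne : v (a 4) ^ 2 ≠ 0 := right_ne_zero_of_mul_eq_one h'
    have hlog := congrArg Real.log h'
    rw [Real.log_mul hs0 hne, Real.log_pow, Real.log_one] at hlog
    push_cast at hlog
    linarith
  have ha5 : 5 ≤ N → Real.log (v (a 5)) = 1 / 2 * -Real.log (v 3) := by
    intro hN
    have h' := congrArg v (hrel 3 hN)
    rw [h3', map_mul, map_pow, map_pow, ha0half, one_mul] at h'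
    have hlog := congrArg Real.log h'
    rw [Real.log_pow, Real.log_pow, ha4 (by omega)] at hlog
    push_cast at hlog
    linarith
  induction n using Nat.strong_induction_on with
  | _ n ih =>
    match n, ih, hn with
    | 0, _, hn => rw [orbitExponent_zero]; exact ha4 hn
    | 1, _, hn => rw [orbitExponent_one]; exact ha5 hn
    | n + 2, ih, hn =>
      have e0 := ih n (by omega) (by omega)
      have e1 := ih (n + 1) (by omega) (by omega)
      have hgt : ∀ {x : ℝ} {m : ℕ}, 0 ≤ x → Real.log x = orbitExponent m * -Real.log (v 3) →
          1 < x := by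
        intro x m hx h
        have : 0 < Real.log x := h ▸ mul_pos (orbitExponent_growth m).1 hℓ
        exact (Real.log_pos_iff hx).mp this
      have g0 := hgt (v.nonneg _) e0
      have g1 := hgt (v.nonneg _) e1
      -- As `|a (n+4)| > 1 = |1/2|`, the shift by `1/2` is invisible and the recurrence becomes
      -- linear in logarithms.
      have h' := congrArg v (hrel (n + 4) hn)
      rw [map_mul, map_pow, map_pow, add_comm (a (n + 4)),
        absoluteValue_add_eq_of_lt hv (by rwa [hhalf])] at h'
      have hne : v (a (n + 4 + 2)) ^ 2 ≠ 0 := by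
        intro h0
        rw [h0, mul_zero] at h'
        exact pow_ne_zero 4 (zero_lt_one.trans g1).ne' h'.symm
      have hlog := congrArg Real.log h'
      rw [Real.log_mul (by linarith) hne, Real.log_pow, Real.log_pow, e0] at hlog
      have e1' : Real.log (v (a (n + 4 + 1))) = orbitExponent (n + 1) * -Real.log (v 3) := e1
      rw [e1'] at hlog
      change Real.log (v (a (n + 4 + 2))) = _
      rw [orbitExponent_add_two]
      push_cast at hlog
      linarith

end Valuations

end UnbddPreper

namespace UnbddPreper

/-! ### The backward orbit -/

section Density

/-- Far along the orbit the monomials of a given form have pairwise distinct absolute values, so by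
the ultrametric inequality the largest one is the absolute value of the sum, which is thus nonzero.
-/
lemma dense_range_affinePoint {v : AbsoluteValue Qbar ℝ} (hv : IsNonarchimedean v) {ℓ : ℝ}
    (hℓ : 0 < ℓ) {a : ℕ → Qbar} (ha : ∀ n, Real.log (v (a (n + 4))) = orbitExponent n * ℓ) :
    @Dense _ (plane Qbar).top (Set.range fun n => affinePoint (a n) (a (n + 1))) := by
  refine dense_of_forall_exists fun e B hB hB0 => ?_
  have hpos : ∀ n, v (a (n + 4)) ≠ 0 := fun n h => by
    have := mul_pos (orbitExponent_growth n).1 hℓ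
    rw [← ha n, h, Real.log_zero] at this
    exact lt_irrefl _ this
  let term : (Fin 3 →₀ ℕ) → ℕ → Qbar := fun m n =>
    coeff m B * ∏ i, (![a n, a (n + 1), 1] : Fin 3 → Qbar) i ^ m i
  have hterm : ∀ m ∈ B.support, ∀ n, v (term m (n + 4)) ≠ 0 ∧ Real.log (v (term m (n + 4))) =
      Real.log (v (coeff m B)) + (m 0 * orbitExponent n + m 1 * orbitExponent (n + 1)) * ℓ := by
    intro m hm n
    have hc : v (coeff m B) ≠ 0 := v.ne_zero (mem_support_iff.mp hm)
    have h0 := pow_ne_zero (m 0) (hpos n)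
    have h1 := pow_ne_zero (m 1) (hpos (n + 1))
    have he : v (term m (n + 4)) =
        v (coeff m B) * (v (a (n + 4)) ^ m 0 * v (a (n + 1 + 4)) ^ m 1) := by
      simp only [term, Fin.prod_univ_three, Matrix.cons_val, one_pow, mul_one, map_mul, map_pow]
    rw [he]
    refine ⟨mul_ne_zero hc (mul_ne_zero h0 h1), ?_⟩
    rw [Real.log_mul hc (mul_ne_zero h0 h1), Real.log_mul h0 h1, Real.log_pow, Real.log_pow, ha, ha]
    ring
  have hdeg : ∀ m ∈ B.support, m 0 + m 1 + m 2 = e := by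
    intro m hm
    have := hB (mem_support_iff.mp hm)
    simpa [Finsupp.weight_apply, Finsupp.sum_fintype, Fin.sum_univ_three] using this
  have hev : ∀ᶠ n in atTop, ∀ m ∈ B.support, ∀ m' ∈ B.support, m ≠ m' →
      v (term m (n + 4)) ≠ v (term m' (n + 4)) := by
    rw [eventually_all_finset]
    intro m hm
    rw [eventually_all_finset]
    intro m' hm'
    by_cases hne : m = m'
    · exact Eventually.of_forall fun n h => absurd hne h
    -- By homogeneity the exponent of the last variable, which is set to 1, is determined by the
    -- other two.
    have hne' : (m 0 : ℤ) - m' 0 ≠ 0 ∨ (m 1 : ℤ) - m' 1 ≠ 0 := by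
      by_contra! hcon
      apply hne
      have h1 := hdeg m hm
      have h2 := hdeg m' hm'
      ext i
      fin_cases i
      · change m 0 = m' 0
        omega
      · change m 1 = m' 1
        omega
      · change m 2 = m' 2
        omega
    have htend := tendsto_abs_linear_orbitExponent hne'
    filter_upwards [htend.eventually_gt_atTop
      (|Real.log (v (coeff m B)) - Real.log (v (coeff m' B))| / ℓ)] with n hn _ heq
    have hlog := congrArg Real.log heq
    rw [(hterm m hm n).2, (hterm m' hm' n).2] at hlog
    push_cast at hn
    have hx : ((m 0 - m' 0 : ℝ) * orbitExponent n + (m 1 - m' 1) * orbitExponent (n + 1)) =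
        -(Real.log (v (coeff m B)) - Real.log (v (coeff m' B))) / ℓ := by
      rw [eq_div_iff hℓ.ne']
      linear_combination hlog
    rw [hx, abs_div, abs_neg, abs_of_pos hℓ] at hn
    exact lt_irrefl _ hn
  obtain ⟨n, hn⟩ := hev.exists
  refine ⟨_, ⟨n + 4, rfl⟩, ?_⟩
  obtain ⟨c, hc, hrep⟩ := affinePoint_rep (a (n + 4)) (a (n + 4 + 1))
  rw [hrep, eval_smul_of_isHomogeneous hB]
  refine mul_ne_zero (pow_ne_zero _ hc) ?_
  rw [eval_eq']
  obtain ⟨m, hm, hmax⟩ := B.support.exists_max_image (fun m => v (term m (n + 4)))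
    (support_nonempty.mpr hB0)
  have hsum := IsNonarchimedean.apply_sum_eq_of_lt hv (fun a => (v.map_neg a).symm)
    (l := fun m => term m (n + 4)) hm
    fun m' hm' hne => lt_of_le_of_ne (hmax m' hm') (hn m' hm' m hm hne)
  intro h0
  have hsum' : v (∑ d ∈ B.support, term d (n + 4)) = 0 := (congrArg v h0).trans (map_zero v)
  rw [hsum] at hsum'
  exact (hterm m hm n).1 hsum'

end Density

/-! ### Lower bounds for heights from the places above 3. -/

section Heights

open NumberField Height

variable {K : Type*} [Field K] [NumberField K]

/-- The numbers 3 and `3⁻¹` have equal heights; for the first only archimedean places contribute,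
for the second only finite ones. -/
lemma finsum_posLog_inv_three :
    ∑ᶠ w : FinitePlace K, Real.posLog (w (3 : K)⁻¹) = Module.finrank ℚ K * Real.log 3 := by
  have hinf : ∀ w : InfinitePlace K, w (3 : K) = 3 := fun w => by
    rw [← InfinitePlace.norm_embedding_eq, map_ofNat]
    norm_num
  have hfin : ∀ w : FinitePlace K, w (3 : K) ≤ 1 := fun w => by
    have hw : IsNonarchimedean w.val := fun x y => FinitePlace.add_le w x y
    exact_mod_cast hw.apply_natCast_le_one (n := 3)
  have h1 := NumberField.logHeight₁_eq (3 : K)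
  have h2 := NumberField.logHeight₁_eq (3 : K)⁻¹
  rw [logHeight₁_inv] at h2
  have e1 : ∑ᶠ w : FinitePlace K, Real.posLog (w (3 : K)) = 0 := by
    rw [← finsum_zero (α := FinitePlace K)]
    refine finsum_congr fun w => ?_
    rw [Real.posLog_eq_zero_iff, abs_of_nonneg (apply_nonneg w _)]
    exact hfin w
  have e2 : ∑ w : InfinitePlace K, w.mult * Real.posLog (w (3 : K)⁻¹) = 0 := by
    refine Finset.sum_eq_zero fun w _ => ?_
    rw [map_inv₀, hinf, (Real.posLog_eq_zero_iff _).mpr, mul_zero]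
    rw [abs_of_pos] <;> norm_num
  have e3 : ∑ w : InfinitePlace K, w.mult * Real.posLog (w (3 : K)) =
      Module.finrank ℚ K * Real.log 3 := by
    rw [← InfinitePlace.sum_mult_eq, Nat.cast_sum, Finset.sum_mul]
    refine Finset.sum_congr rfl fun w _ => ?_
    rw [hinf, Real.posLog_eq_log]
    rw [abs_of_pos] <;> norm_num
  rw [e1, e3] at h1
  rw [e2] at h2
  linarith

lemma hasFiniteSupport_posLog {x : K} (hx : x ≠ 0) :
    Function.HasFiniteSupport fun w : FinitePlace K => Real.posLog (w x) := by
  refine (FinitePlace.hasFiniteMulSupport hx).subset fun w hw => ?_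
  intro h
  apply hw
  change Real.posLog (w x) = 0
  have h' : w x = 1 := h
  rw [h', Real.posLog_one]

/-- Every finite place with `w 3 < 1` contributes exactly `orbitExponent n` times its share for
`3⁻¹`; the other places contribute nonnegatively. -/
lemma le_logHeight₁_orbit {a : ℕ → K} {n : ℕ} (h0 : a 0 ^ 2 = a 0 + 1 / 2)
    (h2 : a 2 = -a 0) (h3 : a 3 = a 0)
    (hrel : ∀ j, j + 2 ≤ n + 4 → (a j + 1 / 2) * a (j + 2) ^ 2 = a (j + 1) ^ 4)
    (hne : a (n + 4) ≠ 0) :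
    orbitExponent n * (Module.finrank ℚ K * Real.log 3) ≤ logHeight₁ (a (n + 4)) := by
  have hpt : ∀ w : FinitePlace K, orbitExponent n * Real.posLog (w (3 : K)⁻¹) ≤
      Real.posLog (w (a (n + 4))) := by
    intro w
    by_cases hw : w (3 : K) < 1
    · have hv : IsNonarchimedean w.val := fun x y => FinitePlace.add_le w x y
      have hlog : Real.log (w (a (n + 4))) = orbitExponent n * -Real.log (w 3) :=
        log_absoluteValue_orbit hv hw h0 h2 h3 hrel n le_rfl
      have hw0 : 0 < w (3 : K) := FinitePlace.pos_iff.mpr (by norm_num)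
      rw [map_inv₀, Real.posLog_eq_log, Real.log_inv, ← hlog]
      · exact le_max_right _ _
      · rw [abs_of_pos (inv_pos.mpr hw0)]
        exact (one_le_inv₀ hw0).mpr hw.le
    · have : Real.posLog (w (3 : K)⁻¹) = 0 := by
        rw [Real.posLog_eq_zero_iff, abs_of_nonneg (apply_nonneg w _), map_inv₀]
        exact inv_le_one_of_one_le₀ (not_lt.mp hw)
      rw [this, mul_zero]
      exact Real.posLog_nonneg
  rw [← finsum_posLog_inv_three, mul_finsum, NumberField.logHeight₁_eq]
  have hsum : ∑ᶠ w : FinitePlace K, orbitExponent n * Real.posLog (w (3 : K)⁻¹) ≤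
      ∑ᶠ w : FinitePlace K, Real.posLog (w (a (n + 4))) := by
    refine finsum_le_finsum' ?_ (hasFiniteSupport_posLog hne) hpt
    refine (hasFiniteSupport_posLog (x := (3 : K)⁻¹) (by norm_num)).subset fun w hw h => hw ?_
    change _ * _ = _
    have h' : Real.posLog (w (3 : K)⁻¹) = 0 := h
    rw [h', mul_zero]
  have : 0 ≤ ∑ w : InfinitePlace K, w.mult * Real.posLog (w (a (n + 4))) :=
    Finset.sum_nonneg fun w _ => mul_nonneg (Nat.cast_nonneg _) Real.posLog_nonneg
  linarith

end Heights

/-! ### Construction of the backward orbit and its properties. -/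

section Orbit

/-- The field of an orbit point contains all earlier terms, since these are forward images. Hence
the bound applies over that field, and its degree cancels in the normalised height. -/
lemma le_naiveHeight {a : ℕ → Qbar} (h0 : a 0 ^ 2 = a 0 + 1 / 2) (h2 : a 2 = -a 0) (h3 : a 3 = a 0)
    (hrel : ∀ j, (a j + 1 / 2) * a (j + 2) ^ 2 = a (j + 1) ^ 4) (hne : ∀ j, a j ≠ 0) (n : ℕ) :
    orbitExponent n * Real.log 3 ≤ naiveHeight (affinePoint (a (n + 4)) (a (n + 4 + 1))) := by
  set P := affinePoint (a (n + 4)) (a (n + 4 + 1)) with hP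
  obtain ⟨hP2, hP0, hP1⟩ := affinePoint_coords (a (n + 4)) (a (n + 4 + 1))
  have hrepmem : ∀ i, P.rep i ∈ coordField P := fun i =>
    IntermediateField.subset_adjoin ℚ _ ⟨i, rfl⟩
  have hmem : ∀ j ≤ n + 4, a j ∈ coordField P ∧ a (j + 1) ∈ coordField P := by
    intro j hj
    induction hj using Nat.decreasingInduction with
    | self =>
      refine ⟨?_, ?_⟩
      · rw [← hP0]
        exact div_mem (hrepmem 0) (hrepmem 2)
      · rw [← hP1]
        exact div_mem (hrepmem 1) (hrepmem 2)
    | of_succ j hj ih =>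
      refine ⟨?_, ih.1⟩
      have h : a j = a (j + 1) ^ 4 / a (j + 2) ^ 2 - 1 / 2 := by
        rw [← hrel j, mul_div_cancel_right₀ _ (pow_ne_zero 2 (hne _))]
        ring
      rw [h]
      exact sub_mem (div_mem (pow_mem ih.1 _) (pow_mem ih.2 _))
        (div_mem (one_mem _) (ofNat_mem _ 2))
  obtain ⟨b, hb⟩ : ∃ b : ℕ → coordField P, ∀ j ≤ n + 4, (b j : Qbar) = a j := by
    classical
    refine ⟨fun j => if h : j ≤ n + 4 then ⟨a j, (hmem j h).1⟩ else 0, fun j hj => ?_⟩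
    simp only [dif_pos hj]
  have hheight := le_logHeight₁_orbit (a := b) (n := n)
    (Subtype.ext (by push_cast; rw [hb 0 (by omega)]; exact h0))
    (Subtype.ext (by push_cast; rw [hb 0 (by omega), hb 2 (by omega)]; exact h2))
    (Subtype.ext (by rw [hb 0 (by omega), hb 3 (by omega)]; exact h3))
    (fun j hj => Subtype.ext (by
      push_cast
      rw [hb j (by omega), hb (j + 1) (by omega), hb (j + 2) (by omega)]
      exact hrel j))
    (fun h => hne (n + 4) (by rw [← hb (n + 4) le_rfl, h]; rfl))
  let r : Fin 3 → coordField P := fun i => ⟨P.rep i, hrepmem i⟩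
  have hquot : b (n + 4) = r 0 / r 2 := Subtype.ext (by
    rw [hb (n + 4) le_rfl]
    exact hP0.symm)
  have hle : Height.logHeight₁ (b (n + 4)) ≤ Height.logHeight r := by
    rw [hquot, Height.logHeight₁_div_eq_logHeight]
    have := Height.logHeight_comp_le ![(0 : Fin 3), 2] r
    have he : r ∘ ![(0 : Fin 3), 2] = ![r 0, r 2] := by
      funext i
      fin_cases i <;> rfl
    rwa [he] at this
  have hfin : (0 : ℝ) < Module.finrank ℚ (coordField P) := Nat.cast_pos.mpr Module.finrank_pos
  change _ ≤ Height.logHeight r / Module.finrank ℚ (coordField P)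
  rw [le_div_iff₀ hfin]
  linarith

lemma sends_affinePoint {a b t : Qbar} (h : (a + 1 / 2) * t ^ 2 = b ^ 4) (ht : t ≠ 0) :
    Sends (fMap 4 2) (affinePoint b t) (affinePoint a b) := by
  have he : (fun i => eval ![b, t, 1] (fMap 4 2 i)) = t ^ 2 • ![a, b, 1] := by
    funext i
    fin_cases i
    · change eval _ (fMap 4 2 0) = t ^ 2 * a
      rw [fMap_zero]
      simp
      linear_combination -h
    · change eval _ (fMap 4 2 1) = t ^ 2 * b
      rw [fMap_one]
      simp
      ring
    · change eval _ (fMap 4 2 2) = t ^ 2 * 1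
      rw [fMap_two]
      simp
  have hne : (fun i => eval ![b, t, 1] (fMap 4 2 i)) ≠ 0 := fun h0 => by
    have := congrFun (he.symm.trans h0) 2
    simp [ht] at this
  have := sends_mk (represents_fMap (d := 4) (p := 2) (by norm_num))
    (v := ![b, t, 1]) (fun h => one_ne_zero (congrFun h 2)) hne
  have hQ : Projectivization.mk Qbar _ hne = affinePoint a b := by
    rw [affinePoint, Projectivization.mk_eq_mk_iff']
    exact ⟨t ^ 2, he.symm⟩
  rwa [hQ] at this

/-- Both `α` and `-α` are admissible roots at the fixed point, because `α + 1/2 = α²`. The sequence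
leaves it through `-α`, returns to `α`, and is then continued by any choice of roots. -/
lemma exists_backward_sequence {α : Qbar} (hα : α ^ 2 = α + 1 / 2) :
    ∃ a : ℕ → Qbar, a 0 = α ∧ a 1 = α ∧ a 2 = -α ∧ a 3 = α ∧
      ∀ j, a j + 1 / 2 ≠ 0 → (a j + 1 / 2) * a (j + 2) ^ 2 = a (j + 1) ^ 4 := by
  -- The root exists even for a zero denominator, where division gives 0; the recurrence is
  -- therefore asserted only when `a j + 1/2 ≠ 0`.
  choose g hg using fun x : Qbar × Qbar =>
    IsAlgClosed.exists_pow_nat_eq (x.2 ^ 4 / (x.1 + 1 / 2)) two_pos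
  let q : ℕ → Qbar × Qbar := fun n => (fun x : Qbar × Qbar => (x.2, g x))^[n] (-α, α)
  have hq : ∀ n, q (n + 1) = ((q n).2, g (q n)) := fun n => Function.iterate_succ_apply' _ _ _
  let a : ℕ → Qbar := fun n => match n with
    | 0 => α
    | 1 => α
    | n + 2 => (q n).1
  have ha2 : ∀ n, a (n + 2) = (q n).1 := fun n => rfl
  have ha3 : ∀ n, a (n + 3) = (q n).2 := fun n => by
    rw [ha2 (n + 1), hq]
  refine ⟨a, rfl, rfl, rfl, ha3 0, fun j hj => ?_⟩
  match j, hj with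
  | 0, _ =>
    change (α + 1 / 2) * (-α) ^ 2 = α ^ 4
    rw [← hα]
    ring
  | 1, _ =>
    rw [ha3 0, ha2 0]
    change (α + 1 / 2) * α ^ 2 = (-α) ^ 4
    rw [← hα]
    ring
  | n + 2, hj =>
    have h4 : a (n + 2 + 2) = g (q n) := by
      rw [ha2 (n + 2), hq, hq]
    have h3 : a (n + 2 + 1) = (q n).2 := ha3 n
    rw [h4, h3, hg, ha2]
    rw [ha2] at hj
    rw [mul_div_cancel₀ _ hj]

theorem exists_backward_orbit {α : Qbar} (hα : α ^ 2 = α + 1 / 2) :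
    Sends (fMap 4 2) (affinePoint α α) (affinePoint α α) ∧
      affinePoint α α ∈ backLocus (fMap 4 2) ∧
      ∃ P : ℕ → P2 Qbar, P 0 = affinePoint α α ∧
        (∀ n, 1 ≤ n → P n ∉ indet (fMap 4 2) ∧ Sends (fMap 4 2) (P n) (P (n - 1))) ∧
        @Dense _ (plane Qbar).top (Set.range P) ∧
        Tendsto (fun n => naiveHeight (P n)) atTop atTop := by
  have : Fact (Nat.Prime 2) := ⟨Nat.prime_two⟩
  have : Fact (Nat.Prime 3) := ⟨Nat.prime_three⟩
  obtain ⟨v, hv, hv2⟩ := exists_padic_absoluteValue 2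
  obtain ⟨w, hw, hw3⟩ := exists_padic_absoluteValue 3
  norm_cast at hv2 hw3
  obtain ⟨a, ha0, ha1, ha2, ha3, hrel⟩ := exists_backward_sequence hα
  have hhalf : v (1 / 2) = 2 := by rw [map_div₀, map_one]; simp [hv2]
  -- In `α² - α = 1/2` the right side has 2-adic absolute value 2, which forces `|α| > 1`, so `α²`
  -- dominates.
  have hvα : v α ^ 2 = 2 := by
    have hgt : 1 < v α := by
      by_contra! hle
      have h1 : (1 / 2 : Qbar) = α ^ 2 + -α := by linear_combination -hα
      have h2 : v (1 / 2) ≤ 1 := by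
        rw [h1]
        refine (hv _ _).trans (max_le ?_ ?_)
        · rw [map_pow]
          exact pow_le_one₀ (v.nonneg _) hle
        · rwa [v.map_neg]
      rw [hhalf] at h2
      norm_num at h2
    have h1 : (1 / 2 : Qbar) = -α + α ^ 2 := by linear_combination -hα
    have hlt : v (-α) < v (α ^ 2) := by
      rw [v.map_neg, map_pow]
      nlinarith
    rw [← map_pow, ← absoluteValue_add_eq_of_lt hv hlt, ← h1, hhalf]
  have hshift : ∀ {x : Qbar}, v x ^ 2 = 2 → v (x + 1 / 2) = 2 := by
    intro x hx
    rw [absoluteValue_add_eq_of_lt hv, hhalf]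
    rw [hhalf]
    exact lt_of_pow_lt_pow_left₀ 2 (by norm_num) (by rw [hx]; norm_num)
  have hshift_ne : ∀ {x : Qbar}, v x ^ 2 = 2 → x + 1 / 2 ≠ 0 := by
    intro x hx h
    have := hshift hx
    rw [h, map_zero] at this
    norm_num at this
  have hva : ∀ n, v (a n) ^ 2 = 2 ∧ v (a (n + 1)) ^ 2 = 2 := by
    intro n
    induction n with
    | zero => exact ⟨by rw [ha0, hvα], by rw [zero_add, ha1, hvα]⟩
    | succ n ih =>
      refine ⟨ih.2, ?_⟩
      have h := congrArg v (hrel n (hshift_ne ih.1))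
      rw [map_mul, hshift ih.1, map_pow, map_pow] at h
      change v (a (n + 2)) ^ 2 = 2
      have h4 : v (a (n + 1)) ^ 4 = (v (a (n + 1)) ^ 2) ^ 2 := by ring
      rw [h4, ih.2] at h
      linarith
  have hrel' : ∀ j, (a j + 1 / 2) * a (j + 2) ^ 2 = a (j + 1) ^ 4 := fun j =>
    hrel j (hshift_ne (hva j).1)
  have hne : ∀ j, a j ≠ 0 := fun j h => by
    have := (hva j).1
    rw [h, map_zero] at this
    norm_num at this
  have h0 : a 0 ^ 2 = a 0 + 1 / 2 := by rw [ha0, hα]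
  have h2 : a 2 = -a 0 := by rw [ha0, ha2]
  have h3 : a 3 = a 0 := by rw [ha0, ha3]
  have hw3' : w 3 < 1 := by
    rw [show w 3 = 3⁻¹ by exact_mod_cast hw3]
    norm_num
  refine ⟨sends_affinePoint (by rw [← hα]; ring) (ha0 ▸ hne 0),
    mem_backLocus fun n => branchesRegular_of_absoluteValue hv (by exact_mod_cast hv2) n hvα hvα,
    fun n => affinePoint (a n) (a (n + 1)), by simp only [zero_add, ha0, ha1], ?_, ?_, ?_⟩
  · intro n hn
    obtain ⟨m, rfl⟩ := Nat.exists_eq_add_of_le' hn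
    have hs : Sends (fMap 4 2) (affinePoint (a (m + 1)) (a (m + 1 + 1)))
        (affinePoint (a m) (a (m + 1))) := sends_affinePoint (hrel' m) (hne _)
    exact ⟨fun h => h ⟨_, hs⟩, hs⟩
  · exact dense_range_affinePoint hw
      (neg_pos.mpr (Real.log_neg (w.pos (by norm_num)) hw3'))
      fun n => log_absoluteValue_orbit hw hw3' h0 h2 h3 (fun j _ => hrel' j) n le_rfl
  · rw [← tendsto_add_atTop_iff_nat 4]
    exact tendsto_atTop_mono (le_naiveHeight h0 h2 h3 hrel' hne)
      (tendsto_orbitExponent.atTop_mul_const (Real.log_pos (by norm_num)))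

end Orbit

end UnbddPreper

open UnbddPreper in
theorem theorem4p1 :
    (∀ d p : ℕ, 3 ≤ d → p.Prime →
      HasDynDegree (fMap d p) 1 d ∧ HasDynDegree (fMap d p) 2 2 ∧
        IsCohHyperbolic (fMap d p) 1) ∧
    (∀ s : Qbar, s ^ 2 = 3 →
      Sends (fMap 4 2) (affinePoint ((1 + s) / 2) ((1 + s) / 2))
        (affinePoint ((1 + s) / 2) ((1 + s) / 2)) ∧
      affinePoint ((1 + s) / 2) ((1 + s) / 2) ∈ backLocus (fMap 4 2) ∧
      ∃ P : ℕ → P2 Qbar, P 0 = affinePoint ((1 + s) / 2) ((1 + s) / 2) ∧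
        (∀ n, 1 ≤ n → P n ∉ indet (fMap 4 2) ∧ Sends (fMap 4 2) (P n) (P (n - 1))) ∧
        @Dense _ (plane Qbar).top (Set.range P) ∧
        Tendsto (fun n => naiveHeight (P n)) atTop atTop) := by
  refine ⟨fun d p hd hp => ⟨hasDynDegree_one hd hp, hasDynDegree_two hd, isCohHyperbolic_fMap hd hp⟩,
    fun s hs => exists_backward_orbit ?_⟩
  linear_combination hs / 4
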